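/- Consider piecewise holomorphic systems separated by the unit circle $\mathbb S^1$, $$\dot z=F^+(z)\ \ (|z|\ge 1),\qquad \dot z=F^-(z)\ \ (|z|\le 1),$$ where $F^\pm\in\mathbb C[z]$ are polynomials of degrees $n^\pm$. A closed orbit is a nonconstant periodic trajectory that meets $\mathbb S^1$ only at crossing points (points where $F^+$ and $F^-$ both point strictly outwards or both point strictly inwards, in the sense of Filippov). A limit cycle is a closed orbit that is isolated, with respect to the Hausdorff distance, among the closed orbits, and it is hyperbolic if the derivative of its Poincaré map does not have modulus $1$. Let $\mathcal L_{n^+,n^-}\in\mathbb N\cup\{\infty\}$ be the maximal number of limit cycles of such a system. For $p\in\mathbb S^1$ parametrize $\mathbb S^1\setminus\{-p\}$ by $c_p(x)=p\,\frac{1-ix}{1+ix}$, $x\in\mathbb R$. The point $p$ is a weak focus–weak focus of order $k\ge 2$ if $F^\pm(p)=0$, $\operatorname{Im}(F^\pm)'(p)>0$, and, for the half-return maps $g^+$ (of $\dot z=F^+(z)$, through $|z|>1$, from $c_p(r)$ to $c_p(-g^+(r))$) and $g^-$ (of $\dot z=F^-(z)$, through $|z|<1$, from $c_p(-r)$ to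 $c_p(g^-(r))$), defined for small $r>0$, the displacement function satisfies $$g^-(g^+(r))-r=V_k r^k+\mathcal O(r^{k+1})\quad (r\to0^+),\qquad V_k\neq0.$$ We say that $m$ hyperbolic limit cycles bifurcate from $p$ if for every $\varepsilon>0$ there are polynomials of the same degrees $n^\pm$, with coefficients $\varepsilon$-close to those of $F^\pm$, whose piecewise system has $m$ distinct hyperbolic limit cycles contained in the disc of radius $\varepsilon$ centred at $p$. Let $\mathcal L^0_{n^+,n^-}\in\mathbb N\cup\{\infty\}$ be the maximal number of hyperbolic limit cycles that bifurcate from a weak focus–weak focus on $\mathbb S^1$ (of any order $k\ge2$) of such a system. Then $\mathcal L^0_{n^+,n^-}\le\mathcal L_{n^+,n^-}$ for all $n^\pm$, and for $n^\pm\in\{1,2\}$ with $n^++n^-\le4$, $$\mathcal L^0_{n^+,n^-}\ge n^++n^-.$$ In particular $\mathcal L^0_{1,1}\ge2$, $\mathcal L^0_{1,2}\ge3$, $\mathcal L^0_{2,1}\ge3$ and $\mathcal L^0_{2,2}\ge4$. -/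

import Mathlib

open Polynomial Set Filter Topology Asymptotics

noncomputable section

namespace CircleHolo

/-- The point of the unit circle with parameter `x` in the Möbius chart centred at the point `p`
of the circle; for `p = i` it is `φ⁻¹(x) = (x + i) / (i x + 1)` with `φ(z) = (-z + i) / (i z - 1)`.
The map `φ` sends the exterior of the circle to the upper half-plane. -/
def circlePoint (p : ℂ) (x : ℝ) : ℂ :=
  p * (1 - Complex.I * x) / (1 + Complex.I * x)

/-- The radial component of the vector `v` at a point `z` of the unit circle. -/
def radial (z v : ℂ) : ℝ := (starRingEnd ℂ z * v).re

/-- `γ` is on `I` a trajectory of the piecewise system `ż = Fp(z)` for `|z| ≥ 1`, `ż = Fm(z)` for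
`|z| ≤ 1` that meets the circle only at crossing points (in Filippov's sense): there both fields
point strictly outwards, and `γ` passes from the field inside to the field outside, or both point
strictly inwards, and `γ` passes from the field outside to the field inside. -/
structure IsCrossingTrajectory (Fp Fm : ℂ[X]) (I : Set ℝ) (γ : ℝ → ℂ) : Prop where
  outside : ∀ t ∈ I, 1 < ‖γ t‖ → HasDerivWithinAt γ (Fp.eval (γ t)) I t
  inside : ∀ t ∈ I, ‖γ t‖ < 1 → HasDerivWithinAt γ (Fm.eval (γ t)) I t
  crossing : ∀ t ∈ I, ‖γ t‖ = 1 →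
    (0 < radial (γ t) (Fm.eval (γ t)) ∧ 0 < radial (γ t) (Fp.eval (γ t)) ∧
      HasDerivWithinAt γ (Fm.eval (γ t)) (I ∩ Iic t) t ∧
      HasDerivWithinAt γ (Fp.eval (γ t)) (I ∩ Ici t) t) ∨
    (radial (γ t) (Fm.eval (γ t)) < 0 ∧ radial (γ t) (Fp.eval (γ t)) < 0 ∧
      HasDerivWithinAt γ (Fp.eval (γ t)) (I ∩ Iic t) t ∧
      HasDerivWithinAt γ (Fm.eval (γ t)) (I ∩ Ici t) t)

/-- `γ` is a nonconstant periodic crossing trajectory with minimal period `T`. -/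
structure IsClosedOrbit (Fp Fm : ℂ[X]) (γ : ℝ → ℂ) (T : ℝ) : Prop where
  trajectory : IsCrossingTrajectory Fp Fm univ γ
  pos : 0 < T
  periodic : Function.Periodic γ T
  minimal : ∀ τ : ℝ, 0 < τ → Function.Periodic γ τ → T ≤ τ

/-- A (crossing) limit cycle: a closed orbit that is isolated, for the Hausdorff distance, among
the closed orbits. -/
def IsLimitCycle (Fp Fm : ℂ[X]) (Γ : Set ℂ) : Prop :=
  (∃ γ T, IsClosedOrbit Fp Fm γ T ∧ range γ = Γ) ∧
  ∃ ε : ℝ, 0 < ε ∧ ∀ γ T, IsClosedOrbit Fp Fm γ T →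
    Metric.hausdorffDist (range γ) Γ < ε → range γ = Γ

/-- `P` is the Poincaré map, on an arc of the circle around its point `q`, of a closed orbit of
minimal period `T` through `q`: the trajectory from the point with parameter `x` is at the point
with parameter `P x` after a time that is close to `T`. -/
def IsPoincareMap (Fp Fm : ℂ[X]) (q : ℂ) (T : ℝ) (P : ℝ → ℝ) : Prop :=
  P 0 = 0 ∧ ∃ τ : ℝ → ℝ, τ 0 = T ∧ ContinuousAt τ 0 ∧
    ∀ᶠ x in 𝓝 (0 : ℝ), 0 < τ x ∧ ∃ η : ℝ → ℂ,
      IsCrossingTrajectory Fp Fm (Icc 0 (τ x)) η ∧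
      η 0 = circlePoint q x ∧ η (τ x) = circlePoint q (P x)

/-- A hyperbolic limit cycle: the derivative of its Poincaré map is not of modulus one. -/
def IsHyperbolicLimitCycle (Fp Fm : ℂ[X]) (Γ : Set ℂ) : Prop :=
  IsLimitCycle Fp Fm Γ ∧
  ∃ (γ : ℝ → ℂ) (T : ℝ), IsClosedOrbit Fp Fm γ T ∧ range γ = Γ ∧ ‖γ 0‖ = 1 ∧
    ∃ (P : ℝ → ℝ) (μ : ℝ), IsPoincareMap Fp Fm (γ 0) T P ∧ HasDerivAt P μ 0 ∧ |μ| ≠ 1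

/-- Some solution of `ż = F(z)` goes in positive time from `a` to `b`, and all its points strictly
in between lie in `D`. -/
def Connects (F : ℂ[X]) (D : Set ℂ) (a b : ℂ) : Prop :=
  ∃ (γ : ℝ → ℂ) (τ : ℝ), 0 < τ ∧
    (∀ t ∈ Icc 0 τ, HasDerivWithinAt γ (F.eval (γ t)) (Icc 0 τ) t) ∧
    γ 0 = a ∧ γ τ = b ∧ ∀ t ∈ Ioo 0 τ, γ t ∈ D

/-- `g` is near `0` the half-return map of `ż = F(z)` outside the circle at `p`, from the arc of
positive parameters to the arc of negative parameters. -/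
def IsOuterHalfReturn (F : ℂ[X]) (p : ℂ) (g : ℝ → ℝ) : Prop :=
  Tendsto g (𝓝[>] 0) (𝓝[>] 0) ∧
  ∀ᶠ r in 𝓝[>] (0 : ℝ), Connects F {z | 1 < ‖z‖} (circlePoint p r) (circlePoint p (-g r))

/-- `g` is near `0` the half-return map of `ż = F(z)` inside the circle at `p`, from the arc of
negative parameters to the arc of positive parameters. -/
def IsInnerHalfReturn (F : ℂ[X]) (p : ℂ) (g : ℝ → ℝ) : Prop :=
  Tendsto g (𝓝[>] 0) (𝓝[>] 0) ∧
  ∀ᶠ r in 𝓝[>] (0 : ℝ), Connects F {z | ‖z‖ < 1} (circlePoint p (-r)) (circlePoint p (g r))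

/-- The point `p` of the unit circle is a weak focus–weak focus of order `k`: a zero of both
fields, of focus or center type for both (rotating in the positive sense), at which the
displacement function satisfies `Δ(r) = V r ^ k + O(r ^ (k + 1))` with `V ≠ 0`, and `k ≥ 2`, so
that the equilibrium is not already hyperbolic. -/
structure IsWeakFocus (Fp Fm : ℂ[X]) (p : ℂ) (k : ℕ) : Prop where
  mem_circle : ‖p‖ = 1
  outer_zero : Fp.eval p = 0
  inner_zero : Fm.eval p = 0
  outer_rot : 0 < (Fp.derivative.eval p).im
  inner_rot : 0 < (Fm.derivative.eval p).im
  two_le : 2 ≤ k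
  displacement : ∃ (gp gm : ℝ → ℝ) (V : ℝ), IsOuterHalfReturn Fp p gp ∧
    IsInnerHalfReturn Fm p gm ∧ V ≠ 0 ∧
    (fun r : ℝ => (gm (gp r) - r) - V * r ^ k) =O[𝓝[>] 0] (fun r : ℝ => r ^ (k + 1))

/-- `m` hyperbolic limit cycles bifurcate from `p`: arbitrarily small perturbations of the
coefficients, with the degrees kept, have `m` hyperbolic limit cycles arbitrarily close to `p`. -/
def Bifurcate (Fp Fm : ℂ[X]) (p : ℂ) (m : ℕ) : Prop :=
  ∀ ε : ℝ, 0 < ε → ∃ Gp Gm : ℂ[X],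
    Gp.natDegree = Fp.natDegree ∧ Gm.natDegree = Fm.natDegree ∧
    (∀ j, ‖Gp.coeff j - Fp.coeff j‖ < ε) ∧ (∀ j, ‖Gm.coeff j - Fm.coeff j‖ < ε) ∧
    ∃ C : Finset (Set ℂ), C.card = m ∧
      ∀ Γ ∈ C, IsHyperbolicLimitCycle Gp Gm Γ ∧ Γ ⊆ Metric.ball p ε

/-- The maximal number of limit cycles of a system whose outer and inner fields are polynomials of
degrees `np` and `nm`. -/
def maxLimitCycles (np nm : ℕ) : ℕ∞ :=
  ⨆ (Fp : ℂ[X]) (Fm : ℂ[X]) (_ : Fp.natDegree = np ∧ Fm.natDegree = nm),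
    {Γ : Set ℂ | IsLimitCycle Fp Fm Γ}.encard

/-- The maximal number of hyperbolic limit cycles that can bifurcate from a weak focus–weak focus
on the unit circle, for outer and inner fields of degrees `np` and `nm`. -/
def maxBifurcating (np nm : ℕ) : ℕ∞ :=
  ⨆ (m : ℕ) (_ : ∃ (Fp Fm : ℂ[X]) (p : ℂ) (k : ℕ), Fp.natDegree = np ∧ Fm.natDegree = nm ∧
    IsWeakFocus Fp Fm p k ∧ Bifurcate Fp Fm p m), (m : ℕ∞)

end CircleHolo

end

/-! The comparison of the two maxima is immediate: limit cycles that bifurcate are limit cycles of a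
perturbed system of the same degrees. The lower bounds come from explicit families whose half-return
maps satisfy an exact equation.

In the chart `z = cayley ζ` centred at `1` the exterior of the circle is the upper half-plane. A
field `(α + i)(ζ - δ)(1 + d ζ)/(1 + d δ)` becomes a polynomial of degree 2 in `z`, and of degree 1
when `d = i`. Integrating `dt` by partial fractions and multiplying by `1 + α i`, which makes the
rate of change purely imaginary, gives a real first integral. On the real line it is `I(x) = log|x -
δ| - Re((1 + α i) log(1 + d x))`. A half turn changes the argument of `ζ - δ` by `π`, so the outer
arc from `r` to `-s` exists when `I(-s) = I(r) + α π`, and the inner arc from `-s` back to `r`, with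
data `β, δ, d`, when `I(r) = I(-s) + β π`.

Let `Δ` be the inner first integral minus the outer one (whose zero is kept at `0`). A closed orbit
then satisfies `Δ(-s) - Δ(r) + (α + β) π = 0`. Near `0`, `Δ` is `log((x - δ)/x)` plus a power series
whose coefficients are, up to the factors `(-1)^(j+1)/j`, the numbers `diffCoeff`. If `β = -α`, `δ =
0` and the first nonzero `diffCoeff` has index `n`, then the displacement has order `n + 1`. Its
leading coefficient contains `(-q)^n - 1` with `q = e^(α π)`, which is nonzero since `α ≠ 0`.

To unfold, put `β = -α + b e^n`, `δ = δ₀ e^(n+1)`, let the `j`-th coefficient be of size `X_j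
e^(n-j)`, and set `r = e ρ`, so that `s ≈ q e ρ`. After division by `e^n` the closing equation tends
to `L(-qρ) - L(ρ) + b π = 0`, where `L(y) = -δ₀/y + Σ (-1)^(j+1) X_j y^j / j`. This is a combination
of `ρ⁻¹, 1, ρ, ..., ρ^n`. Its coefficients can be chosen so that its zeros are `1, ..., n + 1`, all
simple. Each simple zero persists for small `e`, by `exists_root_of_tendsto_deriv`, and gives a
cycle with multiplier different from one. The choices `n = 1, 2, 2, 3` for degrees `(1,1), (1,2),
(2,1), (2,2)` give the bounds.

The rest is the passage from solved equations to limit cycles in the sense of the definitions: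
`spiral_pos` shows that an arc stays on its side of the circle, and `IsClosedOrbit.isolated` shows
that multiplier different from one in modulus implies isolation in the Hausdorff distance. -/

/-! ### Crossing trajectories -/

noncomputable section

namespace CircleHolo

/-- The field that a crossing trajectory follows immediately after it is at `z`. -/
def rightField (Fp Fm : ℂ[X]) (z : ℂ) : ℂ :=
  open Classical in
  if 1 < ‖z‖ ∨ (‖z‖ = 1 ∧ 0 < radial z (Fp.eval z)) then Fp.eval z else Fm.eval z

/-- The field that a crossing trajectory follows immediately before it is at `z`. -/
def leftField (Fp Fm : ℂ[X]) (z : ℂ) : ℂ :=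
  open Classical in
  if 1 < ‖z‖ ∨ (‖z‖ = 1 ∧ radial z (Fp.eval z) < 0) then Fp.eval z else Fm.eval z

/-- The point `z` is off the circle, or it is a crossing point. -/
def IsRegular (Fp Fm : ℂ[X]) (z : ℂ) : Prop :=
  ‖z‖ = 1 → (0 < radial z (Fm.eval z) ∧ 0 < radial z (Fp.eval z)) ∨
    (radial z (Fm.eval z) < 0 ∧ radial z (Fp.eval z) < 0)

variable {Fp Fm : ℂ[X]}

/-- Off the circle the two one-sided fields coincide, and at a crossing point they are the fields of
the two sides. In this form shifting, gluing and periodising reduce to separate checks of right and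
left derivatives, with no matching of velocities at a junction. -/
theorem isCrossingTrajectory_iff {I : Set ℝ} {γ : ℝ → ℂ} :
    IsCrossingTrajectory Fp Fm I γ ↔ ∀ t ∈ I, IsRegular Fp Fm (γ t) ∧
      HasDerivWithinAt γ (rightField Fp Fm (γ t)) (I ∩ Ici t) t ∧
      HasDerivWithinAt γ (leftField Fp Fm (γ t)) (I ∩ Iic t) t := by
  have hI : ∀ t, (I ∩ Ici t) ∪ (I ∩ Iic t) = I := fun t => by
    rw [← inter_union_distrib_left, union_comm, Iic_union_Ici, inter_univ]
  constructor
  · intro h t ht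
    rcases lt_trichotomy ‖γ t‖ 1 with h1 | h1 | h1
    · have := h.inside t ht h1
      refine ⟨fun h2 => absurd h2 h1.ne, ?_, ?_⟩
      · rw [rightField, if_neg (by rintro (h | h) <;> linarith [h])]
        · exact this.mono inter_subset_left
      · rw [leftField, if_neg (by rintro (h | h) <;> linarith [h])]
        · exact this.mono inter_subset_left
    · rcases h.crossing t ht h1 with ⟨a, b, c, d⟩ | ⟨a, b, c, d⟩
      · refine ⟨fun _ => Or.inl ⟨a, b⟩, ?_, ?_⟩
        · rwa [rightField, if_pos (Or.inr ⟨h1, b⟩)]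
        · rwa [leftField, if_neg (by rintro (h | h) <;> linarith [h])]
      · refine ⟨fun _ => Or.inr ⟨a, b⟩, ?_, ?_⟩
        · rwa [rightField, if_neg (by rintro (h | h) <;> linarith [h])]
        · rwa [leftField, if_pos (Or.inr ⟨h1, b⟩)]
    · have := h.outside t ht h1
      refine ⟨fun h2 => absurd h2 h1.ne', ?_, ?_⟩
      · rw [rightField, if_pos (Or.inl h1)]
        exact this.mono inter_subset_left
      · rw [leftField, if_pos (Or.inl h1)]
        exact this.mono inter_subset_left
  · intro h
    refine ⟨fun t ht h1 => ?_, fun t ht h1 => ?_, fun t ht h1 => ?_⟩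
    · obtain ⟨-, a, b⟩ := h t ht
      rw [rightField, if_pos (Or.inl h1)] at a
      rw [leftField, if_pos (Or.inl h1)] at b
      exact hI t ▸ a.union b
    · obtain ⟨-, a, b⟩ := h t ht
      rw [rightField, if_neg (by rintro (h | h) <;> linarith [h])] at a
      rw [leftField, if_neg (by rintro (h | h) <;> linarith [h])] at b
      exact hI t ▸ a.union b
    · obtain ⟨c, a, b⟩ := h t ht
      rcases c h1 with c | c
      · rw [rightField, if_pos (Or.inr ⟨h1, c.2⟩)] at a
        rw [leftField, if_neg (by rintro (h | h) <;> linarith [h])] at b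
        exact Or.inl ⟨c.1, c.2, b, a⟩
      · rw [rightField, if_neg (by rintro (h | h) <;> linarith [h])] at a
        rw [leftField, if_pos (Or.inr ⟨h1, c.2⟩)] at b
        exact Or.inr ⟨c.1, c.2, b, a⟩

theorem IsCrossingTrajectory.mono {I J : Set ℝ} {γ : ℝ → ℂ}
    (h : IsCrossingTrajectory Fp Fm I γ) (hJ : J ⊆ I) : IsCrossingTrajectory Fp Fm J γ := by
  rw [isCrossingTrajectory_iff] at h ⊢
  intro t ht
  obtain ⟨a, b, c⟩ := h t (hJ ht)
  exact ⟨a, b.mono (inter_subset_inter_left _ hJ), c.mono (inter_subset_inter_left _ hJ)⟩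

theorem IsCrossingTrajectory.continuousOn {I : Set ℝ} {γ : ℝ → ℂ}
    (h : IsCrossingTrajectory Fp Fm I γ) : ContinuousOn γ I := by
  rw [isCrossingTrajectory_iff] at h
  intro t ht
  obtain ⟨-, b, c⟩ := h t ht
  have := b.continuousWithinAt.union c.continuousWithinAt
  rwa [← inter_union_distrib_left, union_comm, Iic_union_Ici, inter_univ] at this

theorem hasDerivWithinAt_comp_add_const {f : ℝ → ℂ} {v : ℂ} {s u : Set ℝ} {t a t' : ℝ}
    (h : HasDerivWithinAt f v s t') (ht : t' = t + a) (hu : ∀ x ∈ u, x + a ∈ s) :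
    HasDerivWithinAt (fun x => f (x + a)) v u t := by
  subst ht
  have := HasDerivWithinAt.scomp t h ((hasDerivWithinAt_id t u).add_const a) hu
  simpa [Function.comp_def] using this

theorem IsCrossingTrajectory.comp_add {γ : ℝ → ℂ} (h : IsCrossingTrajectory Fp Fm univ γ)
    (a : ℝ) : IsCrossingTrajectory Fp Fm univ (fun t => γ (t + a)) := by
  rw [isCrossingTrajectory_iff] at h ⊢
  intro t _
  obtain ⟨h1, b, c⟩ := h (t + a) (mem_univ _)
  refine ⟨h1, hasDerivWithinAt_comp_add_const b rfl ?_, hasDerivWithinAt_comp_add_const c rfl ?_⟩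
  · rintro x ⟨-, hx⟩
    exact ⟨mem_univ _, by simpa using hx⟩
  · rintro x ⟨-, hx⟩
    exact ⟨mem_univ _, by simpa using hx⟩

theorem inner_eq_radial (z v : ℂ) : inner ℝ z v = radial z v := by
  rw [radial, Complex.inner, mul_comm]

/-- A curve that leaves a point of the circle with a velocity that points outwards is outside the
circle for a while. -/
theorem eventually_one_lt_norm {η : ℝ → ℂ} {v : ℂ} {t : ℝ} (h : HasDerivWithinAt η v (Ici t) t)
    (h1 : ‖η t‖ = 1) (hv : 0 < radial (η t) v) : ∀ᶠ x in 𝓝[>] t, 1 < ‖η x‖ := by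
  have h2 := (h.norm_sq.mono Ioi_subset_Ici_self)
  rw [hasDerivWithinAt_iff_tendsto_slope' (by simp)] at h2
  have h3 := h2.eventually (lt_mem_nhds (show 0 < 2 * inner ℝ (η t) v by
    rw [inner_eq_radial]; positivity))
  filter_upwards [h3, self_mem_nhdsWithin] with x hx hxt
  rw [slope_def_field, h1] at hx
  have : 0 < x - t := sub_pos.2 hxt
  have h4 : 0 < ‖η x‖ ^ 2 - 1 ^ 2 := by
    by_contra hc
    exact absurd hx (not_lt.2 (div_nonpos_of_nonpos_of_nonneg (not_lt.1 hc) this.le))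
  nlinarith [norm_nonneg (η x)]

theorem eventually_norm_lt_one {η : ℝ → ℂ} {v : ℂ} {t : ℝ} (h : HasDerivWithinAt η v (Ici t) t)
    (h1 : ‖η t‖ = 1) (hv : radial (η t) v < 0) : ∀ᶠ x in 𝓝[>] t, ‖η x‖ < 1 := by
  have h2 := (h.norm_sq.mono Ioi_subset_Ici_self)
  rw [hasDerivWithinAt_iff_tendsto_slope' (by simp)] at h2
  have h3 := h2.eventually (gt_mem_nhds (show 2 * inner ℝ (η t) v < 0 by
    rw [inner_eq_radial]; linarith))
  filter_upwards [h3, self_mem_nhdsWithin] with x hx hxt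
  rw [slope_def_field, h1] at hx
  have : 0 < x - t := sub_pos.2 hxt
  have h4 : ‖η x‖ ^ 2 - 1 ^ 2 < 0 := by
    by_contra hc
    exact absurd hx (not_lt.2 (div_nonneg (not_lt.1 hc) this.le))
  nlinarith [norm_nonneg (η x)]

theorem IsCrossingTrajectory.hasDerivWithinAt_Ici {T : ℝ} {η : ℝ → ℂ}
    (h : IsCrossingTrajectory Fp Fm (Icc 0 T) η) {t : ℝ} (ht : t ∈ Ico 0 T) :
    HasDerivWithinAt η (rightField Fp Fm (η t)) (Ici t) t := by
  rw [isCrossingTrajectory_iff] at h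
  refine (h t (Ico_subset_Icc_self ht)).2.1.mono_of_mem_nhdsWithin ?_
  have : Icc t T ⊆ Icc 0 T ∩ Ici t := fun x hx => ⟨⟨ht.1.trans hx.1, hx.2⟩, hx.1⟩
  exact mem_of_superset (Icc_mem_nhdsGE ht.2) this

/-- After a time `t` a crossing trajectory follows, for a while, one polynomial field that depends
only on its position at `t`. -/
theorem exists_field (z : ℂ) (hz : IsRegular Fp Fm z) : ∃ F : ℂ[X], ∀ (T t : ℝ) (η : ℝ → ℂ),
    IsCrossingTrajectory Fp Fm (Icc 0 T) η → t ∈ Ico 0 T → η t = z →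
      ∀ᶠ x in 𝓝[≥] t, HasDerivWithinAt η (F.eval (η x)) (Ici x) x := by
  have key : ∀ F : ℂ[X], (∀ (T t : ℝ) (η : ℝ → ℂ), IsCrossingTrajectory Fp Fm (Icc 0 T) η →
      t ∈ Ico 0 T → η t = z → ∀ᶠ x in 𝓝[≥] t, rightField Fp Fm (η x) = F.eval (η x)) →
      ∃ F : ℂ[X], ∀ (T t : ℝ) (η : ℝ → ℂ),
        IsCrossingTrajectory Fp Fm (Icc 0 T) η → t ∈ Ico 0 T → η t = z →
        ∀ᶠ x in 𝓝[≥] t, HasDerivWithinAt η (F.eval (η x)) (Ici x) x := by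
    intro F hF
    refine ⟨F, fun T t η h ht htz => ?_⟩
    filter_upwards [hF T t η h ht htz, Ico_mem_nhdsGE ht.2] with x hx hxT
    rw [← hx]
    exact h.hasDerivWithinAt_Ici ⟨ht.1.trans hxT.1, hxT.2⟩
  have hcont : ∀ (T t : ℝ) (η : ℝ → ℂ), IsCrossingTrajectory Fp Fm (Icc 0 T) η → t ∈ Ico 0 T →
      ContinuousWithinAt (fun x => ‖η x‖) (Ici t) t := fun T t η h ht =>
    (h.hasDerivWithinAt_Ici ht).continuousWithinAt.norm
  rcases lt_trichotomy ‖z‖ 1 with h1 | h1 | h1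
  · refine key Fm fun T t η h ht htz => ?_
    filter_upwards [(hcont T t η h ht).eventually (gt_mem_nhds (show ‖η t‖ < 1 by rwa [htz]))] with x hx
    rw [rightField, if_neg (by rintro (h | h) <;> linarith [h])]
  · rcases hz h1 with hr | hr
    · refine key Fp fun T t η h ht htz => ?_
      have h2 := h.hasDerivWithinAt_Ici ht
      rw [rightField, if_pos (by rw [htz]; exact Or.inr ⟨h1, hr.2⟩)] at h2
      have h3 := eventually_one_lt_norm h2 (by rw [htz]; exact h1) (by rw [htz]; exact hr.2)
      rw [eventually_nhdsWithin_iff] at h3 ⊢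
      filter_upwards [h3] with x hx hxt
      rcases (mem_Ici.1 hxt).eq_or_lt with rfl | hlt
      · rw [rightField, if_pos (by rw [htz]; exact Or.inr ⟨h1, hr.2⟩)]
      · rw [rightField, if_pos (Or.inl (hx hlt))]
    · refine key Fm fun T t η h ht htz => ?_
      have hn : ¬ (1 < ‖η t‖ ∨ (‖η t‖ = 1 ∧ 0 < radial (η t) (Fp.eval (η t)))) := by
        rw [htz]; rintro (h | h) <;> linarith [h]
      have h2 := h.hasDerivWithinAt_Ici ht
      rw [rightField, if_neg hn] at h2
      have h3 := eventually_norm_lt_one h2 (by rw [htz]; exact h1) (by rw [htz]; exact hr.1)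
      rw [eventually_nhdsWithin_iff] at h3 ⊢
      filter_upwards [h3] with x hx hxt
      rcases (mem_Ici.1 hxt).eq_or_lt with rfl | hlt
      · rw [rightField, if_neg hn]
      · rw [rightField, if_neg (by rintro (h | h) <;> linarith [h, hx hlt])]
  · refine key Fp fun T t η h ht htz => ?_
    filter_upwards [(hcont T t η h ht).eventually (lt_mem_nhds (show 1 < ‖η t‖ by rwa [htz]))] with x hx
    rw [rightField, if_pos (Or.inl hx)]

/-- Crossing trajectories are determined in forward time by their initial point. -/
theorem IsCrossingTrajectory.eqOn {T : ℝ} {η₁ η₂ : ℝ → ℂ}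
    (h₁ : IsCrossingTrajectory Fp Fm (Icc 0 T) η₁) (h₂ : IsCrossingTrajectory Fp Fm (Icc 0 T) η₂)
    (h0 : η₁ 0 = η₂ 0) : EqOn η₁ η₂ (Icc 0 T) := by
  change Icc 0 T ⊆ {t | η₁ t = η₂ t}
  -- Continuous induction on the closed set of agreement. From a common regular point both curves
  -- follow the same polynomial field for a while; it is locally Lipschitz, so the agreement extends
  -- to the right.
  refine IsClosed.Icc_subset_of_forall_exists_gt ?_ h0 ?_
  · have := (h₁.continuousOn.sub h₂.continuousOn).preimage_isClosed_of_isClosed isClosed_Icc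
      (isClosed_singleton (x := (0 : ℂ)))
    convert this using 1
    ext t
    simp [sub_eq_zero, and_comm]
  · rintro x ⟨hx, hxT⟩ y hy
    have hx' : η₁ x = η₂ x := hx
    have hreg : IsRegular Fp Fm (η₁ x) :=
      ((isCrossingTrajectory_iff.1 h₁) x (Ico_subset_Icc_self hxT)).1
    obtain ⟨F, hF⟩ := exists_field (η₁ x) hreg
    have e1 := hF T x η₁ h₁ hxT rfl
    have e2 := hF T x η₂ h₂ hxT hx'.symm
    obtain ⟨K, s, hs, hK⟩ := (show ContDiffAt ℂ 1 (fun z => F.eval z) (η₁ x) from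
      F.differentiable.contDiff.contDiffAt).exists_lipschitzOnWith
    have c1 := (h₁.hasDerivWithinAt_Ici hxT).continuousWithinAt.eventually hs
    have c2 := (h₂.hasDerivWithinAt_Ici hxT).continuousWithinAt.eventually
      (show ∀ᶠ z in 𝓝 (η₂ x), z ∈ s by rw [← hx']; exact hs)
    obtain ⟨b, hb, hsub⟩ := (mem_nhdsGE_iff_exists_Ico_subset).1 (e1.and (e2.and (c1.and c2)))
    have hb' : x < b := hb
    set m := min (min b T) y with hm
    have hxm : x < m := lt_min (lt_min hb' hxT.2) hy
    have hmT : m ≤ T := (min_le_left _ _).trans (min_le_right _ _)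
    have hmb : m ≤ b := (min_le_left _ _).trans (min_le_left _ _)
    have hIcc : Icc x m ⊆ Icc 0 T := Icc_subset_Icc hxT.1 hmT
    have hIco : ∀ t ∈ Ico x m, t ∈ Ico x b := fun t ht => ⟨ht.1, ht.2.trans_le hmb⟩
    have := ODE_solution_unique_of_mem_Icc_right (v := fun _ z => F.eval z) (s := fun _ => s)
      (K := K) (a := x) (b := m) (fun t _ => hK) (h₁.continuousOn.mono hIcc)
      (fun t ht => (hsub (hIco t ht)).1) (fun t ht => (hsub (hIco t ht)).2.2.1)
      (h₂.continuousOn.mono hIcc)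
      (fun t ht => (hsub (hIco t ht)).2.1) (fun t ht => (hsub (hIco t ht)).2.2.2) hx'
    exact ⟨m, this ⟨hxm.le, le_rfl⟩, hxm, min_le_right _ _⟩

/-- The curve `η₁` on `[0, a]`, followed by the curve `η₂`. -/
def concat (a : ℝ) (η₁ η₂ : ℝ → ℂ) (t : ℝ) : ℂ := if t ≤ a then η₁ t else η₂ (t - a)

theorem concat_of_le {a t : ℝ} (η₁ η₂ : ℝ → ℂ) (h : t ≤ a) : concat a η₁ η₂ t = η₁ t := if_pos h

theorem concat_of_ge {a t : ℝ} {η₁ η₂ : ℝ → ℂ} (h0 : η₁ a = η₂ 0) (h : a ≤ t) :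
    concat a η₁ η₂ t = η₂ (t - a) := by
  rcases h.eq_or_lt with rfl | h
  · rw [concat, if_pos le_rfl, h0, sub_self]
  · rw [concat, if_neg (not_le.2 h)]

theorem IsCrossingTrajectory.concat {a b : ℝ} {η₁ η₂ : ℝ → ℂ}
    (h₁ : IsCrossingTrajectory Fp Fm (Icc 0 a) η₁) (h₂ : IsCrossingTrajectory Fp Fm (Icc 0 b) η₂)
    (h0 : η₁ a = η₂ 0) :
    IsCrossingTrajectory Fp Fm (Icc 0 (a + b)) (concat a η₁ η₂) := by
  rw [isCrossingTrajectory_iff] at h₁ h₂ ⊢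
  intro t ht
  refine ⟨?_, ?_, ?_⟩
  · rcases le_total t a with h | h
    · rw [concat_of_le _ _ h]; exact (h₁ t ⟨ht.1, h⟩).1
    · rw [concat_of_ge h0 h]; exact (h₂ (t - a) ⟨by linarith, by linarith [ht.2]⟩).1
  · rcases lt_or_ge t a with h | h
    · rw [concat_of_le _ _ h.le]
      have h3 := ((h₁ t ⟨ht.1, h.le⟩).2.1.mono (show Icc t a ⊆ Icc 0 a ∩ Ici t from
        fun x hx => ⟨⟨ht.1.trans hx.1, hx.2⟩, hx.1⟩)).mono_of_mem_nhdsWithin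
        (mem_of_superset (Icc_mem_nhdsGE h) subset_rfl)
      refine (h3.congr_of_eventuallyEq ?_ (concat_of_le _ _ h.le)).mono inter_subset_right
      filter_upwards [Icc_mem_nhdsGE h] with x hx using concat_of_le _ _ hx.2
    · rw [concat_of_ge h0 h]
      have h3 := hasDerivWithinAt_comp_add_const (t := t) (a := -a) (u := Icc 0 (a + b) ∩ Ici t)
        (h₂ (t - a) ⟨by linarith, by linarith [ht.2]⟩).2.1 (by ring) (fun x hx =>
          ⟨⟨by linarith [hx.2.out], by linarith [hx.1.2]⟩, mem_Ici.2 (by linarith [hx.2.out])⟩)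
      exact h3.congr (fun x hx => concat_of_ge h0 (h.trans hx.2)) (concat_of_ge h0 h)
  · rcases le_or_gt t a with h | h
    · rw [concat_of_le _ _ h]
      refine ((h₁ t ⟨ht.1, h⟩).2.2.mono (fun x hx => ⟨⟨hx.1.1, hx.2.out.trans h⟩, hx.2⟩)).congr
        (fun x hx => concat_of_le _ _ (hx.2.out.trans h)) (concat_of_le _ _ h)
    · rw [concat_of_ge h0 h.le]
      have h3 := hasDerivWithinAt_comp_add_const (t := t) (a := -a) (u := Icc a t)
        (h₂ (t - a) ⟨by linarith, by linarith [ht.2]⟩).2.2 (by ring) (fun x hx =>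
          ⟨⟨by linarith [hx.1], by linarith [hx.2, ht.2]⟩, mem_Iic.2 (by linarith [hx.2])⟩)
      have h4 := h3.congr (f₁ := CircleHolo.concat a η₁ η₂) (fun x hx => concat_of_ge h0 hx.1)
        (concat_of_ge h0 h.le)
      exact (h4.mono_of_mem_nhdsWithin (Icc_mem_nhdsLE h)).mono inter_subset_right

/-- The extension with period `T` of the restriction of `η` to `[0, T)`. -/
def periodize {T : ℝ} (hT : 0 < T) (η : ℝ → ℂ) (t : ℝ) : ℂ := η (toIcoMod hT 0 t)

theorem periodize_periodic {T : ℝ} (hT : 0 < T) (η : ℝ → ℂ) :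
    Function.Periodic (periodize hT η) T := fun t => by
  rw [periodize, periodize, toIcoMod_add_right]

/-- The closed endpoint `s = T` is included because `η` closes up; this lets the left derivative at
multiples of `T` be read off at the end of `η`. -/
theorem periodize_eq {T : ℝ} (hT : 0 < T) {η : ℝ → ℂ} (h0 : η T = η 0) {t s : ℝ} {n : ℤ}
    (hs : s ∈ Icc 0 T) (hts : t = s + n • T) : periodize hT η t = η s := by
  rcases hs.2.eq_or_lt with h | h
  · have : toIcoMod hT 0 t = 0 :=
      (toIcoMod_eq_iff hT).2 ⟨by simp [hT], n + 1, by rw [hts, h]; simp; ring⟩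
    rw [periodize, this, h, h0]
  · have : toIcoMod hT 0 t = s := (toIcoMod_eq_iff hT).2 ⟨⟨hs.1, by simpa using h⟩, n, hts⟩
    rw [periodize, this]

theorem IsCrossingTrajectory.periodize {T : ℝ} (hT : 0 < T) {η : ℝ → ℂ}
    (h : IsCrossingTrajectory Fp Fm (Icc 0 T) η) (h0 : η T = η 0) :
    IsCrossingTrajectory Fp Fm univ (periodize hT η) := by
  rw [isCrossingTrajectory_iff] at h ⊢
  intro t _
  simp only [univ_inter]
  obtain ⟨⟨hs0, hsT⟩, n, hn⟩ := (toIcoMod_eq_iff hT (a := 0) (b := t)).1 rfl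
  -- The representative in `[0, T)` leaves room on its right and serves the right derivative; the
  -- one in `(0, T]` leaves room on its left and serves the left derivative.
  obtain ⟨⟨hu0, huT⟩, m, hm⟩ := (toIocMod_eq_iff hT (a := 0) (b := t)).1 rfl
  set s := toIcoMod hT 0 t
  set u := toIocMod hT 0 t
  rw [zero_add] at hsT huT
  have es : CircleHolo.periodize hT η t = η s := periodize_eq hT h0 ⟨hs0, hsT.le⟩ hn
  have eu : CircleHolo.periodize hT η t = η u := periodize_eq hT h0 ⟨hu0.le, huT⟩ hm
  refine ⟨es ▸ (h s ⟨hs0, hsT.le⟩).1, ?_, ?_⟩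
  · have h3 := hasDerivWithinAt_comp_add_const (t := t) (a := s - t) (u := Icc t (t + (T - s)))
      (h s ⟨hs0, hsT.le⟩).2.1 (by ring) (fun x hx =>
        ⟨⟨by linarith [hx.1], by linarith [hx.2]⟩, mem_Ici.2 (by linarith [hx.1])⟩)
    rw [es]
    refine (h3.congr (fun x hx => ?_) (by rw [es]; congr 1; ring)).mono_of_mem_nhdsWithin
      (Icc_mem_nhdsGE (by linarith))
    exact periodize_eq hT h0 (n := n) ⟨by linarith [hx.1], by linarith [hx.2]⟩ (by linarith)
  · have h3 := hasDerivWithinAt_comp_add_const (t := t) (a := u - t) (u := Icc (t - u) t)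
      (h u ⟨hu0.le, huT⟩).2.2 (by ring) (fun x hx =>
        ⟨⟨by linarith [hx.1], by linarith [hx.2]⟩, mem_Iic.2 (by linarith [hx.2])⟩)
    rw [eu]
    refine (h3.congr (fun x hx => ?_) (by rw [eu]; congr 1; ring)).mono_of_mem_nhdsWithin
      (Icc_mem_nhdsLE (by linarith))
    exact periodize_eq hT h0 (n := m) ⟨by linarith [hx.1], by linarith [hx.2]⟩ (by linarith)

end CircleHolo

end

/-! ### Points of the circle and isolation of closed orbits -/

noncomputable section

namespace CircleHolo

theorem one_add_I_mul_ne_zero (x : ℝ) : 1 + Complex.I * x ≠ 0 := fun h => by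
  have := congrArg Complex.re h
  simp at this

theorem one_sub_I_mul_ne_zero (x : ℝ) : 1 - Complex.I * x ≠ 0 := fun h => by
  have := congrArg Complex.re h
  simp at this

theorem norm_circlePoint (x : ℝ) : ‖circlePoint 1 x‖ = 1 := by
  have h : ‖1 - Complex.I * x‖ = ‖1 + Complex.I * x‖ := by
    rw [← Complex.norm_conj (1 + Complex.I * x)]
    simp [sub_eq_add_neg]
  rw [circlePoint, one_mul, norm_div, h, div_self (norm_ne_zero_iff.2 (one_add_I_mul_ne_zero x))]

/-- The parameter of a point of the unit circle in the chart centred at `1`. -/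
def circleParam (z : ℂ) : ℝ := (Complex.I * (z - 1) / (z + 1)).re

theorem circlePoint_add_one (x : ℝ) : circlePoint 1 x + 1 = 2 / (1 + Complex.I * x) := by
  rw [circlePoint]
  field_simp [one_add_I_mul_ne_zero x]
  ring

theorem circlePoint_ne_neg_one (x : ℝ) : circlePoint 1 x ≠ -1 := fun h => by
  have := circlePoint_add_one x
  rw [h, neg_add_cancel] at this
  exact (div_ne_zero two_ne_zero (one_add_I_mul_ne_zero x)) this.symm

theorem circleParam_circlePoint (x : ℝ) : circleParam (circlePoint 1 x) = x := by
  have h : Complex.I * (circlePoint 1 x - 1) / (circlePoint 1 x + 1) = x := by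
    rw [circlePoint_add_one, circlePoint]
    field_simp [one_add_I_mul_ne_zero x]
    linear_combination (-2 * (x : ℂ)) * Complex.I_sq
  rw [circleParam, h, Complex.ofReal_re]

theorem circlePoint_injective : Function.Injective (circlePoint 1) := fun x y h => by
  rw [← circleParam_circlePoint x, h, circleParam_circlePoint]

/-- On the unit circle conjugation is inversion, so the Möbius expression in `circleParam` is
already real and taking its real part loses nothing. -/
theorem circlePoint_circleParam {z : ℂ} (h1 : ‖z‖ = 1) (hz : z ≠ -1) :
    circlePoint 1 (circleParam z) = z := by
  have hz1 : z + 1 ≠ 0 := fun h => hz (eq_neg_of_add_eq_zero_left h)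
  have h0 : z ≠ 0 := norm_ne_zero_iff.1 (by rw [h1]; exact one_ne_zero)
  have hc : starRingEnd ℂ z = z⁻¹ := by
    rw [Complex.inv_def, Complex.normSq_eq_norm_sq, h1]; simp
  have hre : ((circleParam z : ℝ) : ℂ) = Complex.I * (z - 1) / (z + 1) := by
    rw [circleParam]
    refine Complex.conj_eq_iff_re.1 ?_
    have h2 : z⁻¹ + 1 ≠ 0 := by
      intro h
      apply hz1
      field_simp at h
      linear_combination h
    have h3 : 1 + z ≠ 0 := by rwa [add_comm]
    rw [map_div₀, map_mul, map_sub, map_add, map_one, Complex.conj_I, hc]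
    field_simp
    ring
  rw [circlePoint, hre]
  have h4 : 1 + Complex.I * (Complex.I * (z - 1) / (z + 1)) = 2 / (z + 1) := by
    field_simp
    linear_combination (z - 1) * Complex.I_sq
  rw [h4]
  field_simp
  linear_combination (1 - z) * Complex.I_sq

theorem continuousOn_circleParam : ContinuousOn circleParam {z | z ≠ -1} := by
  intro z hz
  have : z + 1 ≠ 0 := fun h => hz (eq_neg_of_add_eq_zero_left h)
  refine ContinuousAt.continuousWithinAt ?_
  refine Complex.continuous_re.continuousAt.comp ?_
  fun_prop (disch := assumption)

theorem continuous_circlePoint : Continuous (circlePoint 1) := by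
  unfold circlePoint
  have := one_add_I_mul_ne_zero
  fun_prop (disch := assumption)

/-- The change between the charts of the circle centred at `1` and at its point with
parameter `r`. -/
theorem circlePoint_circlePoint {r x : ℝ} (h : 1 - r * x ≠ 0) :
    circlePoint (circlePoint 1 r) x = circlePoint 1 ((r + x) / (1 - r * x)) := by
  -- With `x = tan θ` the point is `exp(-2iθ)`, so the identity is the addition formula of the
  -- tangent.
  have h1 := one_add_I_mul_ne_zero r
  have h2 := one_add_I_mul_ne_zero x
  have h3 := one_add_I_mul_ne_zero ((r + x) / (1 - r * x))
  have h4 : (1 - r * x : ℂ) ≠ 0 := by exact_mod_cast h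
  have h5 : (1 - r * x : ℂ) + Complex.I * (r + x) ≠ 0 := by
    intro h6
    apply h3
    push_cast
    field_simp
    rw [h6, mul_zero]
  simp only [circlePoint]
  push_cast
  field_simp
  linear_combination (2 * Complex.I * (r : ℂ) * x * (r + x)) * Complex.I_sq

variable {Fp Fm : ℂ[X]}

theorem IsClosedOrbit.continuous {γ : ℝ → ℂ} {T : ℝ} (h : IsClosedOrbit Fp Fm γ T) :
    Continuous γ :=
  continuousOn_univ.1 h.trajectory.continuousOn

theorem IsClosedOrbit.isCompact_range {γ : ℝ → ℂ} {T : ℝ} (h : IsClosedOrbit Fp Fm γ T) :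
    IsCompact (range γ) :=
  h.periodic.compact_of_continuous h.pos.ne' h.continuous

/-- Periodicity moves any point of `γ` to a time after `t`, so forward uniqueness from the common
point is enough. -/
theorem IsClosedOrbit.range_subset {γ γ' : ℝ → ℂ} {T T' : ℝ} (h : IsClosedOrbit Fp Fm γ T)
    (h' : IsClosedOrbit Fp Fm γ' T') {t t' : ℝ} (ht : γ t = γ' t') : range γ ⊆ range γ' := by
  rintro _ ⟨x, rfl⟩
  obtain ⟨y, hy, hxy⟩ := h.periodic.exists_mem_Ico h.pos x t
  have := ((h.trajectory.comp_add t).mono (subset_univ (Icc 0 (y - t)))).eqOn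
    ((h'.trajectory.comp_add t').mono (subset_univ _)) (by simpa using ht)
    ⟨by linarith [hy.1], le_rfl⟩
  refine ⟨y - t + t', ?_⟩
  simp only [sub_add_cancel] at this
  rw [hxy, this]

/-- If a closed orbit passes through the initial point of a crossing trajectory, then it passes
through all its points. -/
theorem IsClosedOrbit.mem_range {γ η : ℝ → ℂ} {T τ : ℝ} (h : IsClosedOrbit Fp Fm γ T)
    (hη : IsCrossingTrajectory Fp Fm (Icc 0 τ) η) (hτ : 0 ≤ τ) (h0 : η 0 ∈ range γ) :
    η τ ∈ range γ := by
  obtain ⟨t, ht⟩ := h0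
  exact ⟨τ + t, ((h.trajectory.comp_add t).mono (subset_univ (Icc 0 τ))).eqOn hη
    (by simpa using ht) ⟨hτ, le_rfl⟩⟩

/-- The complement of the circle together with two small arcs is an open set that contains the
compact set `Γ`, hence it contains a uniform thickening of `Γ`. -/
theorem exists_forall_near_circlePoint {Γ : Set ℂ} (hΓ : IsCompact Γ) {r s e : ℝ} (he : 0 < e)
    (hcirc : ∀ z ∈ Γ, ‖z‖ = 1 → z = circlePoint 1 r ∨ z = circlePoint 1 (-s)) :
    ∃ ε > 0, ∀ z w, ‖z‖ = 1 → w ∈ Γ → dist z w < ε →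
      ∃ x, z = circlePoint 1 x ∧ (|x - r| < e ∨ |x + s| < e) := by
  set V : Set ℂ := {z | z ≠ -1} ∩ circleParam ⁻¹' ({x | |x - r| < e} ∪ {x | |x + s| < e}) with hV
  have hVo : IsOpen V := by
    refine continuousOn_circleParam.isOpen_inter_preimage isOpen_ne ?_
    exact (isOpen_lt (by fun_prop) continuous_const).union
      (isOpen_lt (by fun_prop) continuous_const)
  have hW : IsOpen ({z : ℂ | ‖z‖ ≠ 1} ∪ V) :=
    (isOpen_ne_fun continuous_norm continuous_const).union hVo
  have hsub : Γ ⊆ {z : ℂ | ‖z‖ ≠ 1} ∪ V := by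
    intro z hz
    by_cases h1 : ‖z‖ = 1
    · right
      rcases hcirc z hz h1 with rfl | rfl
      · exact ⟨circlePoint_ne_neg_one _, Or.inl (by simp [circleParam_circlePoint, he])⟩
      · exact ⟨circlePoint_ne_neg_one _, Or.inr (by simp [circleParam_circlePoint, he])⟩
    · exact Or.inl h1
  obtain ⟨ε, hε, hth⟩ := hΓ.exists_thickening_subset_open hW hsub
  refine ⟨ε, hε, fun z w h1 hw hd => ?_⟩
  rcases hth (Metric.mem_thickening_iff.2 ⟨w, hw, hd⟩) with h | h
  · exact absurd h1 h
  · exact ⟨circleParam z, (circlePoint_circleParam h1 h.1).symm, h.2⟩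

/-- A map with a fixed point of multiplier of modulus different from one moves, near that point,
all points strictly closer or all points strictly away. -/
theorem eventually_closer_or_farther {P : ℝ → ℝ} {r μ : ℝ} (hP : HasDerivAt P μ r) (hr : P r = r)
    (hμ : |μ| ≠ 1) :
    (∀ᶠ y in 𝓝 r, y ≠ r → |P y - r| < |y - r|) ∨ (∀ᶠ y in 𝓝 r, y ≠ r → |y - r| < |P y - r|) := by
  have hlo := hasDerivAt_iff_isLittleO.1 hP
  rcases hμ.lt_or_gt with h | h
  · left
    filter_upwards [hlo.def (show 0 < (1 - |μ|) / 2 by linarith)] with y hy hne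
    have hpos : 0 < |y - r| := abs_pos.2 (sub_ne_zero.2 hne)
    simp only [Real.norm_eq_abs, smul_eq_mul, hr] at hy
    have h2 := abs_sub_abs_le_abs_sub (P y - r) ((y - r) * μ)
    rw [abs_mul] at h2
    nlinarith
  · right
    filter_upwards [hlo.def (show 0 < (|μ| - 1) / 2 by linarith)] with y hy hne
    have hpos : 0 < |y - r| := abs_pos.2 (sub_ne_zero.2 hne)
    simp only [Real.norm_eq_abs, smul_eq_mul, hr] at hy
    have h2 := abs_sub_abs_le_abs_sub ((y - r) * μ) (P y - r)
    rw [abs_mul, abs_sub_comm ((y - r) * μ)] at h2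
    nlinarith

/-- A closed orbit that crosses the circle at two points, with a Poincaré map whose multiplier is
not of modulus one, is isolated among the closed orbits. -/
theorem IsClosedOrbit.isolated {γ : ℝ → ℂ} {T r s μ : ℝ} {P gm τ τm : ℝ → ℝ} {η ηm : ℝ → ℝ → ℂ}
    (hγ : IsClosedOrbit Fp Fm γ T) (hγ0 : γ 0 = circlePoint 1 r) (hr : 0 < r) (hs : 0 < s)
    (hcirc : ∀ z ∈ range γ, ‖z‖ = 1 → z = circlePoint 1 r ∨ z = circlePoint 1 (-s))
    (hin : ∃ t, ‖γ t‖ < 1) (hout : ∃ t, 1 < ‖γ t‖)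
    (hret : ∀ᶠ y in 𝓝 r, 0 < τ y ∧ IsCrossingTrajectory Fp Fm (Icc 0 (τ y)) (η y) ∧
      η y 0 = circlePoint 1 y ∧ η y (τ y) = circlePoint 1 (P y))
    (hback : ∀ᶠ y in 𝓝 s, 0 < τm y ∧ IsCrossingTrajectory Fp Fm (Icc 0 (τm y)) (ηm y) ∧
      ηm y 0 = circlePoint 1 (-y) ∧ ηm y (τm y) = circlePoint 1 (gm y))
    (hPpos : ∀ᶠ y in 𝓝 r, 0 < P y) (hgpos : ∀ᶠ y in 𝓝 s, 0 < gm y)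
    (hP : HasDerivAt P μ r) (hPr : P r = r) (hμ : |μ| ≠ 1) :
    ∃ ε : ℝ, 0 < ε ∧ ∀ γ' T', IsClosedOrbit Fp Fm γ' T' →
      Metric.hausdorffDist (range γ') (range γ) < ε → range γ' = range γ := by
  have hall : ∃ e > 0, e ≤ r ∧ e ≤ s ∧ (∀ y, |y - r| ≤ e → (0 < τ y ∧
      IsCrossingTrajectory Fp Fm (Icc 0 (τ y)) (η y) ∧ η y 0 = circlePoint 1 y ∧
      η y (τ y) = circlePoint 1 (P y)) ∧ 0 < P y) ∧ (∀ y, |y - s| < e → (0 < τm y ∧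
      IsCrossingTrajectory Fp Fm (Icc 0 (τm y)) (ηm y) ∧ ηm y 0 = circlePoint 1 (-y) ∧
      ηm y (τm y) = circlePoint 1 (gm y)) ∧ 0 < gm y) ∧
      ((∀ y, |y - r| ≤ e → y ≠ r → |P y - r| < |y - r|) ∨
        (∀ y, |y - r| ≤ e → y ≠ r → |y - r| < |P y - r|)) := by
    obtain ⟨e1, he1, h1⟩ := Metric.eventually_nhds_iff.1 (hret.and hPpos)
    obtain ⟨e2, he2, h2⟩ := Metric.eventually_nhds_iff.1 (hback.and hgpos)
    obtain ⟨e3, he3, h3⟩ : ∃ e > 0, (∀ y, dist y r < e → y ≠ r → |P y - r| < |y - r|) ∨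
        (∀ y, dist y r < e → y ≠ r → |y - r| < |P y - r|) := by
      rcases eventually_closer_or_farther hP hPr hμ with h | h
      · obtain ⟨e, he, h⟩ := Metric.eventually_nhds_iff.1 h
        exact ⟨e, he, Or.inl fun y hy => h hy⟩
      · obtain ⟨e, he, h⟩ := Metric.eventually_nhds_iff.1 h
        exact ⟨e, he, Or.inr fun y hy => h hy⟩
    refine ⟨min (min r s) (min e1 (min e2 e3)) / 2, by positivity, ?_, ?_, ?_, ?_, ?_⟩
    · have : min (min r s) (min e1 (min e2 e3)) ≤ r := by simp
      linarith
    · have : min (min r s) (min e1 (min e2 e3)) ≤ s := by simp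
      linarith
    · intro y hy
      have : min (min r s) (min e1 (min e2 e3)) ≤ e1 := by simp
      exact h1 (by rw [Real.dist_eq]; linarith)
    · intro y hy
      have : min (min r s) (min e1 (min e2 e3)) ≤ e2 := by simp
      exact h2 (by rw [Real.dist_eq]; linarith)
    · have : min (min r s) (min e1 (min e2 e3)) ≤ e3 := by simp
      rcases h3 with h3 | h3
      · exact Or.inl fun y hy => h3 y (by rw [Real.dist_eq]; linarith)
      · exact Or.inr fun y hy => h3 y (by rw [Real.dist_eq]; linarith)
  obtain ⟨e, he, her, hes, hr1, hs1, hmove⟩ := hall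
  obtain ⟨ε₁, hε₁, hnear⟩ := exists_forall_near_circlePoint hγ.isCompact_range he hcirc
  obtain ⟨ti, hti⟩ := hin
  obtain ⟨tu, hto⟩ := hout
  -- The last two bounds force every nearby closed orbit to have points in the closed disc and
  -- points outside the open disc, hence to meet the circle.
  refine ⟨min ε₁ (min (1 - ‖γ ti‖) (‖γ tu‖ - 1)), by
    simp only [lt_min_iff]; exact ⟨hε₁, by linarith, by linarith⟩, fun γ' T' hγ' hd => ?_⟩
  rw [lt_min_iff, lt_min_iff] at hd
  have hne : Metric.hausdorffEDist (range γ') (range γ) ≠ ⊤ :=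
    Metric.hausdorffEDist_ne_top_of_nonempty_of_bounded (range_nonempty _) (range_nonempty _)
      hγ'.isCompact_range.isBounded hγ.isCompact_range.isBounded
  have hpt : ∀ x, circlePoint 1 x ∈ range γ' → |x - r| < e ∨ |x + s| < e := by
    intro x hx
    obtain ⟨w, hw, hxw⟩ := Metric.exists_dist_lt_of_hausdorffDist_lt hx hd.1 hne
    obtain ⟨y, hy, h⟩ := hnear _ w (norm_circlePoint x) hw hxw
    rwa [circlePoint_injective hy]
  have hptpos : ∀ x, 0 < x → circlePoint 1 x ∈ range γ' → |x - r| < e := by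
    intro x hx0 hx
    rcases hpt x hx with h | h
    · exact h
    · have := (abs_lt.1 h).2
      linarith
  set X : Set ℝ := Icc (r - e) (r + e) ∩ circlePoint 1 ⁻¹' range γ' with hX
  have hXc : IsCompact X := isCompact_Icc.inter_right
    (hγ'.isCompact_range.isClosed.preimage continuous_circlePoint)
  have hXI : ∀ x ∈ X, |x - r| ≤ e := fun x hx =>
    abs_le.2 ⟨by linarith [hx.1.1], by linarith [hx.1.2]⟩
  have hmemX : ∀ x, 0 < x → circlePoint 1 x ∈ range γ' → x ∈ X := by
    intro x hx0 hx
    have := abs_lt.1 (hptpos x hx0 hx)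
    exact ⟨⟨by linarith [this.1], by linarith [this.2]⟩, hx⟩
  -- By the intermediate value theorem `γ'` meets the circle, near `r` or near `-s`; in the second
  -- case the inner arc carries the crossing to a positive parameter.
  have hXne : X.Nonempty := by
    obtain ⟨_, ⟨t1, rfl⟩, h1⟩ := Metric.exists_dist_lt_of_hausdorffDist_lt'
      (mem_range_self ti) hd.2.1 hne
    obtain ⟨_, ⟨t2, rfl⟩, h2⟩ := Metric.exists_dist_lt_of_hausdorffDist_lt'
      (mem_range_self tu) hd.2.2 hne
    have h1' : ‖γ' t1‖ ≤ 1 := by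
      have := norm_sub_norm_le (γ' t1) (γ ti)
      rw [← dist_eq_norm] at this
      linarith
    have h2' : 1 ≤ ‖γ' t2‖ := by
      have := norm_sub_norm_le (γ tu) (γ' t2)
      rw [← dist_eq_norm, dist_comm] at this
      linarith
    obtain ⟨t, ht⟩ := mem_range_of_exists_le_of_exists_ge hγ'.continuous.norm ⟨t1, h1'⟩ ⟨t2, h2'⟩
    obtain ⟨w, hw, hxw⟩ := Metric.exists_dist_lt_of_hausdorffDist_lt (mem_range_self t) hd.1 hne
    obtain ⟨x, hx, h | h⟩ := hnear _ w ht hw hxw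
    · refine ⟨x, hmemX x (by linarith [(abs_lt.1 h).1]) ⟨t, hx⟩⟩
    · obtain ⟨⟨hτ0, htr, h0, h1⟩, hpos⟩ := hs1 (-x) (by rw [abs_sub_comm]; convert h using 2; ring)
      refine ⟨gm (-x), hmemX _ hpos ?_⟩
      rw [← h1]
      exact hγ'.mem_range htr hτ0.le ⟨t, by rw [h0, neg_neg]; exact hx⟩
  have hXP : ∀ x ∈ X, P x ∈ X := by
    intro x hx
    obtain ⟨⟨hτ0, htr, h0, h1⟩, hpos⟩ := hr1 x (hXI x hx)
    refine hmemX _ hpos ?_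
    rw [← h1]
    exact hγ'.mem_range htr hτ0.le (by rw [h0]; exact hx.2)
  -- An extremal argument replaces the iteration of `P`: a point of `X` nearest to `r` (if `P`
  -- contracts) or farthest from `r` (if `P` expands) would be beaten by its own image unless it is
  -- `r`.
  have hrX : r ∈ X := by
    have hco : ContinuousOn (fun x : ℝ => |x - r|) X := by fun_prop
    rcases hmove with hmove | hmove
    · obtain ⟨x, hx, hmin⟩ := hXc.exists_isMinOn hXne hco
      by_cases hxr : x = r
      · exact hxr ▸ hx
      · exact absurd (hmove x (hXI x hx) hxr) (not_lt.2 (hmin (hXP x hx)))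
    · obtain ⟨x, hx, hmax⟩ := hXc.exists_isMaxOn hXne hco
      by_cases hxr : x = r
      · exact hxr ▸ hx
      · exact absurd (hmove x (hXI x hx) hxr) (not_lt.2 (hmax (hXP x hx)))
  obtain ⟨t, ht⟩ := hrX.2
  exact (hγ'.range_subset hγ (ht.trans hγ0.symm)).antisymm
    (hγ.range_subset hγ' (hγ0.trans ht.symm))

end CircleHolo

end

/-! ### Limit cycles made of two arcs -/

noncomputable section

namespace CircleHolo

variable {Fp Fm : ℂ[X]}

theorem range_periodize {T : ℝ} (hT : 0 < T) {η : ℝ → ℂ} (h0 : η T = η 0) :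
    range (periodize hT η) = η '' Icc 0 T := by
  refine Subset.antisymm ?_ ?_
  · rintro _ ⟨t, rfl⟩
    have := toIcoMod_mem_Ico hT 0 t
    exact ⟨_, ⟨this.1, by simpa using this.2.le⟩, rfl⟩
  · rintro _ ⟨t, ht, rfl⟩
    exact ⟨t, periodize_eq hT h0 (n := 0) ht (by simp)⟩

theorem image_concat {a b : ℝ} {η₁ η₂ : ℝ → ℂ} (h0 : η₁ a = η₂ 0) (ha : 0 ≤ a) (hb : 0 ≤ b) :
    concat a η₁ η₂ '' Icc 0 (a + b) = η₁ '' Icc 0 a ∪ η₂ '' Icc 0 b := by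
  refine Subset.antisymm ?_ ?_
  · rintro _ ⟨t, ht, rfl⟩
    rcases le_total t a with h | h
    · exact Or.inl ⟨t, ⟨ht.1, h⟩, (concat_of_le _ _ h).symm⟩
    · exact Or.inr ⟨t - a, ⟨by linarith, by linarith [ht.2]⟩, (concat_of_ge h0 h).symm⟩
  · rintro _ (⟨t, ht, rfl⟩ | ⟨t, ht, rfl⟩)
    · exact ⟨t, ⟨ht.1, by linarith [ht.2]⟩, concat_of_le _ _ ht.2⟩
    · refine ⟨t + a, ⟨by linarith [ht.1], by linarith [ht.2]⟩, ?_⟩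
      rw [concat_of_ge h0 (by linarith [ht.1]), add_sub_cancel_right]

/-- The definition of a Poincaré map uses the chart centred at the point of the orbit, the arcs use
the chart centred at `1`. The change of chart `m` and its inverse `w` have reciprocal derivatives at
corresponding points, so conjugation keeps the multiplier. -/
theorem isPoincareMap_of_return {r μ : ℝ} {P τ : ℝ → ℝ} {η : ℝ → ℝ → ℂ}
    (hret : ∀ᶠ y in 𝓝 r, 0 < τ y ∧ IsCrossingTrajectory Fp Fm (Icc 0 (τ y)) (η y) ∧
      η y 0 = circlePoint 1 y ∧ η y (τ y) = circlePoint 1 (P y))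
    (hτ : ContinuousAt τ r) (hP : HasDerivAt P μ r) (hPr : P r = r) :
    ∃ Q : ℝ → ℝ, IsPoincareMap Fp Fm (circlePoint 1 r) (τ r) Q ∧ HasDerivAt Q μ 0 := by
  set m : ℝ → ℝ := fun x => (r + x) / (1 - r * x) with hm
  set w : ℝ → ℝ := fun y => (y - r) / (1 + r * y) with hw
  have hm0 : m 0 = r := by simp [hm]
  have hrr : 1 + r * r ≠ 0 := by nlinarith [mul_self_nonneg r]
  have hm' : HasDerivAt m (1 + r * r) 0 := by
    have h1 : HasDerivAt (fun x : ℝ => r + x) 1 0 := (hasDerivAt_id 0).const_add r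
    have h2 : HasDerivAt (fun x : ℝ => 1 - r * x) (-(r * 1)) 0 :=
      ((hasDerivAt_id (0 : ℝ)).const_mul r).const_sub 1
    exact (h1.div h2 (by simp)).congr_deriv (by simp)
  have hw' : HasDerivAt w (1 + r * r)⁻¹ r := by
    have h1 : HasDerivAt (fun x : ℝ => x - r) 1 r := (hasDerivAt_id r).sub_const r
    have h2 : HasDerivAt (fun x : ℝ => 1 + r * x) (r * 1) r :=
      ((hasDerivAt_id r).const_mul r).const_add 1
    refine (h1.div h2 hrr).congr_deriv ?_
    rw [sub_self, zero_mul, sub_zero, one_mul, sq, div_mul_cancel_left₀ hrr]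
  have hP1 : HasDerivAt P μ (m 0) := by rwa [hm0]
  have hPm : HasDerivAt (fun x => P (m x)) (μ * (1 + r * r)) 0 := hP1.comp 0 hm'
  have hPm0 : P (m 0) = r := by rw [hm0, hPr]
  have hmt : Tendsto m (𝓝 0) (𝓝 r) := by
    have := hm'.continuousAt.tendsto
    rwa [hm0] at this
  refine ⟨fun x => w (P (m x)), ⟨by simp [hPm0, hw], fun x => τ (m x), by simp [hm0], ?_, ?_⟩, ?_⟩
  · have : ContinuousAt τ (m 0) := by rwa [hm0]
    exact this.comp hm'.continuousAt
  · have e1 : ∀ᶠ x : ℝ in 𝓝 0, 1 - r * x ≠ 0 := by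
      have : ContinuousAt (fun x : ℝ => 1 - r * x) 0 := by fun_prop
      exact this.eventually_ne (by simp)
    have e2 : ∀ᶠ x : ℝ in 𝓝 0, 1 + r * P (m x) ≠ 0 := by
      have : ContinuousAt (fun x : ℝ => 1 + r * P (m x)) 0 :=
        continuousAt_const.add (continuousAt_const.mul hPm.continuousAt)
      exact this.eventually_ne (by rw [hPm0]; exact hrr)
    filter_upwards [hmt.eventually hret, e1, e2] with x ⟨h1, h2, h3, h4⟩ hx1 hx2
    refine ⟨h1, η (m x), h2, ?_, ?_⟩
    · rw [h3, circlePoint_circlePoint hx1]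
    · have h5 : 1 - r * w (P (m x)) = (1 + r * r) / (1 + r * P (m x)) := by
        simp only [hw]
        field_simp
        ring
      have h6 : 1 - r * w (P (m x)) ≠ 0 := by rw [h5]; exact div_ne_zero hrr hx2
      rw [h4, circlePoint_circlePoint h6, h5]
      congr 1
      rw [eq_div_iff (div_ne_zero hrr hx2)]
      simp only [hw]
      generalize P (m x) = y at hx2
      have h7 : (y - r) / (1 + r * y) * (1 + r * y) = y - r := div_mul_cancel₀ _ hx2
      rw [← mul_right_cancel_iff_of_pos (show (0 : ℝ) < (1 + r * y) ^ 2 by positivity)]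
      rw [mul_assoc, sq, ← mul_assoc (_ / _), div_mul_cancel₀ _ hx2]
      linear_combination (-(1 + r * y)) * h7
  · have hw1 : HasDerivAt w (1 + r * r)⁻¹ (P (m 0)) := by rwa [hPm0]
    have := hw1.comp 0 hPm
    exact this.congr_deriv (by rw [mul_comm μ, inv_mul_cancel_left₀ hrr])

/-- Two families of arcs, through the exterior and through the interior of the circle, that close
up with a return map whose multiplier is not of modulus one, form a hyperbolic limit cycle. -/
theorem isHyperbolicLimitCycle_of_arcs {r s a b : ℝ} {gp gm τp τm : ℝ → ℝ}
    {ηp ηm : ℝ → ℝ → ℂ} (hr : 0 < r) (hs : 0 < s) (hgp : gp r = s) (hgm : gm s = r)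
    (hp : ∀ᶠ y in 𝓝 r, 0 < τp y ∧ IsCrossingTrajectory Fp Fm (Icc 0 (τp y)) (ηp y) ∧
      ηp y 0 = circlePoint 1 y ∧ ηp y (τp y) = circlePoint 1 (-gp y))
    (hm : ∀ᶠ y in 𝓝 s, 0 < τm y ∧ IsCrossingTrajectory Fp Fm (Icc 0 (τm y)) (ηm y) ∧
      ηm y 0 = circlePoint 1 (-y) ∧ ηm y (τm y) = circlePoint 1 (gm y))
    (hp1 : ∀ t ∈ Ioo 0 (τp r), 1 < ‖ηp r t‖) (hm1 : ∀ t ∈ Ioo 0 (τm s), ‖ηm s t‖ < 1)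
    (hτp : ContinuousAt τp r) (hτm : ContinuousAt τm s)
    (hgp' : HasDerivAt gp a r) (hgm' : HasDerivAt gm b s) (hab : |b * a| ≠ 1) :
    IsHyperbolicLimitCycle Fp Fm (ηp r '' Icc 0 (τp r) ∪ ηm s '' Icc 0 (τm s)) := by
  set P : ℝ → ℝ := fun y => gm (gp y) with hPdef
  set τ : ℝ → ℝ := fun y => τp y + τm (gp y) with hτdef
  set η : ℝ → ℝ → ℂ := fun y => concat (τp y) (ηp y) (ηm (gp y)) with hηdef
  have hgpt : Tendsto gp (𝓝 r) (𝓝 s) := by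
    have := hgp'.continuousAt.tendsto
    rwa [hgp] at this
  have hret : ∀ᶠ y in 𝓝 r, 0 < τ y ∧ IsCrossingTrajectory Fp Fm (Icc 0 (τ y)) (η y) ∧
      η y 0 = circlePoint 1 y ∧ η y (τ y) = circlePoint 1 (P y) := by
    filter_upwards [hp, hgpt.eventually hm] with y ⟨h1, h2, h3, h4⟩ ⟨k1, k2, k3, k4⟩
    have h0 : ηp y (τp y) = ηm (gp y) 0 := by rw [h4, k3]
    refine ⟨add_pos h1 k1, h2.concat k2 h0, ?_, ?_⟩
    · simp only [hηdef]
      rw [concat_of_le _ _ h1.le, h3]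
    · simp only [hηdef, hτdef, hPdef]
      rw [concat_of_ge h0 (by linarith), add_sub_cancel_left, k4]
  obtain ⟨h1, h2, h3, h4⟩ := hp.self_of_nhds
  obtain ⟨k1, k2, k3, k4⟩ := hm.self_of_nhds
  obtain ⟨hT, htraj, hη0, hηT⟩ := hret.self_of_nhds
  have hPr : P r = r := by simp only [hPdef]; rw [hgp, hgm]
  have hP : HasDerivAt P (b * a) r := by
    have : HasDerivAt gm b (gp r) := by rwa [hgp]
    exact this.comp r hgp'
  have hjoin : ηp r (τp r) = ηm (gp r) 0 := by rw [h4, hgp, k3]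
  have hclose : η r (τ r) = η r 0 := by rw [hηT, hη0, hPr]
  set γ := periodize hT (η r) with hγdef
  have hγη : ∀ t ∈ Icc 0 (τ r), γ t = η r t := fun t ht =>
    periodize_eq hT hclose (n := 0) ht (by simp)
  have hγ0 : γ 0 = circlePoint 1 r := by rw [hγη 0 ⟨le_rfl, hT.le⟩, hη0]
  have hηp : ∀ t ∈ Icc 0 (τp r), η r t = ηp r t := fun t ht => concat_of_le _ _ ht.2
  have hηm : ∀ t ∈ Icc (τp r) (τ r), η r t = ηm s (t - τp r) := fun t ht => by
    simp only [hηdef]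
    rw [concat_of_ge hjoin ht.1, hgp]
  have hτr : τ r = τp r + τm s := by simp only [hτdef, hgp]
  have hcases : ∀ t ∈ Icc 0 (τ r), 1 < ‖γ t‖ ∨ ‖γ t‖ < 1 ∨
      ((t = 0 ∨ t = τ r) ∧ γ t = circlePoint 1 r) ∨ γ t = circlePoint 1 (-s) := by
    intro t ht
    rw [hγη t ht]
    rcases ht.1.eq_or_lt with rfl | h0
    · exact Or.inr (Or.inr (Or.inl ⟨Or.inl rfl, hη0⟩))
    rcases ht.2.eq_or_lt with rfl | hT'
    · exact Or.inr (Or.inr (Or.inl ⟨Or.inr rfl, by rw [hηT, hPr]⟩))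
    rcases lt_trichotomy t (τp r) with h | h | h
    · rw [hηp t ⟨h0.le, h.le⟩]
      exact Or.inl (hp1 t ⟨h0, h⟩)
    · rw [hηp t ⟨h0.le, h.le⟩, h, h4, hgp]
      exact Or.inr (Or.inr (Or.inr rfl))
    · rw [hηm t ⟨h.le, hT'.le⟩]
      exact Or.inr (Or.inl (hm1 _ ⟨by linarith, by linarith⟩))
  have hne : circlePoint 1 r ≠ circlePoint 1 (-s) := fun h => by
    have := circlePoint_injective h
    linarith
  have hclosed : IsClosedOrbit Fp Fm γ (τ r) := by
    refine ⟨htraj.periodize hT hclose, hT, periodize_periodic hT _, fun τ' hτ' hper => ?_⟩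
    -- A smaller period would bring the orbit back to the parameter `r` strictly inside `(0, τ r)`,
    -- whereas there it is off the circle or at `-s`.
    by_contra hlt
    rw [not_le] at hlt
    have e1 : γ τ' = circlePoint 1 r := by
      have := hper 0
      rwa [zero_add, hγ0] at this
    rcases hcases τ' ⟨hτ'.le, hlt.le⟩ with h | h | ⟨h | h, -⟩ | h
    · rw [e1, norm_circlePoint] at h; exact lt_irrefl _ h
    · rw [e1, norm_circlePoint] at h; exact lt_irrefl _ h
    · exact hτ'.ne' h
    · exact hlt.ne h
    · exact hne (e1.symm.trans h)
  have hrange : range γ = ηp r '' Icc 0 (τp r) ∪ ηm s '' Icc 0 (τm s) := by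
    rw [hγdef, range_periodize hT hclose, ← image_concat (by rw [hjoin, hgp]) h1.le k1.le, ← hτr]
    simp only [hηdef, hgp]
  have hτ : ContinuousAt τ r := by
    have : ContinuousAt τm (gp r) := by rwa [hgp]
    exact hτp.add (this.comp hgp'.continuousAt)
  obtain ⟨Q, hQ, hQ'⟩ := isPoincareMap_of_return hret hτ hP hPr
  rw [← hrange]
  refine ⟨⟨⟨γ, τ r, hclosed, rfl⟩, ?_⟩, γ, τ r, hclosed, rfl, by rw [hγ0, norm_circlePoint], Q,
    b * a, by rwa [hγ0], hQ', hab⟩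
  refine hclosed.isolated hγ0 hr hs ?_ ?_ ?_ hret hm ?_ ?_ hP hPr hab
  · rintro _ ⟨t, rfl⟩ hz
    obtain ⟨y, hy, hty⟩ := hclosed.periodic.exists_mem_Ico hT t 0
    rw [zero_add] at hy
    rw [hty] at hz ⊢
    rcases hcases y ⟨hy.1, hy.2.le⟩ with h | h | ⟨-, h⟩ | h
    · exact absurd hz h.ne'
    · exact absurd hz h.ne
    · exact Or.inl h
    · exact Or.inr h
  · refine ⟨τp r + τm s / 2, ?_⟩
    rw [hγη _ ⟨by linarith, by linarith⟩, hηm _ ⟨by linarith, by linarith⟩]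
    exact hm1 _ ⟨by linarith, by linarith⟩
  · refine ⟨τp r / 2, ?_⟩
    rw [hγη _ ⟨by linarith, by linarith⟩, hηp _ ⟨by linarith, by linarith⟩]
    exact hp1 _ ⟨by linarith, by linarith⟩
  · exact hP.continuousAt.eventually (lt_mem_nhds (by rw [hPr]; exact hr))
  · exact hgm'.continuousAt.eventually (lt_mem_nhds (by rw [hgm]; exact hr))

end CircleHolo

end

/-! ### Arcs in the half-plane chart -/

noncomputable section

namespace CircleHolo

/-- The first integral, on the real line, of the flow of
`dζ/dt = (α + i) (ζ - δ) (1 + d ζ) / (1 + d δ)`. -/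
def firstIntegral (α δ : ℝ) (d : ℂ) (x : ℝ) : ℝ :=
  Real.log (x - δ) - ((1 + α * Complex.I) * Complex.log (1 + d * x)).re

/-- Bounds on the parameters of a half-return arc from `r` to `-s`. -/
structure Admissible (α δ : ℝ) (d : ℂ) (r s : ℝ) : Prop where
  hα : |α| ≤ 2
  hd : ‖d‖ ≤ 2
  hr : 0 < r
  hs : 0 < s
  hδr : |δ| ≤ r / 4
  hδs : |δ| ≤ s / 4
  hr1 : r ≤ 1 / 1000000
  hs1 : s ≤ 1 / 1000000

theorem Admissible.symm {α δ : ℝ} {d : ℂ} {r s : ℝ} (h : Admissible α δ d r s) :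
    Admissible α (-δ) (-d) s r :=
  ⟨h.hα, by rw [norm_neg]; exact h.hd, h.hs, h.hr, by rw [abs_neg]; exact h.hδs,
    by rw [abs_neg]; exact h.hδr, h.hs1, h.hr1⟩

theorem firstIntegral_neg (α δ : ℝ) (d : ℂ) (x : ℝ) :
    firstIntegral α (-δ) (-d) x = firstIntegral α δ d (-x) := by
  have : x - -δ = -(-x - δ) := by ring
  rw [firstIntegral, firstIntegral, this, Real.log_neg_eq_log]
  simp

/-- The duration of the half-return arc from `r` to `-s`. -/
def arcTime (d : ℂ) (r s : ℝ) : ℝ :=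
  Real.pi + (Complex.log (1 + d * r) - Complex.log (1 - d * s)).im

/-- The constant term of the field `dζ/dt = (α + i) (ζ - δ) (1 + d ζ) / (1 + d δ)` in the
coordinate `1 / (ζ - δ)`. -/
def shiftCoeff (δ : ℝ) (d : ℂ) : ℂ := d / (1 + d * δ)

/-- The solution from `1 / (r - δ)` in the coordinate `1 / (ζ - δ)`. -/
def linArc (α δ : ℝ) (d : ℂ) (r t : ℝ) : ℂ :=
  -shiftCoeff δ d + Complex.exp (-(α + Complex.I) * t) * (1 / (r - δ) + shiftCoeff δ d)

/-- The solution from `r` of `dζ/dt = (α + i) (ζ - δ) (1 + d ζ) / (1 + d δ)`. -/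
def arc (α δ : ℝ) (d : ℂ) (r t : ℝ) : ℂ := δ + 1 / linArc α δ d r t

/-- A half turn lasts at most `4π/3 < 9/2` and `|α| ≤ 2`, so all expansion factors lie between
`1/20000` and `20000`. The later numerical constants leave room for this. -/
theorem exp_nine_lt : Real.exp 9 < 20000 := by
  have h := Real.exp_one_lt_three
  have h2 : Real.exp 9 = Real.exp 1 ^ 9 := by rw [← Real.exp_nat_mul]; norm_num
  rw [h2]
  calc Real.exp 1 ^ 9 ≤ 3 ^ 9 := by gcongr
    _ < 20000 := by norm_num

theorem exp_le_of_mul_le {α t : ℝ} (hα : |α| ≤ 2) (ht : t ∈ Icc 0 (4 * Real.pi / 3)) :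
    Real.exp (α * t) ≤ 20000 ∧ Real.exp (-(α * t)) ≤ 20000 := by
  have hpi := Real.pi_lt_d2
  have ht2 : t ≤ 9 / 2 := by linarith [ht.2]
  have h := abs_le.1 hα
  have h1 : α * t ≤ 9 := by nlinarith [ht.1]
  have h2 : -(α * t) ≤ 9 := by nlinarith [ht.1]
  exact ⟨(Real.exp_le_exp.2 h1).trans exp_nine_lt.le, (Real.exp_le_exp.2 h2).trans exp_nine_lt.le⟩

/-- The height of a logarithmic spiral over a chord that it meets at both ends. -/
theorem spiral_pos {α κ X τ : ℝ} (hα : |α| ≤ 2) (hX : 0 < X) (hκ : |κ| * 100000 ≤ X)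
    (hτ1 : 2 * Real.pi / 3 ≤ τ) (hτ2 : τ ≤ 4 * Real.pi / 3)
    (hend : κ * (Real.exp (α * τ) - Real.cos τ) + X * Real.sin τ = 0) {t : ℝ} (ht : t ∈ Ioo 0 τ) :
    0 < κ * (Real.exp (α * t) - Real.cos t) + X * Real.sin t := by
  have hpi := Real.pi_pos
  set f : ℝ → ℝ := fun t => κ * (Real.exp (α * t) - Real.cos t) + X * Real.sin t with hf
  have hder : ∀ t, HasDerivAt f (κ * (α * Real.exp (α * t) + Real.sin t) + X * Real.cos t) t := by
    intro t
    have h1 : HasDerivAt (fun t : ℝ => α * t) (α * 1) t := (hasDerivAt_id t).const_mul α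
    have h2 := (((h1.exp).sub (Real.hasDerivAt_cos t)).const_mul κ).add
      ((Real.hasDerivAt_sin t).const_mul X)
    exact h2.congr_deriv (by ring)
  have hcont : Continuous f := continuous_iff_continuousAt.2 fun t => (hder t).continuousAt
  have hsmall : ∀ t ∈ Icc 0 τ, |κ * (α * Real.exp (α * t) + Real.sin t)| < X / 2 := by
    intro t ht
    have he := (exp_le_of_mul_le hα ⟨ht.1, ht.2.trans hτ2⟩).1
    have h1 : |α * Real.exp (α * t) + Real.sin t| ≤ 2 * 20000 + 1 := by
      refine (abs_add_le _ _).trans (add_le_add ?_ (Real.abs_sin_le_one t))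
      rw [abs_mul, abs_of_pos (Real.exp_pos _)]
      exact mul_le_mul hα he (Real.exp_pos _).le (by norm_num)
    rw [abs_mul]
    nlinarith [abs_nonneg κ]
  have hcos : ∀ t, t ∈ Icc 0 (Real.pi / 3) → 1 / 2 ≤ Real.cos t := by
    intro t ht
    rw [← Real.cos_pi_div_three]
    exact Real.cos_le_cos_of_nonneg_of_le_pi ht.1 (by linarith) ht.2
  have hcos2 : ∀ t, t ∈ Icc (2 * Real.pi / 3) (4 * Real.pi / 3) → Real.cos t ≤ -(1 / 2) := by
    intro t ht
    have h1 : 1 / 2 ≤ Real.cos |t - Real.pi| := hcos _ ⟨abs_nonneg _, by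
      rw [abs_le]; constructor <;> linarith [ht.1, ht.2]⟩
    rw [Real.cos_abs, Real.cos_sub_pi] at h1
    linarith
  -- The term in `κ` is a small perturbation of `X sin t`. The height vanishes at both ends; it
  -- increases while `cos ≥ 1/2`, is bounded below while `sin ≥ 1/2`, and decreases to the end while
  -- `cos ≤ -1/2`.
  rcases le_or_gt t (Real.pi / 3) with h | h
  · have hmono : StrictMonoOn f (Icc 0 (Real.pi / 3)) := by
      refine strictMonoOn_of_deriv_pos (convex_Icc _ _) hcont.continuousOn fun x hx => ?_
      rw [interior_Icc] at hx
      rw [(hder x).deriv]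
      have h1 := (abs_lt.1 (hsmall x ⟨hx.1.le, by linarith [hx.2]⟩)).1
      have h2 := hcos x ⟨hx.1.le, hx.2.le⟩
      nlinarith
    have := hmono ⟨le_rfl, by linarith⟩ ⟨ht.1.le, h⟩ ht.1
    simpa [hf] using this
  rcases le_or_gt t (2 * Real.pi / 3) with h' | h'
  · have he := exp_le_of_mul_le hα (t := t) ⟨ht.1.le, by linarith⟩
    have hsin : 1 / 2 ≤ Real.sin t := by
      have h1 : 1 / 2 ≤ Real.cos |t - Real.pi / 2| := hcos _ ⟨abs_nonneg _, by
        rw [abs_le]; constructor <;> linarith⟩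
      rwa [Real.cos_abs, Real.cos_sub_pi_div_two] at h1
    have h1 : |Real.exp (α * t) - Real.cos t| ≤ 20000 + 1 := by
      refine (abs_sub _ _).trans (add_le_add ?_ (Real.abs_cos_le_one t))
      rw [abs_of_pos (Real.exp_pos _)]
      exact he.1
    have h2 : |κ * (Real.exp (α * t) - Real.cos t)| ≤ |κ| * 20001 := by
      rw [abs_mul]
      exact mul_le_mul_of_nonneg_left (h1.trans (by norm_num)) (abs_nonneg _)
    have h3 := (abs_le.1 h2).1
    nlinarith [abs_nonneg κ]
  · have hanti : StrictAntiOn f (Icc (2 * Real.pi / 3) τ) := by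
      refine strictAntiOn_of_deriv_neg (convex_Icc _ _) hcont.continuousOn fun x hx => ?_
      rw [interior_Icc] at hx
      rw [(hder x).deriv]
      have h1 := (abs_lt.1 (hsmall x ⟨by linarith [hx.1], hx.2.le⟩)).2
      have h2 := hcos2 x ⟨hx.1.le, by linarith [hx.2]⟩
      nlinarith
    have := hanti ⟨h'.le, ht.2.le⟩ ⟨hτ1, le_rfl⟩ ht.2
    rwa [show f τ = 0 from hend] at this

variable {α δ : ℝ} {d : ℂ} {r s : ℝ}

theorem Admissible.one_add_ne {α δ : ℝ} {d : ℂ} {r s : ℝ} (h : Admissible α δ d r s) :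
    1 + d * δ ≠ 0 ∧ ‖shiftCoeff δ d‖ ≤ 4 := by
  have h1 : ‖d * δ‖ ≤ 1 / 2 := by
    rw [norm_mul, Complex.norm_real, Real.norm_eq_abs]
    nlinarith [h.hd, h.hδr, h.hr1, abs_nonneg δ, norm_nonneg d]
  have h2 : 1 / 2 ≤ ‖1 + d * δ‖ := by
    have := norm_sub_norm_le (1 : ℂ) (-(d * δ))
    rw [sub_neg_eq_add, norm_neg, norm_one] at this
    linarith
  have h3 : 1 + d * δ ≠ 0 := norm_ne_zero_iff.1 (by linarith)
  refine ⟨h3, ?_⟩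
  rw [shiftCoeff, norm_div, div_le_iff₀ (by linarith)]
  linarith [h.hd]

theorem norm_mul_ofReal_le {d : ℂ} {x : ℝ} (hd : ‖d‖ ≤ 2) (hx : |x| ≤ 1 / 1000000) :
    ‖d * x‖ ≤ 1 / 500000 := by
  rw [norm_mul, Complex.norm_real, Real.norm_eq_abs]
  nlinarith [abs_nonneg x, norm_nonneg d]

theorem norm_log_one_add_le {d : ℂ} {x : ℝ} (hd : ‖d‖ ≤ 2) (hx : |x| ≤ 1 / 1000000) :
    ‖Complex.log (1 + d * x)‖ ≤ 3 * |x| := by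
  have h1 := norm_mul_ofReal_le hd hx
  refine (Complex.norm_log_one_add_half_le_self (by linarith)).trans ?_
  rw [norm_mul, Complex.norm_real, Real.norm_eq_abs]
  nlinarith [abs_nonneg x]

theorem one_add_mul_ne_zero {d : ℂ} {x : ℝ} (hd : ‖d‖ ≤ 2) (hx : |x| ≤ 1 / 1000000) :
    1 + d * x ≠ 0 := fun h => by
  have h1 := norm_mul_ofReal_le hd hx
  rw [← eq_neg_iff_add_eq_zero] at h
  rw [← norm_neg, ← h, norm_one] at h1
  norm_num at h1

theorem Admissible.arcTime_mem (h : Admissible α δ d r s) :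
    arcTime d r s ∈ Icc (2 * Real.pi / 3) (4 * Real.pi / 3) := by
  have h1 := norm_log_one_add_le (x := r) h.hd (by rw [abs_of_pos h.hr]; exact h.hr1)
  have h2 := norm_log_one_add_le (x := -s) h.hd (by rw [abs_neg, abs_of_pos h.hs]; exact h.hs1)
  rw [abs_of_pos h.hr] at h1
  rw [abs_neg, abs_of_pos h.hs] at h2
  have h3 : |(Complex.log (1 + d * r) - Complex.log (1 - d * s)).im| ≤ 1 / 2 := by
    refine (Complex.abs_im_le_norm _).trans ((norm_sub_le _ _).trans ?_)
    have : (1 : ℂ) - d * s = 1 + d * ((-s : ℝ) : ℂ) := by push_cast; ring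
    rw [this]
    linarith [h.hr1, h.hs1]
  have h4 := abs_le.1 h3
  have hpi := Real.pi_gt_three
  rw [arcTime]
  constructor <;> linarith

theorem Admissible.sub_pos (h : Admissible α δ d r s) :
    3 / 4 * r ≤ r - δ ∧ r - δ ≤ 5 / 4 * r ∧ 3 / 4 * s ≤ s + δ ∧ s + δ ≤ 5 / 4 * s := by
  have h1 := abs_le.1 h.hδr
  have h2 := abs_le.1 h.hδs
  refine ⟨?_, ?_, ?_, ?_⟩ <;> linarith [h1.1, h1.2, h2.1, h2.2]

theorem linArc_zero (α δ : ℝ) (d : ℂ) (r : ℝ) :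
    linArc α δ d r 0 = 1 / (r - δ) := by
  simp [linArc]

/-- The integrated equation is an identity between complex logarithms. Its real part is the
hypothesis on the first integral and its imaginary part defines `arcTime`; exponentiating it gives
the position at the end, the sign coming from `exp(π i) = -1`. -/
theorem Admissible.linArc_arcTime (h : Admissible α δ d r s)
    (hI : firstIntegral α δ d (-s) = firstIntegral α δ d r + α * Real.pi) :
    linArc α δ d r (arcTime d r s) = -(1 / (s + δ)) := by
  obtain ⟨hp1, -, hp3, -⟩ := h.sub_pos
  have hr := h.hr
  have hs := h.hs
  have hrδ : 0 < r - δ := by linarith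
  have hsδ : 0 < s + δ := by linarith
  have hne := h.one_add_ne.1
  have ea : (1 : ℂ) - d * s = 1 + d * ((-s : ℝ) : ℂ) := by push_cast; ring
  have n1 := one_add_mul_ne_zero (x := r) h.hd (by rw [abs_of_pos h.hr]; exact h.hr1)
  have n2 : 1 - d * s ≠ 0 := by
    rw [ea]
    exact one_add_mul_ne_zero h.hd (by rw [abs_neg, abs_of_pos h.hs]; exact h.hs1)
  set w1 := Complex.log (1 + d * r) with hw1
  set w2 := Complex.log (1 - d * s) with hw2
  have hI' : Real.log (s + δ) - (w2.re - α * w2.im) =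
      Real.log (r - δ) - (w1.re - α * w1.im) + α * Real.pi := by
    have h3 : Real.log (-s - δ) = Real.log (s + δ) := by
      rw [← Real.log_neg_eq_log]; congr 1; ring
    rw [firstIntegral, firstIntegral, h3, ← ea] at hI
    simpa [Complex.add_re, Complex.mul_re] using hI
  have key : w2 - Real.pi * Complex.I + Real.log (r - δ) =
      -(α + Complex.I) * (arcTime d r s : ℝ) + w1 + Real.log (s + δ) := by
    apply Complex.ext
    · simp [arcTime, ← hw1, ← hw2]
      linarith
    · simp [arcTime, ← hw1, ← hw2]
      ring
  have key2 := congrArg Complex.exp key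
  rw [Complex.exp_add, Complex.exp_sub, Complex.exp_pi_mul_I, Complex.exp_add, Complex.exp_add,
    ← Complex.ofReal_exp, ← Complex.ofReal_exp, Real.exp_log hrδ, Real.exp_log hsδ, hw1, hw2,
    Complex.exp_log n1, Complex.exp_log n2] at key2
  have m1 : ((r : ℂ) - δ) ≠ 0 := by exact_mod_cast hrδ.ne'
  have m2 : ((s : ℂ) + δ) ≠ 0 := by exact_mod_cast hsδ.ne'
  push_cast at key2
  rw [linArc, shiftCoeff]
  obtain ⟨e, he⟩ : ∃ e, e = 1 + d * δ := ⟨_, rfl⟩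
  rw [← he] at hne ⊢
  have e1 : 1 / ((r : ℂ) - δ) + d / e = (1 + d * r) / (e * (r - δ)) := by
    field_simp
    linear_combination he
  have e2 : -(d / e) + Complex.exp (-(↑α + Complex.I) * ↑(arcTime d r s)) *
      ((1 + d * r) / (e * (r - δ))) = -(d / e) +
      (Complex.exp (-(↑α + Complex.I) * ↑(arcTime d r s)) * (1 + d * r) * (s + δ)) /
        (e * (r - δ) * (s + δ)) := by
    field_simp
  rw [e1, e2, ← key2]
  field_simp
  linear_combination he

/-- Near the zero the coordinate `1/(ζ - δ)` is huge while the affine term stays bounded by 4; the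
ratio `4 * 100000 ≤ 700000` is what `spiral_pos` asks for. -/
theorem Admissible.re_shift (h : Admissible α δ d r s) :
    700000 ≤ 1 / (r - δ) + (shiftCoeff δ d).re ∧ 700000 ≤ 1 / (s + δ) - (shiftCoeff δ d).re ∧
      |(shiftCoeff δ d).im| ≤ 4 := by
  obtain ⟨hp1, hp2, hp3, hp4⟩ := h.sub_pos
  have hr := h.hr
  have hs := h.hs
  have hn := h.one_add_ne.2
  have h1 := abs_le.1 ((Complex.abs_re_le_norm (shiftCoeff δ d)).trans hn)
  have h2 : 800000 ≤ 1 / (r - δ) := by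
    rw [le_div_iff₀ (by linarith)]
    linarith [h.hr1]
  have h3 : 800000 ≤ 1 / (s + δ) := by
    rw [le_div_iff₀ (by linarith)]
    linarith [h.hs1]
  exact ⟨by linarith [h1.1], by linarith [h1.2], (Complex.abs_im_le_norm _).trans hn⟩

/-- In the coordinate `1/(ζ - δ)` the flow is affine, so the arc is a logarithmic spiral about
`-shiftCoeff δ d`, and up to a negative factor its imaginary part is the height function of
`spiral_pos`. -/
theorem im_linArc (α δ : ℝ) (d : ℂ) (r t : ℝ) : (linArc α δ d r t).im = -(Real.exp (-(α * t)) *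
    ((shiftCoeff δ d).im * (Real.exp (α * t) - Real.cos t) +
      (1 / (r - δ) + (shiftCoeff δ d).re) * Real.sin t)) := by
  have h1 : -((α : ℂ) + Complex.I) * t = ((-(α * t) : ℝ) : ℂ) + ((-t : ℝ) : ℂ) * Complex.I := by
    push_cast; ring
  have h2 : (1 : ℂ) / (r - δ) = ((1 / (r - δ) : ℝ) : ℂ) := by push_cast; ring
  have h3 : Real.exp (-(α * t)) * Real.exp (α * t) = 1 := by
    rw [← Real.exp_add, neg_add_cancel, Real.exp_zero]
  rw [linArc, h1, Complex.exp_add, Complex.exp_mul_I, h2, ← Complex.ofReal_exp,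
    ← Complex.ofReal_cos, ← Complex.ofReal_sin]
  simp only [Complex.add_im, Complex.neg_im, Complex.mul_im, Complex.mul_re, Complex.add_re,
    Complex.ofReal_re, Complex.ofReal_im, Complex.I_re, Complex.I_im, Real.cos_neg, Real.sin_neg]
  linear_combination (shiftCoeff δ d).im * h3

theorem Admissible.im_linArc_neg (h : Admissible α δ d r s)
    (hI : firstIntegral α δ d (-s) = firstIntegral α δ d r + α * Real.pi) {t : ℝ}
    (ht : t ∈ Ioo 0 (arcTime d r s)) : (linArc α δ d r t).im < 0 := by
  have hre := h.re_shift
  have hτ := h.arcTime_mem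
  rw [im_linArc, neg_lt_zero]
  refine mul_pos (Real.exp_pos _) (spiral_pos h.hα (by linarith) (by linarith) hτ.1 hτ.2 ?_ ht)
  have h1 := congrArg Complex.im (h.linArc_arcTime hI)
  have h2 : -(1 / ((s : ℂ) + δ)) = ((-(1 / (s + δ)) : ℝ) : ℂ) := by push_cast; ring
  rw [im_linArc, h2, Complex.ofReal_im, neg_eq_zero, mul_eq_zero] at h1
  exact h1.resolve_left (Real.exp_pos _).ne'

/-- A lower bound in the inverted coordinate confines the arc to a disc of radius proportional to
`r`. This keeps it away from the pole of the chart and puts the cycle in a small ball. -/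
theorem Admissible.le_norm_linArc (h : Admissible α δ d r s) {t : ℝ}
    (ht : t ∈ Icc 0 (arcTime d r s)) : 1 / (40000 * r) ≤ ‖linArc α δ d r t‖ := by
  have hr := h.hr
  obtain ⟨hp1, hp2, -, -⟩ := h.sub_pos
  have hn := h.one_add_ne.2
  have he := (exp_le_of_mul_le h.hα ⟨ht.1, ht.2.trans h.arcTime_mem.2⟩).1
  have h1 : 1 / 20000 ≤ ‖Complex.exp (-(α + Complex.I) * t)‖ := by
    rw [Complex.norm_exp]
    have : (-((α : ℂ) + Complex.I) * t).re = -(α * t) := by simp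
    rw [this, Real.exp_neg, ← one_div]
    exact one_div_le_one_div_of_le (Real.exp_pos _) he
  have h2 : 1 / (5 / 4 * r) - 4 ≤ ‖1 / ((r : ℂ) - δ) + shiftCoeff δ d‖ := by
    have h3 := norm_sub_norm_le (1 / ((r : ℂ) - δ)) (-shiftCoeff δ d)
    rw [sub_neg_eq_add, norm_neg] at h3
    have h4 : ‖1 / ((r : ℂ) - δ)‖ = 1 / (r - δ) := by
      have : (1 : ℂ) / (r - δ) = ((1 / (r - δ) : ℝ) : ℂ) := by push_cast; ring
      rw [this, Complex.norm_real, Real.norm_eq_abs, abs_of_pos]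
      have : 0 < r - δ := by linarith
      positivity
    have h5 : 1 / (5 / 4 * r) ≤ 1 / (r - δ) := one_div_le_one_div_of_le (by linarith) hp2
    linarith
  have h6 : 1000000 ≤ 1 / r := by rw [le_div_iff₀ hr]; linarith [h.hr1]
  have e1 : 1 / (5 / 4 * r) = 4 / 5 * (1 / r) := by field_simp
  have e2 : 1 / (40000 * r) = 1 / 40000 * (1 / r) := by field_simp
  rw [e1] at h2
  rw [e2, linArc]
  have h7 := norm_sub_norm_le (Complex.exp (-(α + Complex.I) * t) *
    (1 / ((r : ℂ) - δ) + shiftCoeff δ d)) (shiftCoeff δ d)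
  rw [norm_mul, sub_eq_neg_add (_ * _) (shiftCoeff δ d)] at h7
  have h8 : 1 / 20000 * (4 / 5 * (1 / r) - 4) ≤ ‖Complex.exp (-(α + Complex.I) * t)‖ *
      ‖1 / ((r : ℂ) - δ) + shiftCoeff δ d‖ :=
    mul_le_mul h1 h2 (by linarith) (norm_nonneg _)
  linarith

theorem Admissible.norm_arc_le (h : Admissible α δ d r s) {t : ℝ}
    (ht : t ∈ Icc 0 (arcTime d r s)) : ‖arc α δ d r t‖ ≤ 50000 * r := by
  have hr := h.hr
  have h1 := h.le_norm_linArc ht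
  have h2 : ‖1 / linArc α δ d r t‖ ≤ 40000 * r := by
    rw [norm_div, norm_one]
    refine (one_div_le_one_div_of_le (by positivity) h1).trans ?_
    rw [one_div_one_div]
  rw [arc]
  refine (norm_add_le _ _).trans ?_
  rw [Complex.norm_real, Real.norm_eq_abs]
  linarith [h.hδr]

theorem Admissible.linArc_ne_zero (h : Admissible α δ d r s) {t : ℝ}
    (ht : t ∈ Icc 0 (arcTime d r s)) : linArc α δ d r t ≠ 0 := by
  have hr := h.hr
  have h1 := h.le_norm_linArc ht
  exact norm_pos_iff.1 (lt_of_lt_of_le (by positivity) h1)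

/-- The field `dζ/dt = (α + i) (ζ - δ) (1 + d ζ) / (1 + d δ)`. -/
def chartField (α δ : ℝ) (d ζ : ℂ) : ℂ := (α + Complex.I) * (ζ - δ) * (1 + d * ζ) / (1 + d * δ)

theorem Admissible.hasDerivAt_arc (h : Admissible α δ d r s) {t : ℝ}
    (ht : t ∈ Icc 0 (arcTime d r s)) :
    HasDerivAt (arc α δ d r) (chartField α δ d (arc α δ d r t)) t := by
  have hne := h.linArc_ne_zero ht
  have h1 : HasDerivAt (linArc α δ d r)
      (-(α + Complex.I) * (linArc α δ d r t + shiftCoeff δ d)) t := by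
    have h2 : HasDerivAt (fun t : ℝ => -((α : ℂ) + Complex.I) * (t : ℂ))
        (-(α + Complex.I) * 1) t := (Complex.ofRealCLM.hasDerivAt (x := t)).const_mul _
    exact ((h2.cexp.mul_const (1 / ((r : ℂ) - δ) + shiftCoeff δ d)).const_add
      (-shiftCoeff δ d)).congr_deriv (by rw [linArc]; ring)
  have h3 := (h1.inv hne).const_add (δ : ℂ)
  have h4 : HasDerivAt (arc α δ d r) (-(-(α + Complex.I) * (linArc α δ d r t + shiftCoeff δ d)) /
      linArc α δ d r t ^ 2) t := by
    have h5 : arc α δ d r = fun t => (δ : ℂ) + (linArc α δ d r)⁻¹ t := by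
      ext t
      simp only [arc, one_div, Pi.inv_apply]
    rw [h5]
    exact h3
  refine h4.congr_deriv ?_
  have hn := h.one_add_ne.1
  rw [chartField, arc, shiftCoeff]
  obtain ⟨e, he⟩ : ∃ e, e = 1 + d * δ := ⟨_, rfl⟩
  rw [← he] at hn ⊢
  field_simp
  linear_combination (α + Complex.I) * linArc α δ d r t * he

theorem arc_zero (α δ : ℝ) (d : ℂ) (r : ℝ) : arc α δ d r 0 = r := by
  rw [arc, linArc_zero, one_div_one_div]
  ring

theorem Admissible.arc_arcTime (h : Admissible α δ d r s)
    (hI : firstIntegral α δ d (-s) = firstIntegral α δ d r + α * Real.pi) :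
    arc α δ d r (arcTime d r s) = ((-s : ℝ) : ℂ) := by
  rw [arc, h.linArc_arcTime hI, one_div, inv_neg, one_div, inv_inv]
  push_cast
  ring

theorem Admissible.im_arc_pos (h : Admissible α δ d r s)
    (hI : firstIntegral α δ d (-s) = firstIntegral α δ d r + α * Real.pi) {t : ℝ}
    (ht : t ∈ Ioo 0 (arcTime d r s)) : 0 < (arc α δ d r t).im := by
  have h1 := h.im_linArc_neg hI ht
  have h2 := h.linArc_ne_zero (Ioo_subset_Icc_self ht)
  rw [arc, one_div, Complex.add_im, Complex.ofReal_im, Complex.inv_im, zero_add]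
  exact div_pos (by linarith) (Complex.normSq_pos.2 h2)

/-- Transversality at both ends, hence crossing points: written with `1/(x - δ)`, the imaginary part
is dominated by the pole, against an error of at most 8 from `α` times the imaginary part of the
shift. -/
theorem Admissible.im_chartField (h : Admissible α δ d r s) :
    0 < (chartField α δ d r).im ∧ (chartField α δ d ((-s : ℝ) : ℂ)).im < 0 := by
  obtain ⟨hp1, hp2, hp3, hp4⟩ := h.sub_pos
  have hr := h.hr
  have hs := h.hs
  have hn := h.one_add_ne.1
  obtain ⟨b1, b2, b3⟩ := h.re_shift
  have hα := h.hα
  have hακ : |α * (shiftCoeff δ d).im| ≤ 8 := by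
    rw [abs_mul]
    calc _ ≤ (2 : ℝ) * 4 := mul_le_mul hα b3 (abs_nonneg _) (by norm_num)
      _ = 8 := by norm_num
  have hακ' := abs_le.1 hακ
  have hrδ : 0 < r - δ := by linarith
  have hsδ : 0 < s + δ := by linarith
  have m1 : ((r : ℂ) - δ) ≠ 0 := by exact_mod_cast hrδ.ne'
  have m2 : ((s : ℂ) + δ) ≠ 0 := by exact_mod_cast hsδ.ne'
  have e1 : chartField α δ d r = (((r - δ) ^ 2 : ℝ) : ℂ) * ((α + Complex.I) *
      (((1 / (r - δ) : ℝ) : ℂ) + shiftCoeff δ d)) := by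
    rw [chartField, shiftCoeff]
    push_cast
    obtain ⟨e, he⟩ : ∃ e, e = 1 + d * δ := ⟨_, rfl⟩
    rw [← he] at hn ⊢
    field_simp
    linear_combination (-(α + Complex.I)) * he
  have e2 : chartField α δ d ((-s : ℝ) : ℂ) = ((-(s + δ) ^ 2 : ℝ) : ℂ) * ((α + Complex.I) *
      (((1 / (s + δ) : ℝ) : ℂ) - shiftCoeff δ d)) := by
    rw [chartField, shiftCoeff]
    push_cast
    obtain ⟨e, he⟩ : ∃ e, e = 1 + d * δ := ⟨_, rfl⟩
    rw [← he] at hn ⊢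
    field_simp
    linear_combination (α + Complex.I) * (s + δ) * he
  rw [e1, e2, Complex.im_ofReal_mul, Complex.im_ofReal_mul]
  constructor
  · refine mul_pos (by positivity) ?_
    simp only [Complex.mul_im, Complex.add_re, Complex.add_im, Complex.ofReal_re,
      Complex.ofReal_im, Complex.I_re, Complex.I_im]
    linarith
  · refine mul_neg_of_neg_of_pos (by have : 0 < (s + δ) ^ 2 := by positivity
                                     linarith) ?_
    simp only [Complex.mul_im, Complex.add_re, Complex.add_im, Complex.sub_re, Complex.sub_im,
      Complex.ofReal_re, Complex.ofReal_im, Complex.I_re, Complex.I_im]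
    linarith

end CircleHolo

end

/-! ### Arcs of the polynomial fields -/

noncomputable section

namespace CircleHolo

/-- The extension to complex parameters of the chart of the circle centred at `1`. -/
def cayley (ζ : ℂ) : ℂ := (1 - Complex.I * ζ) / (1 + Complex.I * ζ)

theorem cayley_ofReal (x : ℝ) : cayley x = circlePoint 1 x := by
  rw [cayley, circlePoint, one_mul]

theorem one_add_I_mul_ne_zero_of_norm {ζ : ℂ} (h : ‖ζ‖ ≤ 1 / 2) : 1 / 2 ≤ ‖1 + Complex.I * ζ‖ := by
  have h1 := norm_sub_norm_le (1 : ℂ) (-(Complex.I * ζ))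
  rw [sub_neg_eq_add, norm_neg, norm_one, norm_mul, Complex.norm_I, one_mul] at h1
  linarith

theorem norm_cayley_sub_one_le {ζ : ℂ} (h : ‖ζ‖ ≤ 1 / 2) : ‖cayley ζ - 1‖ ≤ 4 * ‖ζ‖ := by
  have h1 := one_add_I_mul_ne_zero_of_norm h
  have h2 : 1 + Complex.I * ζ ≠ 0 := norm_ne_zero_iff.1 (by linarith)
  have h3 : cayley ζ - 1 = -2 * Complex.I * ζ / (1 + Complex.I * ζ) := by
    rw [cayley]
    field_simp
    ring
  rw [h3, norm_div, div_le_iff₀ (by linarith)]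
  simp only [norm_mul, norm_neg, Complex.norm_I, Complex.norm_ofNat, mul_one]
  nlinarith [norm_nonneg ζ]

/-- This identity is why the upper half-plane corresponds to the exterior of the circle. -/
theorem normSq_one_sub_I_mul (ζ : ℂ) :
    ‖1 - Complex.I * ζ‖ ^ 2 = ‖1 + Complex.I * ζ‖ ^ 2 + 4 * ζ.im := by
  rw [← Complex.normSq_eq_norm_sq, ← Complex.normSq_eq_norm_sq, Complex.normSq_apply,
    Complex.normSq_apply]
  simp
  ring

theorem one_lt_norm_cayley {ζ : ℂ} (h : ‖ζ‖ ≤ 1 / 2) (hi : 0 < ζ.im) : 1 < ‖cayley ζ‖ := by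
  have h1 := one_add_I_mul_ne_zero_of_norm h
  rw [cayley, norm_div, one_lt_div (by linarith)]
  have := normSq_one_sub_I_mul ζ
  nlinarith [norm_nonneg (1 - Complex.I * ζ)]

theorem norm_cayley_lt_one {ζ : ℂ} (h : ‖ζ‖ ≤ 1 / 2) (hi : ζ.im < 0) : ‖cayley ζ‖ < 1 := by
  have h1 := one_add_I_mul_ne_zero_of_norm h
  rw [cayley, norm_div, div_lt_one (by linarith)]
  have := normSq_one_sub_I_mul ζ
  nlinarith [norm_nonneg (1 - Complex.I * ζ)]

theorem hasDerivAt_cayley {ζ : ℂ} (h : 1 + Complex.I * ζ ≠ 0) :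
    HasDerivAt cayley (-2 * Complex.I / (1 + Complex.I * ζ) ^ 2) ζ := by
  have h1 : HasDerivAt (fun ζ : ℂ => Complex.I * ζ) (Complex.I * 1) ζ :=
    (hasDerivAt_id ζ).const_mul _
  refine ((h1.const_sub 1).div (h1.const_add 1) h).congr_deriv ?_
  congr 1
  ring

/-- The leading factor of the polynomial field that is `chartField` in the chart at `1`. -/
def fieldFactor (α δ : ℝ) (d : ℂ) : ℂ := -Complex.I * (α + Complex.I) / (2 * (1 + d * δ))

/-- The quadratic polynomial field that is `chartField` in the chart at `1`. -/
def polyField (α δ : ℝ) (d : ℂ) : ℂ[X] :=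
  C (fieldFactor α δ d * ((Complex.I - δ) * (1 + Complex.I * d))) * X ^ 2 +
  C (fieldFactor α δ d * ((Complex.I - δ) * (1 - Complex.I * d) -
    (Complex.I + δ) * (1 + Complex.I * d))) * X +
  C (fieldFactor α δ d * (-(Complex.I + δ) * (1 - Complex.I * d)))

/-- `polyField` is the push-forward of `chartField`. It factors into two linear forms in `z`,
vanishing at the images of `δ` and of `-1/d`; each contributes a factor `1/(1 + iζ)`, and together
they match the derivative of `cayley`. -/
theorem eval_polyField_cayley (α δ : ℝ) {d ζ : ℂ} (h : 1 + Complex.I * ζ ≠ 0)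
    (hd : 1 + d * δ ≠ 0) : (polyField α δ d).eval (cayley ζ) =
      -2 * Complex.I / (1 + Complex.I * ζ) ^ 2 * chartField α δ d ζ := by
  have e0 : (polyField α δ d).eval (cayley ζ) = fieldFactor α δ d *
      ((Complex.I - δ) * cayley ζ - (Complex.I + δ)) *
      ((1 + Complex.I * d) * cayley ζ + (1 - Complex.I * d)) := by
    simp only [polyField, eval_add, eval_mul, eval_C, eval_X, eval_pow]
    ring
  have e1 : (Complex.I - δ) * cayley ζ - (Complex.I + δ) = 2 * (ζ - δ) / (1 + Complex.I * ζ) := by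
    rw [cayley]
    field_simp
    linear_combination (-2 * ζ) * Complex.I_sq
  have e2 : (1 + Complex.I * d) * cayley ζ + (1 - Complex.I * d) =
      2 * (1 + d * ζ) / (1 + Complex.I * ζ) := by
    rw [cayley]
    field_simp
    linear_combination (-2 * ζ * d) * Complex.I_sq
  rw [e0, e1, e2, fieldFactor, chartField]
  obtain ⟨e, he⟩ : ∃ e, e = 1 + d * δ := ⟨_, rfl⟩
  rw [← he] at hd ⊢
  field_simp

/-- The chart is conformal and takes the real axis to the circle, so the normal component is
rescaled by the positive factor `2/(1 + x²)`. -/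
theorem radial_polyField (α δ x : ℝ) {d : ℂ} (hd : 1 + d * δ ≠ 0) :
    radial (circlePoint 1 x) ((polyField α δ d).eval (circlePoint 1 x)) =
      2 / (1 + x ^ 2) * (chartField α δ d x).im := by
  have h1 := one_add_I_mul_ne_zero x
  have h2 := one_sub_I_mul_ne_zero x
  have hc : starRingEnd ℂ (circlePoint 1 x) = (1 + Complex.I * x) / (1 - Complex.I * x) := by
    rw [circlePoint, one_mul, map_div₀]
    simp [sub_eq_add_neg]
  have h3 : (1 + Complex.I * x) * (1 - Complex.I * x) = ((1 + x ^ 2 : ℝ) : ℂ) := by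
    push_cast
    linear_combination (-(x : ℂ) ^ 2) * Complex.I_sq
  have h4 : starRingEnd ℂ (circlePoint 1 x) * (polyField α δ d).eval (circlePoint 1 x) =
      ((2 / (1 + x ^ 2) : ℝ) : ℂ) * (-Complex.I * chartField α δ d x) := by
    rw [hc, ← cayley_ofReal, eval_polyField_cayley α δ h1 hd, Complex.ofReal_div, ← h3]
    push_cast
    field_simp
  rw [radial, h4, Complex.re_ofReal_mul]
  simp

theorem hasDerivWithinAt_singleton (f : ℝ → ℂ) (v : ℂ) (x : ℝ) : HasDerivWithinAt f v {x} x := by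
  rw [hasDerivWithinAt_iff_tendsto_slope]
  simp

/-- The curve `η` is on `[0, τ]` a solution of `ż = F(z)`, from the point of the circle with
parameter `a` to the one with parameter `b`, through `D`. -/
structure IsArc (F : ℂ[X]) (D : Set ℂ) (a b : ℝ) (η : ℝ → ℂ) (τ : ℝ) : Prop where
  pos : 0 < τ
  deriv : ∀ t ∈ Icc 0 τ, HasDerivAt η (F.eval (η t)) t
  start : η 0 = circlePoint 1 a
  finish : η τ = circlePoint 1 b
  mem : ∀ t ∈ Ioo 0 τ, η t ∈ D

theorem IsArc.connects {F : ℂ[X]} {D : Set ℂ} {a b : ℝ} {η : ℝ → ℂ} {τ : ℝ}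
    (h : IsArc F D a b η τ) : Connects F D (circlePoint 1 a) (circlePoint 1 b) :=
  ⟨η, τ, h.pos, fun t ht => (h.deriv t ht).hasDerivWithinAt, h.start, h.finish, h.mem⟩

theorem IsArc.outer_trajectory {Fp Fm : ℂ[X]} {a b : ℝ} {η : ℝ → ℂ} {τ : ℝ}
    (h : IsArc Fp {z | 1 < ‖z‖} a b η τ)
    (hpa : 0 < radial (circlePoint 1 a) (Fp.eval (circlePoint 1 a)))
    (hma : 0 < radial (circlePoint 1 a) (Fm.eval (circlePoint 1 a)))
    (hpb : radial (circlePoint 1 b) (Fp.eval (circlePoint 1 b)) < 0)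
    (hmb : radial (circlePoint 1 b) (Fm.eval (circlePoint 1 b)) < 0) :
    IsCrossingTrajectory Fp Fm (Icc 0 τ) η := by
  have hcase : ∀ t ∈ Icc 0 τ, t = 0 ∨ t = τ ∨ 1 < ‖η t‖ := by
    intro t ht
    rcases ht.1.eq_or_lt with h0 | h0
    · exact Or.inl h0.symm
    rcases ht.2.eq_or_lt with h1 | h1
    · exact Or.inr (Or.inl h1)
    · exact Or.inr (Or.inr (h.mem t ⟨h0, h1⟩))
  refine ⟨fun t ht _ => (h.deriv t ht).hasDerivWithinAt, fun t ht hlt => ?_, fun t ht h1 => ?_⟩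
  · rcases hcase t ht with rfl | rfl | h2
    · rw [h.start, norm_circlePoint] at hlt; exact absurd hlt (lt_irrefl _)
    · rw [h.finish, norm_circlePoint] at hlt; exact absurd hlt (lt_irrefl _)
    · exact absurd hlt h2.le.not_gt
  · rcases hcase t ht with rfl | rfl | h2
    · refine Or.inl ⟨h.start ▸ hma, h.start ▸ hpa, ?_, (h.deriv _ ht).hasDerivWithinAt⟩
      -- At an endpoint of the time interval only one one-sided derivative carries information; the
      -- other is taken over a single point.
      have : Icc (0 : ℝ) τ ∩ Iic 0 = {0} := by
        ext x
        simp only [mem_inter_iff, mem_Icc, mem_Iic, mem_singleton_iff]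
        exact ⟨fun hx => le_antisymm hx.2 hx.1.1, fun hx => by subst hx; exact ⟨ht, le_rfl⟩⟩
      rw [this]
      exact hasDerivWithinAt_singleton _ _ _
    · refine Or.inr ⟨h.finish ▸ hmb, h.finish ▸ hpb, (h.deriv _ ht).hasDerivWithinAt, ?_⟩
      have : Icc (0 : ℝ) t ∩ Ici t = {t} := by
        ext x
        simp only [mem_inter_iff, mem_Icc, mem_Ici, mem_singleton_iff]
        exact ⟨fun hx => le_antisymm hx.1.2 hx.2, fun hx => by subst hx; exact ⟨ht, le_rfl⟩⟩
      rw [this]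
      exact hasDerivWithinAt_singleton _ _ _
    · exact absurd h1 h2.ne'

theorem IsArc.inner_trajectory {Fp Fm : ℂ[X]} {a b : ℝ} {η : ℝ → ℂ} {τ : ℝ}
    (h : IsArc Fm {z | ‖z‖ < 1} a b η τ)
    (hpa : radial (circlePoint 1 a) (Fp.eval (circlePoint 1 a)) < 0)
    (hma : radial (circlePoint 1 a) (Fm.eval (circlePoint 1 a)) < 0)
    (hpb : 0 < radial (circlePoint 1 b) (Fp.eval (circlePoint 1 b)))
    (hmb : 0 < radial (circlePoint 1 b) (Fm.eval (circlePoint 1 b))) :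
    IsCrossingTrajectory Fp Fm (Icc 0 τ) η := by
  have hcase : ∀ t ∈ Icc 0 τ, t = 0 ∨ t = τ ∨ ‖η t‖ < 1 := by
    intro t ht
    rcases ht.1.eq_or_lt with h0 | h0
    · exact Or.inl h0.symm
    rcases ht.2.eq_or_lt with h1 | h1
    · exact Or.inr (Or.inl h1)
    · exact Or.inr (Or.inr (h.mem t ⟨h0, h1⟩))
  refine ⟨fun t ht hlt => ?_, fun t ht _ => (h.deriv t ht).hasDerivWithinAt, fun t ht h1 => ?_⟩
  · rcases hcase t ht with rfl | rfl | h2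
    · rw [h.start, norm_circlePoint] at hlt; exact absurd hlt (lt_irrefl _)
    · rw [h.finish, norm_circlePoint] at hlt; exact absurd hlt (lt_irrefl _)
    · exact absurd hlt h2.le.not_gt
  · rcases hcase t ht with rfl | rfl | h2
    · refine Or.inr ⟨h.start ▸ hma, h.start ▸ hpa, ?_, (h.deriv _ ht).hasDerivWithinAt⟩
      have : Icc (0 : ℝ) τ ∩ Iic 0 = {0} := by
        ext x
        simp only [mem_inter_iff, mem_Icc, mem_Iic, mem_singleton_iff]
        exact ⟨fun hx => le_antisymm hx.2 hx.1.1, fun hx => by subst hx; exact ⟨ht, le_rfl⟩⟩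
      rw [this]
      exact hasDerivWithinAt_singleton _ _ _
    · refine Or.inl ⟨h.finish ▸ hmb, h.finish ▸ hpb, (h.deriv _ ht).hasDerivWithinAt, ?_⟩
      have : Icc (0 : ℝ) t ∩ Ici t = {t} := by
        ext x
        simp only [mem_inter_iff, mem_Icc, mem_Ici, mem_singleton_iff]
        exact ⟨fun hx => le_antisymm hx.1.2 hx.2, fun hx => by subst hx; exact ⟨ht, le_rfl⟩⟩
      rw [this]
      exact hasDerivWithinAt_singleton _ _ _
    · exact absurd h1 h2.ne

/-- The half-return arc through the exterior of the circle. -/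
def outerArc (α δ : ℝ) (d : ℂ) (r t : ℝ) : ℂ := cayley (arc α δ d r t)

/-- The half-return arc through the interior of the circle, from the parameter `-s`. -/
def innerArc (α δ : ℝ) (d : ℂ) (s t : ℝ) : ℂ := cayley (-arc α (-δ) (-d) s t)

/-- The symmetry `ζ ↦ -ζ` exchanges the half-planes, so inner arcs are outer arcs with `δ` and `d`
negated. -/
theorem chartField_neg (α δ : ℝ) (d ζ : ℂ) :
    chartField α (-δ) (-d) ζ = -chartField α δ d (-ζ) := by
  rw [chartField, chartField]
  push_cast
  rw [neg_mul_neg]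
  ring

variable {α δ : ℝ} {d : ℂ} {r s : ℝ}

theorem Admissible.norm_arc_le_half (h : Admissible α δ d r s) {t : ℝ}
    (ht : t ∈ Icc 0 (arcTime d r s)) : ‖arc α δ d r t‖ ≤ 1 / 2 :=
  (h.norm_arc_le ht).trans (by linarith [h.hr1])

theorem Admissible.isArc_outerArc (h : Admissible α δ d r s)
    (hI : firstIntegral α δ d (-s) = firstIntegral α δ d r + α * Real.pi) :
    IsArc (polyField α δ d) {z | 1 < ‖z‖} r (-s) (outerArc α δ d r) (arcTime d r s) := by
  have hpi := Real.pi_pos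
  refine ⟨by linarith [h.arcTime_mem.1], fun t ht => ?_, ?_, ?_, fun t ht => ?_⟩
  · have hne : 1 + Complex.I * arc α δ d r t ≠ 0 := norm_ne_zero_iff.1
      (by linarith [one_add_I_mul_ne_zero_of_norm (h.norm_arc_le_half ht)])
    have := (hasDerivAt_cayley hne).comp t (h.hasDerivAt_arc ht)
    rw [outerArc, eval_polyField_cayley α δ hne h.one_add_ne.1]
    exact this
  · rw [outerArc, arc_zero, cayley_ofReal]
  · rw [outerArc, h.arc_arcTime hI, cayley_ofReal]
  · exact one_lt_norm_cayley (h.norm_arc_le_half (Ioo_subset_Icc_self ht)) (h.im_arc_pos hI ht)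

theorem Admissible.isArc_innerArc (h : Admissible α δ d r s)
    (hI : firstIntegral α δ d r = firstIntegral α δ d (-s) + α * Real.pi) :
    IsArc (polyField α δ d) {z | ‖z‖ < 1} (-s) r (innerArc α δ d s) (arcTime (-d) s r) := by
  have hpi := Real.pi_pos
  have h' := h.symm
  have hI' : firstIntegral α (-δ) (-d) (-r) = firstIntegral α (-δ) (-d) s + α * Real.pi := by
    rw [firstIntegral_neg, firstIntegral_neg, neg_neg, hI]
  refine ⟨by linarith [h'.arcTime_mem.1], fun t ht => ?_, ?_, ?_, fun t ht => ?_⟩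
  · have hne : 1 + Complex.I * (-arc α (-δ) (-d) s t) ≠ 0 := norm_ne_zero_iff.1
      (by
        have := one_add_I_mul_ne_zero_of_norm (ζ := -arc α (-δ) (-d) s t)
          (by rw [norm_neg]; exact h'.norm_arc_le_half ht)
        linarith)
    have := (hasDerivAt_cayley hne).comp t (h'.hasDerivAt_arc ht).neg
    rw [innerArc, eval_polyField_cayley α δ hne h.one_add_ne.1]
    rw [chartField_neg, neg_neg] at this
    exact this
  · rw [innerArc, arc_zero, ← Complex.ofReal_neg, cayley_ofReal]
  · rw [innerArc, h'.arc_arcTime hI', ← Complex.ofReal_neg, neg_neg, cayley_ofReal]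
  · refine norm_cayley_lt_one ?_ ?_
    · rw [norm_neg]; exact h'.norm_arc_le_half (Ioo_subset_Icc_self ht)
    · rw [Complex.neg_im]; linarith [h'.im_arc_pos hI' ht]

theorem Admissible.norm_outerArc_sub_one_le (h : Admissible α δ d r s) {t : ℝ}
    (ht : t ∈ Icc 0 (arcTime d r s)) : ‖outerArc α δ d r t - 1‖ ≤ 200000 * r := by
  refine (norm_cayley_sub_one_le (h.norm_arc_le_half ht)).trans ?_
  linarith [h.norm_arc_le ht]

theorem Admissible.norm_innerArc_sub_one_le (h : Admissible α δ d r s) {t : ℝ}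
    (ht : t ∈ Icc 0 (arcTime (-d) s r)) : ‖innerArc α δ d s t - 1‖ ≤ 200000 * s := by
  refine (norm_cayley_sub_one_le (by rw [norm_neg]; exact h.symm.norm_arc_le_half ht)).trans ?_
  rw [norm_neg]
  linarith [h.symm.norm_arc_le ht]

theorem Admissible.radial_pos (h : Admissible α δ d r s) :
    0 < radial (circlePoint 1 r) ((polyField α δ d).eval (circlePoint 1 r)) := by
  rw [radial_polyField α δ r h.one_add_ne.1]
  exact mul_pos (by positivity) h.im_chartField.1

theorem Admissible.radial_neg (h : Admissible α δ d r s) :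
    radial (circlePoint 1 (-s)) ((polyField α δ d).eval (circlePoint 1 (-s))) < 0 := by
  rw [radial_polyField α δ (-s) h.one_add_ne.1]
  exact mul_neg_of_pos_of_neg (by positivity) h.im_chartField.2

end CircleHolo

end

/-! ### Half-return maps and hyperbolic limit cycles -/

noncomputable section

namespace CircleHolo

/-- The derivative of `firstIntegral`. -/
def firstIntegralDeriv (α δ : ℝ) (d : ℂ) (x : ℝ) : ℝ :=
  1 / (x - δ) - ((1 + α * Complex.I) * (d / (1 + d * x))).re

theorem one_add_mem_slitPlane {d : ℂ} {x : ℝ} (hd : ‖d‖ ≤ 2) (hx : |x| ≤ 1 / 1000000) :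
    1 + d * x ∈ Complex.slitPlane :=
  Complex.mem_slitPlane_of_norm_lt_one
    (lt_of_le_of_lt (norm_mul_ofReal_le hd hx) (by norm_num))

theorem hasDerivAt_firstIntegral (α : ℝ) {δ x : ℝ} {d : ℂ} (hd : ‖d‖ ≤ 2) (hx : |x| ≤ 1 / 1000000)
    (hxδ : x - δ ≠ 0) : HasDerivAt (firstIntegral α δ d) (firstIntegralDeriv α δ d x) x := by
  have h1 : HasDerivAt (fun x : ℝ => Real.log (x - δ)) (1 / (x - δ)) x :=
    ((hasDerivAt_id x).sub_const δ).log hxδ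
  have h2 : HasDerivAt (fun x : ℝ => 1 + d * (x : ℂ)) (d * 1) x :=
    ((Complex.ofRealCLM.hasDerivAt (x := x)).const_mul d).const_add 1
  rw [mul_one] at h2
  have h3 := (h2.clog_real (one_add_mem_slitPlane hd hx)).const_mul (1 + α * Complex.I)
  have h4 := Complex.reCLM.hasFDerivAt.comp_hasDerivAt x h3
  exact h1.sub h4

theorem norm_one_add_mul_I_le {α : ℝ} (hα : |α| ≤ 2) : ‖1 + (α : ℂ) * Complex.I‖ ≤ 3 := by
  refine (norm_add_le _ _).trans ?_
  rw [norm_one, norm_mul, Complex.norm_I, Complex.norm_real, Real.norm_eq_abs]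
  linarith

theorem abs_re_mul_log_le {α x : ℝ} {d : ℂ} (hα : |α| ≤ 2) (hd : ‖d‖ ≤ 2)
    (hx : |x| ≤ 1 / 1000000) : |((1 + α * Complex.I) * Complex.log (1 + d * x)).re| ≤ 9 * |x| := by
  refine (Complex.abs_re_le_norm _).trans ?_
  rw [norm_mul]
  have h1 := norm_one_add_mul_I_le hα
  have h2 := norm_log_one_add_le hd hx
  calc _ ≤ 3 * (3 * |x|) := mul_le_mul h1 h2 (norm_nonneg _) (by norm_num)
    _ = 9 * |x| := by ring

theorem abs_re_mul_div_le {α x : ℝ} {d : ℂ} (hα : |α| ≤ 2) (hd : ‖d‖ ≤ 2)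
    (hx : |x| ≤ 1 / 1000000) : |((1 + α * Complex.I) * (d / (1 + d * x))).re| ≤ 12 := by
  refine (Complex.abs_re_le_norm _).trans ?_
  have h1 := norm_one_add_mul_I_le hα
  have h2 := norm_mul_ofReal_le hd hx
  have h3 : 1 / 2 ≤ ‖1 + d * x‖ := by
    have := norm_sub_norm_le (1 : ℂ) (-(d * x))
    rw [sub_neg_eq_add, norm_neg, norm_one] at this
    linarith
  have h4 : ‖d / (1 + d * x)‖ ≤ 4 := by
    rw [norm_div, div_le_iff₀ (by linarith)]
    linarith
  rw [norm_mul]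
  calc _ ≤ (3 : ℝ) * 4 := mul_le_mul h1 h4 (norm_nonneg _) (by norm_num)
    _ = 12 := by norm_num

theorem firstIntegralDeriv_neg (α δ : ℝ) (d : ℂ) (x : ℝ) :
    firstIntegralDeriv α (-δ) (-d) x = -firstIntegralDeriv α δ d (-x) := by
  have h1 : 1 / (x - -δ) = -(1 / (-x - δ)) := by
    rw [show -x - δ = -(x - -δ) by ring, one_div, one_div, inv_neg, neg_neg]
  have h2 : (1 + (α : ℂ) * Complex.I) * (-d / (1 + -d * x)) =
      -((1 + α * Complex.I) * (d / (1 + d * ((-x : ℝ) : ℂ)))) := by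
    push_cast
    rw [neg_mul_comm d, neg_div, mul_neg]
  rw [firstIntegralDeriv, firstIntegralDeriv, h1, h2, Complex.neg_re]
  ring

theorem one_le_firstIntegralDeriv {α δ x : ℝ} {d : ℂ} (hα : |α| ≤ 2) (hd : ‖d‖ ≤ 2) (hx0 : 0 < x)
    (hδ : |δ| ≤ x / 4) (hx : x ≤ 1 / 1000000) : 1 ≤ firstIntegralDeriv α δ d x := by
  have h1 := (abs_le.1 (abs_re_mul_div_le (x := x) hα hd (by rwa [abs_of_pos hx0]))).2
  have h2 := abs_le.1 hδ
  have h3 : 13 ≤ 1 / (x - δ) := by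
    rw [le_div_iff₀ (by linarith)]
    linarith
  rw [firstIntegralDeriv]
  linarith

theorem firstIntegralDeriv_le_neg_one {α δ x : ℝ} {d : ℂ} (hα : |α| ≤ 2) (hd : ‖d‖ ≤ 2)
    (hx0 : 0 < x) (hδ : |δ| ≤ x / 4) (hx : x ≤ 1 / 1000000) :
    firstIntegralDeriv α δ d (-x) ≤ -1 := by
  have := one_le_firstIntegralDeriv (δ := -δ) (d := -d) hα (by rwa [norm_neg]) hx0
    (by rwa [abs_neg]) hx
  rw [firstIntegralDeriv_neg] at this
  linarith

theorem sub_le_firstIntegral_sub {α δ x y : ℝ} {d : ℂ} (hα : |α| ≤ 2) (hd : ‖d‖ ≤ 2) (hx0 : 0 < x)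
    (hδ : |δ| ≤ x / 4) (hxy : x ≤ y) (hy : y ≤ 1 / 1000000) :
    y - x ≤ firstIntegral α δ d y - firstIntegral α δ d x := by
  have hder : ∀ t ∈ Icc x y,
      HasDerivAt (firstIntegral α δ d) (firstIntegralDeriv α δ d t) t := by
    intro t ht
    have ht0 : 0 < t := hx0.trans_le ht.1
    refine hasDerivAt_firstIntegral α hd (by rw [abs_of_pos ht0]; linarith [ht.2]) ?_
    have := (abs_le.1 hδ).2
    exact ne_of_gt (by linarith [ht.1])
  have := (convex_Icc x y).mul_sub_le_image_sub_of_le_deriv (f := firstIntegral α δ d) (C := 1)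
    (fun t ht => (hder t ht).continuousAt.continuousWithinAt)
    (fun t ht => (hder t (interior_subset ht)).differentiableAt.differentiableWithinAt)
    (fun t ht => by
      have ht' := interior_subset ht
      rw [(hder t ht').deriv]
      exact one_le_firstIntegralDeriv hα hd (hx0.trans_le ht'.1) (by linarith [ht'.1])
        (by linarith [ht'.2]))
    x ⟨le_rfl, hxy⟩ y ⟨hxy, le_rfl⟩ hxy
  linarith

/-- On each side of the zero the pole makes the derivative of the first integral at least 1 in
modulus. This yields both uniqueness of the return point and continuity of the half-return map. -/
theorem abs_sub_le_firstIntegral_sub {α δ x y : ℝ} {d : ℂ} (hα : |α| ≤ 2) (hd : ‖d‖ ≤ 2)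
    (hx0 : 0 < x) (hy0 : 0 < y) (hδx : |δ| ≤ x / 4) (hδy : |δ| ≤ y / 4) (hx : x ≤ 1 / 1000000)
    (hy : y ≤ 1 / 1000000) :
    |y - x| ≤ |firstIntegral α δ d (-y) - firstIntegral α δ d (-x)| := by
  rw [← firstIntegral_neg, ← firstIntegral_neg]
  have hd' : ‖-d‖ ≤ 2 := by rwa [norm_neg]
  rcases le_total x y with h | h
  · rw [abs_of_nonneg (sub_nonneg.2 h)]
    exact (sub_le_firstIntegral_sub (δ := -δ) hα hd' hx0 (by rwa [abs_neg]) h hy).trans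
      (le_abs_self _)
  · rw [abs_sub_comm, abs_of_nonneg (sub_nonneg.2 h), abs_sub_comm]
    exact (sub_le_firstIntegral_sub (δ := -δ) hα hd' hy0 (by rwa [abs_neg]) h hx).trans
      (le_abs_self _)

/-- Intermediate value theorem. The leading approximation is `s + δ = (r - δ) e^(α π)`; letting `s +
δ` range between half and twice this value changes the logarithm by `± log 2`, more than the error
`1/10` of the regular part. The bounds on `r` and `δ` keep the whole range admissible. -/
theorem exists_halfReturn_point {α δ r : ℝ} {d : ℂ} (hα : |α| ≤ 2) (hd : ‖d‖ ≤ 2) (hr : 0 < r)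
    (hr1 : r ≤ 1 / 100000000000) (hδ : |δ| ≤ r / 1000000) :
    ∃ s, Admissible α δ d r s ∧
      firstIntegral α δ d (-s) = firstIntegral α δ d r + α * Real.pi ∧ s ≤ 100000 * r := by
  have hpi := Real.pi_pos
  obtain ⟨hq1, hq2⟩ := exp_le_of_mul_le hα (t := Real.pi) ⟨hpi.le, by linarith⟩
  set q := Real.exp (α * Real.pi) with hq
  have hq0 : 0 < q := Real.exp_pos _
  have hq3 : 1 / 20000 ≤ q := by
    rw [Real.exp_neg] at hq2
    rw [one_div]
    exact inv_le_of_inv_le₀ hq0 hq2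
  have hδ' := abs_le.1 hδ
  set m := r - δ with hm
  have hm1 : 9 / 10 * r ≤ m := by linarith
  have hm2 : m ≤ 11 / 10 * r := by linarith
  have hm0 : 0 < m := by linarith
  have hadm : ∀ s ∈ Icc (m * q / 2 - δ) (2 * (m * q) - δ), Admissible α δ d r s := by
    intro s hs
    have h1 : m * (1 / 20000) ≤ m * q := mul_le_mul_of_nonneg_left hq3 hm0.le
    have h2 : m * q ≤ m * 20000 := mul_le_mul_of_nonneg_left hq1 hm0.le
    have h3 : s ≤ 50000 * r := by linarith [hs.2]
    have h4 : r / 100000 ≤ s := by linarith [hs.1]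
    exact ⟨hα, hd, hr, by linarith, by linarith, by linarith, by linarith, by linarith⟩
  have hle : m * q / 2 - δ ≤ 2 * (m * q) - δ := by
    have : 0 < m * q := by positivity
    linarith
  have hcont : ContinuousOn (fun s => firstIntegral α δ d (-s))
      (Icc (m * q / 2 - δ) (2 * (m * q) - δ)) := by
    intro s hs
    have ha := hadm s hs
    have h1 : HasDerivAt (firstIntegral α δ d) (firstIntegralDeriv α δ d (-s)) (-s) := by
      refine hasDerivAt_firstIntegral α hd ?_ ?_
      · rw [abs_neg, abs_of_pos ha.hs]; exact ha.hs1
      · have := (abs_le.1 ha.hδs).1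
        have := ha.hs
        exact ne_of_lt (by linarith)
    exact (h1.continuousAt.comp (f := fun s : ℝ => -s)
      continuous_neg.continuousAt).continuousWithinAt
  have hval : ∀ s ∈ Icc (m * q / 2 - δ) (2 * (m * q) - δ),
      |firstIntegral α δ d (-s) - firstIntegral α δ d r - α * Real.pi -
        (Real.log (s + δ) - Real.log (m * q))| ≤ 1 / 10 := by
    intro s hs
    have ha := hadm s hs
    have b1 := abs_le.1 (abs_re_mul_log_le (x := r) hα hd (by rw [abs_of_pos hr]; exact ha.hr1))
    have b2 := abs_le.1 (abs_re_mul_log_le (x := -s) hα hd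
      (by rw [abs_neg, abs_of_pos ha.hs]; exact ha.hs1))
    rw [abs_of_pos hr] at b1
    rw [abs_neg, abs_of_pos ha.hs] at b2
    have e1 : Real.log (-s - δ) = Real.log (s + δ) := by
      rw [← Real.log_neg_eq_log]; congr 1; ring
    have e2 : Real.log (m * q) = Real.log m + α * Real.pi := by
      rw [Real.log_mul hm0.ne' hq0.ne', hq, Real.log_exp]
    rw [firstIntegral, firstIntegral, e1, e2, abs_le]
    have := ha.hs1
    have := ha.hr1
    constructor <;> linarith [b1.1, b1.2, b2.1, b2.2]
  have hlog2 : 1 / 2 < Real.log 2 := by linarith [Real.log_two_gt_d9]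
  have hmq : 0 < m * q := by positivity
  obtain ⟨s, hs, hsv⟩ := intermediate_value_Icc hle hcont
    (show firstIntegral α δ d r + α * Real.pi ∈ Icc _ _ from by
      constructor
      · have := (abs_le.1 (hval _ ⟨le_rfl, hle⟩)).2
        rw [sub_add_cancel, Real.log_div hmq.ne' two_ne_zero] at this
        linarith
      · have := (abs_le.1 (hval _ ⟨hle, le_rfl⟩)).1
        rw [sub_add_cancel, Real.log_mul two_ne_zero hmq.ne'] at this
        linarith)
  refine ⟨s, hadm s hs, hsv, ?_⟩
  have h2 : m * q ≤ m * 20000 := mul_le_mul_of_nonneg_left hq1 hm0.le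
  linarith [hs.2]

/-- Implicit differentiation for a map already known to be continuous: dividing by the continuous
slope `dslope K` requires differentiability only at the point. -/
theorem hasDerivAt_of_comp_eq {K h g : ℝ → ℝ} {k h' r : ℝ} (hg : ContinuousAt g r)
    (hK : HasDerivAt K k (g r)) (hk : k ≠ 0) (hh : HasDerivAt h h' r)
    (he : ∀ᶠ y in 𝓝 r, K (g y) = h y) : HasDerivAt g (h' / k) r := by
  rw [hasDerivAt_iff_tendsto_slope] at hh ⊢
  have h1 : Tendsto (fun y => dslope K (g r) (g y)) (𝓝 r) (𝓝 k) := by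
    have h2 : ContinuousAt (dslope K (g r)) (g r) :=
      continuousAt_dslope_same.2 hK.differentiableAt
    have h3 := h2.tendsto.comp hg.tendsto
    rwa [dslope_same, hK.deriv] at h3
  refine (hh.div (h1.mono_left nhdsWithin_le_nhds) hk).congr' ?_
  filter_upwards [nhdsWithin_le_nhds he, nhdsWithin_le_nhds (h1.eventually_ne hk),
    self_mem_nhdsWithin] with y hy hne hyr
  have h4 := sub_smul_dslope K (g r) (g y)
  rw [smul_eq_mul, hy, he.self_of_nhds] at h4
  rw [Pi.div_apply, slope_def_field, slope_def_field, ← h4]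
  have : y - r ≠ 0 := sub_ne_zero.2 hyr
  field_simp

/-- The half-return map from the arc of positive to the arc of negative parameters, with the sign
of its values changed. -/
theorem exists_halfReturn (α δ : ℝ) (d : ℂ) (hα : |α| ≤ 2) (hd : ‖d‖ ≤ 2) :
    ∃ g : ℝ → ℝ, ∀ r, 0 < r → r ≤ 1 / 100000000000 → |δ| ≤ r / 1000000 →
      Admissible α δ d r (g r) ∧
      firstIntegral α δ d (-g r) = firstIntegral α δ d r + α * Real.pi ∧ g r ≤ 100000 * r ∧
      (r < 1 / 100000000000 → |δ| < r / 1000000 → HasDerivAt g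
        (-firstIntegralDeriv α δ d r / firstIntegralDeriv α δ d (-g r)) r) := by
  have hex : ∀ r, ∃ s, 0 < r → r ≤ 1 / 100000000000 → |δ| ≤ r / 1000000 →
      Admissible α δ d r s ∧
        firstIntegral α δ d (-s) = firstIntegral α δ d r + α * Real.pi ∧ s ≤ 100000 * r := by
    intro r
    by_cases h : 0 < r ∧ r ≤ 1 / 100000000000 ∧ |δ| ≤ r / 1000000
    · obtain ⟨s, hs⟩ := exists_halfReturn_point hα hd h.1 h.2.1 h.2.2
      exact ⟨s, fun _ _ _ => hs⟩
    · exact ⟨0, fun h1 h2 h3 => absurd ⟨h1, h2, h3⟩ h⟩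
  choose g hg using hex
  refine ⟨g, fun r hr hr1 hδ => ?_⟩
  obtain ⟨ha, hI, hb⟩ := hg r hr hr1 hδ
  refine ⟨ha, hI, hb, fun hr1' hδ' => ?_⟩
  have hnear : ∀ᶠ y in 𝓝 r, 0 < y ∧ y < 1 / 100000000000 ∧ |δ| < y / 1000000 :=
    (eventually_gt_nhds hr).and ((eventually_lt_nhds hr1').and
      ((show ContinuousAt (fun y : ℝ => y / 1000000) r by fun_prop).eventually
        (lt_mem_nhds hδ')))
  have hrδ : r - δ ≠ 0 := by
    have := (abs_le.1 hδ).2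
    exact ne_of_gt (by linarith)
  have hgδ : -g r - δ ≠ 0 := by
    have := (abs_le.1 ha.hδs).1
    have := ha.hs
    exact ne_of_lt (by linarith)
  have hIr : HasDerivAt (firstIntegral α δ d) (firstIntegralDeriv α δ d r) r :=
    hasDerivAt_firstIntegral α hd (by rw [abs_of_pos hr]; exact ha.hr1) hrδ
  have hIg : HasDerivAt (firstIntegral α δ d) (firstIntegralDeriv α δ d (-g r)) (-g r) :=
    hasDerivAt_firstIntegral α hd (by rw [abs_neg, abs_of_pos ha.hs]; exact ha.hs1) hgδ
  -- The first integral expands distances on the negative side, so `|g y - g r|` is at most the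
  -- change of the first integral from `r` to `y`.
  have hcont : ContinuousAt g r := by
    rw [ContinuousAt, tendsto_iff_dist_tendsto_zero]
    have h1 : Tendsto (fun y => |firstIntegral α δ d y - firstIntegral α δ d r|) (𝓝 r) (𝓝 0) := by
      have h2 := (hIr.continuousAt.tendsto.sub_const (firstIntegral α δ d r)).abs
      rwa [sub_self, abs_zero] at h2
    refine squeeze_zero' (Eventually.of_forall fun _ => dist_nonneg) ?_ h1
    filter_upwards [hnear] with y hy
    obtain ⟨ha', hI', -⟩ := hg y hy.1 hy.2.1.le hy.2.2.le
    rw [Real.dist_eq]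
    refine (abs_sub_le_firstIntegral_sub (α := α) (δ := δ) (d := d) hα hd ha.hs ha'.hs ha.hδs
      ha'.hδs ha.hs1 ha'.hs1).trans ?_
    rw [hI', hI]
    exact le_of_eq (by congr 1; ring)
  have hK : HasDerivAt (fun s => firstIntegral α δ d (-s))
      (-firstIntegralDeriv α δ d (-g r)) (g r) := by
    have h1 : HasDerivAt (fun s : ℝ => -s) (-1) (g r) := hasDerivAt_neg (g r)
    exact (hIg.comp (g r) h1).congr_deriv (by ring)
  have hle := firstIntegralDeriv_le_neg_one (α := α) (δ := δ) (d := d) hα hd ha.hs ha.hδs ha.hs1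
  have := hasDerivAt_of_comp_eq hcont hK (by linarith) (hIr.add_const (α * Real.pi))
    (by filter_upwards [hnear] with y hy using (hg y hy.1 hy.2.1.le hy.2.2.le).2.1)
  refine this.congr_deriv ?_
  rw [div_neg, neg_div]

theorem Admissible.eq_of_eq {α δ : ℝ} {d : ℂ} {r s s' : ℝ} (h : Admissible α δ d r s)
    (h' : Admissible α δ d r s') (he : firstIntegral α δ d (-s) = firstIntegral α δ d (-s')) :
    s = s' := by
  have := abs_sub_le_firstIntegral_sub (α := α) (δ := δ) (d := d) h.hα h.hd h.hs h'.hs h.hδs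
    h'.hδs h.hs1 h'.hs1
  rw [he, sub_self, abs_zero] at this
  linarith [sub_eq_zero.1 (abs_nonpos_iff.1 this)]

theorem continuousAt_arcTime {d : ℂ} {r : ℝ} {g : ℝ → ℝ} (hd : ‖d‖ ≤ 2) (hr : |r| ≤ 1 / 1000000)
    (hs : |g r| ≤ 1 / 1000000) (hg : ContinuousAt g r) :
    ContinuousAt (fun y => arcTime d y (g y)) r := by
  have h1 : ContinuousAt (fun y : ℝ => Complex.log (1 + d * y)) r := by
    refine ContinuousAt.clog (by fun_prop) (one_add_mem_slitPlane hd hr)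
  have h2 : ContinuousAt (fun y : ℝ => Complex.log (1 - d * g y)) r := by
    refine ContinuousAt.clog ?_ ?_
    · exact continuousAt_const.sub
        (continuousAt_const.mul (Complex.continuous_ofReal.continuousAt.comp hg))
    · have := one_add_mem_slitPlane (x := -g r) hd (by rwa [abs_neg])
      convert this using 1
      push_cast
      ring
  unfold arcTime
  exact continuousAt_const.add (Complex.continuous_im.continuousAt.comp (h1.sub h2))

/-- A nondegenerate solution of the two half-return equations gives a hyperbolic limit cycle. -/
theorem exists_isHyperbolicLimitCycle {α β δ : ℝ} {c d : ℂ} {r s : ℝ} (hα : |α| ≤ 2)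
    (hβ : |β| ≤ 2) (hc : ‖c‖ ≤ 2) (hd : ‖d‖ ≤ 2) (hr : 0 < r) (hs : 0 < s)
    (hr1 : r < 1 / 100000000000) (hs1 : s < 1 / 100000000000) (hδr : |δ| < r / 1000000)
    (hδs : |δ| < s / 1000000)
    (hp : firstIntegral α 0 c (-s) = firstIntegral α 0 c r + α * Real.pi)
    (hm : firstIntegral β δ d r = firstIntegral β δ d (-s) + β * Real.pi)
    (hne : firstIntegralDeriv α 0 c r * firstIntegralDeriv β δ d (-s) ≠
      firstIntegralDeriv α 0 c (-s) * firstIntegralDeriv β δ d r) :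
    ∃ Γ, IsHyperbolicLimitCycle (polyField α 0 c) (polyField β δ d) Γ ∧
      (∀ z ∈ Γ, ‖z - 1‖ ≤ 200000 * (r + s)) ∧ circlePoint 1 r ∈ Γ ∧
      ∀ x, 0 < x → circlePoint 1 x ∈ Γ → x = r := by
  have adp : Admissible α 0 c r s := ⟨hα, hc, hr, hs, by rw [abs_zero]; positivity,
    by rw [abs_zero]; positivity, by linarith, by linarith⟩
  have adm : Admissible β δ d r s :=
    ⟨hβ, hd, hr, hs, by linarith, by linarith, by linarith, by linarith⟩
  obtain ⟨gp, hgp⟩ := exists_halfReturn α 0 c hα hc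
  obtain ⟨gm, hgm⟩ := exists_halfReturn β (-δ) (-d) hβ (by rwa [norm_neg])
  have z0 : ∀ y : ℝ, 0 < y → |(0 : ℝ)| < y / 1000000 := fun y hy => by
    rw [abs_zero]; positivity
  obtain ⟨ap, hIp, -, hdp⟩ := hgp r hr hr1.le (z0 r hr).le
  obtain ⟨am, hIm, -, hdm⟩ := hgm s hs hs1.le (by rw [abs_neg]; exact hδs.le)
  have egp : gp r = s := ap.eq_of_eq adp (by rw [hIp, hp])
  have egm : gm s = r := am.eq_of_eq adm.symm (by
    rw [hIm, firstIntegral_neg, firstIntegral_neg, neg_neg, hm])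
  specialize hdp hr1 (z0 r hr)
  specialize hdm hs1 (by rwa [abs_neg])
  rw [egp] at hdp
  rw [egm, firstIntegralDeriv_neg, firstIntegralDeriv_neg, neg_neg, neg_neg, div_neg] at hdm
  have hgpt : Tendsto gp (𝓝 r) (𝓝 s) := egp ▸ hdp.continuousAt.tendsto
  have hgmt : Tendsto gm (𝓝 s) (𝓝 r) := egm ▸ hdm.continuousAt.tendsto
  have hδr' : ∀ᶠ y in 𝓝 r, |δ| < y / 1000000 :=
    (show ContinuousAt (fun y : ℝ => y / 1000000) r by fun_prop).eventually (lt_mem_nhds hδr)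
  have hδs' : ∀ᶠ y in 𝓝 s, |δ| < y / 1000000 :=
    (show ContinuousAt (fun y : ℝ => y / 1000000) s by fun_prop).eventually (lt_mem_nhds hδs)
  have admr : ∀ᶠ y in 𝓝 r, Admissible β δ d y (gp y) := by
    filter_upwards [eventually_gt_nhds hr, eventually_lt_nhds hr1, hδr',
      hgpt.eventually (eventually_gt_nhds hs), hgpt.eventually (eventually_lt_nhds hs1),
      hgpt.eventually hδs'] with y h1 h2 h3 h4 h5 h6
    exact ⟨hβ, hd, h1, h4, by linarith, by linarith, by linarith, by linarith⟩
  have adps : ∀ᶠ y in 𝓝 s, Admissible α 0 c (gm y) y ∧ Admissible β δ d (gm y) y := by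
    filter_upwards [eventually_gt_nhds hs, eventually_lt_nhds hs1, hδs',
      hgmt.eventually (eventually_gt_nhds hr), hgmt.eventually (eventually_lt_nhds hr1),
      hgmt.eventually hδr'] with y h1 h2 h3 h4 h5 h6
    exact ⟨⟨hα, hc, h4, h1, by rw [abs_zero]; positivity, by rw [abs_zero]; positivity,
      by linarith, by linarith⟩,
      ⟨hβ, hd, h4, h1, by linarith, by linarith, by linarith, by linarith⟩⟩
  -- The multiplier is the product of the two half-return derivatives. The signs of the four
  -- derivatives make it positive, so modulus one would mean equality of the products in `hne`.
  have hmul : |-firstIntegralDeriv β δ d (-s) / firstIntegralDeriv β δ d r *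
      (-firstIntegralDeriv α 0 c r / firstIntegralDeriv α 0 c (-s))| ≠ 1 := by
    have p1 := one_le_firstIntegralDeriv (α := α) (δ := 0) (d := c) hα hc hr adp.hδr adp.hr1
    have p2 := one_le_firstIntegralDeriv (α := β) (δ := δ) (d := d) hβ hd hr adm.hδr adm.hr1
    have n1 := firstIntegralDeriv_le_neg_one (α := α) (δ := 0) (d := c) hα hc hs adp.hδs adp.hs1
    have n2 := firstIntegralDeriv_le_neg_one (α := β) (δ := δ) (d := d) hβ hd hs adm.hδs adm.hs1
    rw [abs_of_pos]
    · rw [div_mul_div_comm, Ne, div_eq_one_iff_eq]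
      · intro h
        apply hne
        linarith
      · exact mul_ne_zero (by linarith) (by linarith)
    · exact mul_pos (div_pos (by linarith) (by linarith))
        (div_pos_of_neg_of_neg (by linarith) (by linarith))
  have arcp := adp.isArc_outerArc hp
  have arcm := adm.isArc_innerArc hm
  have hyp := isHyperbolicLimitCycle_of_arcs (Fp := polyField α 0 c) (Fm := polyField β δ d)
    (gp := gp) (gm := gm) (τp := fun y => arcTime c y (gp y)) (τm := fun y => arcTime (-d) y (gm y))
    (ηp := outerArc α 0 c) (ηm := innerArc β δ d) hr hs egp egm ?_ ?_
    (by simp only [egp]; exact arcp.mem) (by simp only [egm]; exact arcm.mem)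
    (continuousAt_arcTime hc (by rw [abs_of_pos hr]; exact adp.hr1)
      (by rw [egp, abs_of_pos hs]; exact adp.hs1) hdp.continuousAt)
    (continuousAt_arcTime (by rwa [norm_neg]) (by rw [abs_of_pos hs]; exact adp.hs1)
      (by rw [egm, abs_of_pos hr]; exact adp.hr1) hdm.continuousAt)
    hdp (hdm.congr_deriv (by rw [neg_div])) hmul
  · refine ⟨_, hyp, ?_, ?_, ?_⟩
    · rintro z (⟨t, ht, rfl⟩ | ⟨t, ht, rfl⟩)
      · simp only [egp] at ht
        exact (adp.norm_outerArc_sub_one_le ht).trans (by linarith)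
      · simp only [egm] at ht
        exact (adm.norm_innerArc_sub_one_le ht).trans (by linarith)
    · exact Or.inl ⟨0, ⟨le_rfl, by simp only [egp]; exact arcp.pos.le⟩, arcp.start⟩
    · rintro x hx (⟨t, ht, he⟩ | ⟨t, ht, he⟩)
      · simp only [egp] at ht
        rcases ht.1.eq_or_lt with rfl | h0
        · exact (circlePoint_injective (arcp.start.symm.trans he)).symm
        rcases ht.2.eq_or_lt with rfl | h1
        · have := circlePoint_injective (arcp.finish.symm.trans he)
          linarith
        · have := arcp.mem t ⟨h0, h1⟩
          rw [mem_ofPred_eq, he, norm_circlePoint] at this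
          exact absurd this (lt_irrefl _)
      · simp only [egm] at ht
        rcases ht.1.eq_or_lt with rfl | h0
        · have := circlePoint_injective (arcm.start.symm.trans he)
          linarith
        rcases ht.2.eq_or_lt with rfl | h1
        · exact (circlePoint_injective (arcm.finish.symm.trans he)).symm
        · have := arcm.mem t ⟨h0, h1⟩
          rw [mem_ofPred_eq, he, norm_circlePoint] at this
          exact absurd this (lt_irrefl _)
  · filter_upwards [admr, eventually_gt_nhds hr, eventually_lt_nhds hr1] with y hy h1 h2
    obtain ⟨ap', hIp', -, -⟩ := hgp y h1 h2.le (z0 y h1).le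
    have ha := ap'.isArc_outerArc hIp'
    exact ⟨ha.pos, ha.outer_trajectory ap'.radial_pos hy.radial_pos ap'.radial_neg hy.radial_neg,
      ha.start, ha.finish⟩
  · filter_upwards [adps, eventually_gt_nhds hs, eventually_lt_nhds hs1, hδs'] with y hy h1 h2 h3
    obtain ⟨am', hIm', -, -⟩ := hgm y h1 h2.le (by rw [abs_neg]; exact h3.le)
    have ha := hy.2.isArc_innerArc (by
      rw [firstIntegral_neg, firstIntegral_neg, neg_neg] at hIm'
      exact hIm')
    exact ⟨ha.pos, ha.inner_trajectory hy.1.radial_neg hy.2.radial_neg hy.1.radial_pos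
      hy.2.radial_pos, ha.start, ha.finish⟩

end CircleHolo

end

/-! ### Expansion of the displacement function -/

noncomputable section

namespace CircleHolo

/-- Up to a constant factor, the coefficient of `x ^ j` of the difference of the regular parts of
two first integrals. -/
def diffCoeff (α β : ℝ) (c d : ℂ) (j : ℕ) : ℝ :=
  ((1 + α * Complex.I) * c ^ j - (1 + β * Complex.I) * d ^ j).re

/-- The difference of the regular parts of two first integrals. -/
def diffRegular (α β : ℝ) (c d : ℂ) (x : ℝ) : ℝ :=
  ((1 + α * Complex.I) * Complex.log (1 + c * x)).re -
    ((1 + β * Complex.I) * Complex.log (1 + d * x)).re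

theorem firstIntegral_sub_firstIntegral (α β δ : ℝ) (c d : ℂ) (x : ℝ) :
    firstIntegral β δ d x - firstIntegral α 0 c x =
      Real.log (x - δ) - Real.log x + diffRegular α β c d x := by
  rw [firstIntegral, firstIntegral, diffRegular, sub_zero]
  ring

/-- The index `0` is harmless here and in all later sums: its coefficient is divided by `0`, hence
vanishes. -/
theorem re_mul_logTaylor (u c : ℂ) (x : ℝ) (n : ℕ) :
    (u * Complex.logTaylor (n + 1) (c * x)).re =
      ∑ j ∈ Finset.range (n + 1), (-1) ^ (j + 1) / (j : ℝ) * (u * c ^ j).re * x ^ j := by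
  rw [Complex.logTaylor, Finset.mul_sum, Complex.re_sum]
  refine Finset.sum_congr rfl fun j _ => ?_
  have : u * ((-1) ^ (j + 1) * (c * x) ^ j / j) =
      (((-1) ^ (j + 1) / (j : ℝ) * x ^ j : ℝ) : ℂ) * (u * c ^ j) := by
    push_cast
    ring
  rw [this, Complex.re_ofReal_mul]
  ring

theorem abs_re_mul_log_sub_le {α x : ℝ} {d : ℂ} (hα : |α| ≤ 2) (hd : ‖d‖ ≤ 2)
    (hx : |x| ≤ 1 / 1000000) (n : ℕ) :
    |((1 + α * Complex.I) * Complex.log (1 + d * x)).re -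
      ∑ j ∈ Finset.range (n + 1), (-1) ^ (j + 1) / (j : ℝ) *
        ((1 + α * Complex.I) * d ^ j).re * x ^ j| ≤ 6 * (2 * |x|) ^ (n + 1) := by
  have h1 := norm_mul_ofReal_le hd hx
  have h2 := Complex.norm_log_sub_logTaylor_le n (z := d * x) (by linarith)
  have h3 : ‖d * x‖ ≤ 2 * |x| := by
    rw [norm_mul, Complex.norm_real, Real.norm_eq_abs]
    exact mul_le_mul_of_nonneg_right hd (abs_nonneg x)
  rw [← re_mul_logTaylor, ← Complex.sub_re, ← mul_sub]
  refine (Complex.abs_re_le_norm _).trans ?_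
  rw [norm_mul]
  have h4 : (1 - ‖d * x‖)⁻¹ ≤ 2 := inv_le_of_inv_le₀ (by norm_num) (by linarith)
  have h5 : ‖d * x‖ ^ (n + 1) * (1 - ‖d * x‖)⁻¹ / (n + 1) ≤ (2 * |x|) ^ (n + 1) * 2 := by
    refine (div_le_self (mul_nonneg (by positivity) (inv_nonneg.2 (by linarith))) ?_).trans ?_
    · linarith [Nat.cast_nonneg (α := ℝ) n]
    · exact mul_le_mul (pow_le_pow_left₀ (norm_nonneg _) h3 _) h4
        (inv_nonneg.2 (by linarith)) (by positivity)
  calc _ ≤ 3 * ((2 * |x|) ^ (n + 1) * 2) :=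
        mul_le_mul (norm_one_add_mul_I_le hα) (h2.trans h5) (norm_nonneg _) (by norm_num)
    _ = _ := by ring

theorem abs_diffRegular_sub_le {α β x : ℝ} {c d : ℂ} (hα : |α| ≤ 2) (hβ : |β| ≤ 2) (hc : ‖c‖ ≤ 2)
    (hd : ‖d‖ ≤ 2) (hx : |x| ≤ 1 / 1000000) (n : ℕ) :
    |diffRegular α β c d x - ∑ j ∈ Finset.range (n + 1), (-1) ^ (j + 1) / (j : ℝ) *
        diffCoeff α β c d j * x ^ j| ≤ 12 * (2 * |x|) ^ (n + 1) := by
  have h1 := abs_re_mul_log_sub_le hα hc hx n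
  have h2 := abs_re_mul_log_sub_le hβ hd hx n
  have e : ∑ j ∈ Finset.range (n + 1), (-1) ^ (j + 1) / (j : ℝ) * diffCoeff α β c d j * x ^ j =
      ∑ j ∈ Finset.range (n + 1), (-1) ^ (j + 1) / (j : ℝ) *
        ((1 + α * Complex.I) * c ^ j).re * x ^ j -
      ∑ j ∈ Finset.range (n + 1), (-1) ^ (j + 1) / (j : ℝ) *
        ((1 + β * Complex.I) * d ^ j).re * x ^ j := by
    rw [← Finset.sum_sub_distrib]
    refine Finset.sum_congr rfl fun j _ => ?_
    rw [diffCoeff, Complex.sub_re]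
    ring
  rw [e, diffRegular, sub_sub_sub_comm]
  refine (abs_sub _ _).trans ?_
  linarith

theorem diffRegular_eq_of_vanish {α β x : ℝ} {c d : ℂ} {n : ℕ} (hα : |α| ≤ 2) (hβ : |β| ≤ 2)
    (hc : ‖c‖ ≤ 2) (hd : ‖d‖ ≤ 2) (hx : |x| ≤ 1 / 1000000)
    (hvan : ∀ j, 0 < j → j < n → diffCoeff α β c d j = 0) :
    |diffRegular α β c d x - (-1) ^ (n + 1) / (n : ℝ) * diffCoeff α β c d n * x ^ n| ≤
      12 * (2 * |x|) ^ (n + 1) := by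
  have h := abs_diffRegular_sub_le hα hβ hc hd hx n
  rw [Finset.sum_range_succ, Finset.sum_eq_zero, zero_add] at h
  · exact h
  · intro j hj
    rcases Nat.eq_zero_or_pos j with rfl | hj0
    · simp
    · rw [hvan j hj0 (Finset.mem_range.1 hj)]
      ring

/-- This Lipschitz bound allows the regular part at the return point to be replaced by its value at
the starting point. -/
theorem abs_re_mul_log_sub_log_le {α x y : ℝ} {d : ℂ} (hα : |α| ≤ 2) (hd : ‖d‖ ≤ 2)
    (hx : |x| ≤ 1 / 1000000) (hy : |y| ≤ 1 / 1000000) :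
    |((1 + α * Complex.I) * Complex.log (1 + d * y)).re -
      ((1 + α * Complex.I) * Complex.log (1 + d * x)).re| ≤ 12 * |y - x| := by
  have hder : ∀ t ∈ Icc (-(1 / 1000000 : ℝ)) (1 / 1000000),
      HasDerivWithinAt (fun x : ℝ => ((1 + α * Complex.I) * Complex.log (1 + d * x)).re)
        ((1 + α * Complex.I) * (d / (1 + d * t))).re (Icc (-(1 / 1000000 : ℝ)) (1 / 1000000)) t := by
    intro t ht
    have h2 : HasDerivAt (fun x : ℝ => 1 + d * (x : ℂ)) (d * 1) t :=
      ((Complex.ofRealCLM.hasDerivAt (x := t)).const_mul d).const_add 1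
    rw [mul_one] at h2
    have h3 := (h2.clog_real (one_add_mem_slitPlane hd (abs_le.2 ht))).const_mul (1 + α * Complex.I)
    exact (Complex.reCLM.hasFDerivAt.comp_hasDerivAt t h3).hasDerivWithinAt
  exact (convex_Icc (-(1 / 1000000 : ℝ)) (1 / 1000000)).norm_image_sub_le_of_norm_hasDerivWithin_le
    hder (fun t ht => abs_re_mul_div_le hα hd (abs_le.2 ht)) (abs_le.1 hx) (abs_le.1 hy)

theorem exp_sub_one_isBigO {ι : Type*} {l : Filter ι} {w : ι → ℝ} (hw : Tendsto w l (𝓝 0)) :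
    (fun i => Real.exp (w i) - 1) =O[l] w := by
  have := (Real.hasDerivAt_exp 0).isBigO_sub.comp_tendsto hw
  simpa [Function.comp_def] using this

theorem exp_sub_one_sub_isBigO {ι : Type*} {l : Filter ι} {w : ι → ℝ} (hw : Tendsto w l (𝓝 0)) :
    (fun i => Real.exp (w i) - 1 - w i) =O[l] fun i => w i ^ 2 := by
  refine IsBigO.of_bound 1 ?_
  have : ∀ᶠ i in l, |w i| < 1 := by
    have := hw.abs
    rw [abs_zero] at this
    exact this.eventually (gt_mem_nhds one_pos)
  filter_upwards [this] with i hi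
  rw [one_mul, Real.norm_eq_abs, Real.norm_eq_abs, abs_of_nonneg (sq_nonneg (w i))]
  exact Real.abs_exp_sub_one_sub_id_le hi.le

theorem tendsto_nhdsGT_of_le {g : ℝ → ℝ} {K : ℝ} (h : ∀ᶠ r in 𝓝[>] (0 : ℝ), 0 < g r ∧ g r ≤ K * r) :
    Tendsto g (𝓝[>] 0) (𝓝[>] 0) := by
  refine tendsto_nhdsWithin_iff.2 ⟨?_, h.mono fun r hr => hr.1⟩
  have h1 : Tendsto (fun r : ℝ => K * r) (𝓝[>] 0) (𝓝 0) := by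
    have : Tendsto (fun r : ℝ => K * r) (𝓝 0) (𝓝 (K * 0)) := (continuous_const_mul K).tendsto 0
    rw [mul_zero] at this
    exact this.mono_left nhdsWithin_le_nhds
  exact tendsto_of_tendsto_of_tendsto_of_le_of_le' tendsto_const_nhds h1
    (h.mono fun r hr => hr.1.le) (h.mono fun r hr => hr.2)

/-- The displacement function of the two half-return maps at a common zero. -/
theorem displacement_isBigO {α : ℝ} {c d : ℂ} {n : ℕ} (hn : 0 < n) (hα : |α| ≤ 2) (hc : ‖c‖ ≤ 2)
    (hd : ‖d‖ ≤ 2) (hvan : ∀ j, 0 < j → j < n → diffCoeff α (-α) c d j = 0) {gp gm : ℝ → ℝ}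
    (hgp : ∀ᶠ r in 𝓝[>] (0 : ℝ), Admissible α 0 c r (gp r) ∧
      firstIntegral α 0 c (-gp r) = firstIntegral α 0 c r + α * Real.pi ∧ gp r ≤ 100000 * r)
    (hgm : ∀ᶠ s in 𝓝[>] (0 : ℝ), Admissible (-α) 0 d (gm s) s ∧
      firstIntegral (-α) 0 d (gm s) = firstIntegral (-α) 0 d (-s) + (-α) * Real.pi ∧
      gm s ≤ 100000 * s) :
    (fun r : ℝ => (gm (gp r) - r) - (-1) ^ (n + 1) / (n : ℝ) * diffCoeff α (-α) c d n *
      ((-Real.exp (α * Real.pi)) ^ n - 1) * r ^ (n + 1)) =O[𝓝[>] 0]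
        (fun r : ℝ => r ^ (n + 1 + 1)) := by
  set l := 𝓝[>] (0 : ℝ) with hl
  set q := Real.exp (α * Real.pi) with hq
  set A := (-1) ^ (n + 1) / (n : ℝ) * diffCoeff α (-α) c d n with hA
  have hα' : |-α| ≤ 2 := by rwa [abs_neg]
  have hpos : ∀ᶠ r in l, (0 : ℝ) < r := self_mem_nhdsWithin
  have hidt : Tendsto (fun r : ℝ => r) l (𝓝 0) := nhdsWithin_le_nhds
  have hgpt : Tendsto gp l l := tendsto_nhdsGT_of_le (hgp.mono fun r hr => ⟨hr.1.hs, hr.2.2⟩)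
  have hgm' := hgpt.eventually hgm
  have hsO : gp =O[l] fun r => r := by
    refine IsBigO.of_bound 100000 ?_
    filter_upwards [hgp, hpos] with r hr h0
    rw [Real.norm_eq_abs, Real.norm_eq_abs, abs_of_pos hr.1.hs, abs_of_pos h0]
    exact hr.2.2
  -- The outer map is `gp r = q r e^w` with `w = O(r)`, so powers of `gp r` equal those of `q r` up
  -- to one order more.
  set w : ℝ → ℝ := fun r => Real.log (gp r) - Real.log r - α * Real.pi with hw
  have hwO : w =O[l] fun r => r := by
    have h1 : (fun r => 9 * (gp r) + 9 * r) =O[l] fun r : ℝ => r :=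
      (hsO.const_mul_left 9).add ((isBigO_refl _ l).const_mul_left 9)
    refine IsBigO.trans (IsBigO.of_bound 1 ?_) h1
    filter_upwards [hgp, hpos] with r hr h0
    obtain ⟨ha, hI, -⟩ := hr
    have b1 := abs_re_mul_log_le (x := r) hα hc (by rw [abs_of_pos h0]; exact ha.hr1)
    have b2 := abs_re_mul_log_le (x := -gp r) hα hc
      (by rw [abs_neg, abs_of_pos ha.hs]; exact ha.hs1)
    rw [abs_of_pos h0] at b1
    rw [abs_neg, abs_of_pos ha.hs] at b2
    rw [firstIntegral, firstIntegral, sub_zero, sub_zero, Real.log_neg_eq_log] at hI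
    have hs := ha.hs
    rw [one_mul, Real.norm_eq_abs, Real.norm_eq_abs,
      abs_of_pos (show 0 < 9 * gp r + 9 * r by positivity), abs_le]
    have b1' := abs_le.1 b1
    have b2' := abs_le.1 b2
    simp only [hw]
    constructor <;> linarith [b1'.1, b1'.2, b2'.1, b2'.2]
  have hwt : Tendsto w l (𝓝 0) := hwO.trans_tendsto hidt
  have hseq : ∀ᶠ r in l, gp r = q * r * Real.exp (w r) := by
    filter_upwards [hgp, hpos] with r hr h0
    simp only [hw]
    rw [Real.exp_sub, Real.exp_sub, Real.exp_log hr.1.hs, Real.exp_log h0, ← hq]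
    have : q ≠ 0 := (Real.exp_pos _).ne'
    field_simp
  have hsn : (fun r => (-gp r) ^ n - (-q) ^ n * r ^ n) =O[l] fun r => r ^ (n + 1) := by
    have h1 : Tendsto (fun r => n * w r) l (𝓝 0) := by simpa using hwt.const_mul (n : ℝ)
    have h2 : (fun r => (-q) ^ n * r ^ n * (Real.exp (n * w r) - 1)) =O[l]
        fun r => r ^ n * r :=
      ((isBigO_refl _ l).const_mul_left _).mul
        ((exp_sub_one_isBigO h1).trans (hwO.const_mul_left _))
    refine h2.congr' ?_ (Eventually.of_forall fun r => (pow_succ r n).symm)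
    filter_upwards [hseq] with r hr
    rw [hr, Real.exp_nat_mul, neg_eq_neg_one_mul (q * r * _), neg_eq_neg_one_mul q]
    simp only [mul_pow]
    ring
  -- Without a shift of the zero and with opposite rates, the logarithms and the terms in `π`
  -- cancel; `D` is what remains of the closing equation, and its leading term has order `n`.
  set D : ℝ → ℝ := fun r => diffRegular α (-α) c d (-gp r) - diffRegular α (-α) c d r with hD
  have hDO : (fun r => D r - A * ((-q) ^ n - 1) * r ^ n) =O[l] fun r => r ^ (n + 1) := by
    have h1 : (fun r => diffRegular α (-α) c d (-gp r) - A * (-gp r) ^ n) =O[l]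
        fun r => r ^ (n + 1) := by
      refine IsBigO.trans (IsBigO.of_bound (12 * 2 ^ (n + 1)) ?_) (hsO.pow (n + 1))
      filter_upwards [hgp] with r hr
      have hs := hr.1.hs
      have := diffRegular_eq_of_vanish (x := -gp r) hα hα' hc hd
        (by rw [abs_neg, abs_of_pos hs]; exact hr.1.hs1) hvan
      rw [abs_neg, abs_of_pos hs, mul_pow, ← mul_assoc] at this
      rw [Real.norm_eq_abs, Real.norm_eq_abs, abs_of_pos (pow_pos hs _)]
      exact this
    have h2 : (fun r => diffRegular α (-α) c d r - A * r ^ n) =O[l] fun r => r ^ (n + 1) := by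
      refine IsBigO.of_bound (12 * 2 ^ (n + 1)) ?_
      filter_upwards [hgp] with r hr
      have h0 := hr.1.hr
      have := diffRegular_eq_of_vanish (x := r) hα hα' hc hd
        (by rw [abs_of_pos h0]; exact hr.1.hr1) hvan
      rw [abs_of_pos h0, mul_pow, ← mul_assoc] at this
      rw [Real.norm_eq_abs, Real.norm_eq_abs, abs_of_pos (pow_pos h0 _)]
      exact this
    refine ((h1.add (hsn.const_mul_left A)).sub h2).congr_left fun r => ?_
    simp only [hD]
    ring
  have hDn : D =O[l] fun r => r ^ n := by
    have h1 : (fun r : ℝ => r ^ (n + 1)) =O[l] fun r => r ^ n := by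
      have : (fun r : ℝ => r ^ n * r) =O[l] fun r => r ^ n * 1 :=
        (isBigO_refl _ l).mul (hidt.isBigO_one ℝ)
      simpa [pow_succ] using this
    refine ((hDO.trans h1).add ((isBigO_refl (fun r : ℝ => r ^ n) l).const_mul_left
      (A * ((-q) ^ n - 1)))).congr_left fun r => ?_
    ring
  set P : ℝ → ℝ := fun r => gm (gp r) with hP
  set y : ℝ → ℝ := fun r => Real.log (P r) - Real.log r with hy
  -- The logarithmic displacement `y` differs from `D` only because the inner regular part is
  -- evaluated at `P r` instead of `r`.
  have hyD : ∀ᶠ r in l, |y r - D r| ≤ 12 * |P r - r| := by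
    filter_upwards [hgp, hgm'] with r hr hr'
    obtain ⟨ha, hI, -⟩ := hr
    obtain ⟨ha', hI', -⟩ := hr'
    have b := abs_re_mul_log_sub_log_le (x := r) (y := P r) hα' hd
      (by rw [abs_of_pos ha.hr]; exact ha.hr1) (by rw [abs_of_pos ha'.hr]; exact ha'.hr1)
    have e1 := firstIntegral_sub_firstIntegral α (-α) 0 c d (-gp r)
    have e2 := firstIntegral_sub_firstIntegral α (-α) 0 c d r
    rw [sub_zero, sub_self, zero_add] at e1 e2
    have e3 : y r - D r = ((1 + ((-α : ℝ) : ℂ) * Complex.I) * Complex.log (1 + d * P r)).re -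
        ((1 + ((-α : ℝ) : ℂ) * Complex.I) * Complex.log (1 + d * r)).re := by
      have e4 : firstIntegral (-α) 0 d (P r) - firstIntegral (-α) 0 d r = D r := by
        simp only [hD, hP]
        linarith
      rw [← e4, firstIntegral, firstIntegral, sub_zero, sub_zero]
      simp only [hy]
      ring
    rw [e3]
    exact b
  have hPt : Tendsto P l l := by
    refine Tendsto.comp ?_ hgpt
    exact tendsto_nhdsGT_of_le (hgm.mono fun r hr => ⟨hr.1.hr, hr.2.2⟩)
  have hPpos : ∀ᶠ r in l, 0 < P r := hPt.eventually self_mem_nhdsWithin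
  have hPr0 : Tendsto (fun r => P r - r) l (𝓝 0) := by
    simpa using (hPt.mono_right nhdsWithin_le_nhds).sub hidt
  have hD0 : Tendsto D l (𝓝 0) := by
    refine hDn.trans_tendsto ?_
    have : Tendsto (fun r : ℝ => r ^ n) (𝓝 0) (𝓝 (0 ^ n)) := (continuous_pow n).tendsto 0
    rw [zero_pow hn.ne'] at this
    exact this.mono_left nhdsWithin_le_nhds
  have hyDO : (fun r => y r - D r) =O[l] fun r => P r - r :=
    IsBigO.of_bound 12 (hyD.mono fun r hr => by rwa [Real.norm_eq_abs, Real.norm_eq_abs])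
  have hy0 : Tendsto y l (𝓝 0) := by
    have := (hyDO.trans_tendsto hPr0).add hD0
    simpa using this
  have hPeq : ∀ᶠ r in l, P r = r * Real.exp (y r) := by
    filter_upwards [hPpos, hpos] with r h1 h0
    simp only [hy]
    rw [Real.exp_sub, Real.exp_log h1, Real.exp_log h0]
    field_simp
  have hPO : (fun r => P r - r) =O[l] fun r => r * y r := by
    refine ((isBigO_refl (fun r : ℝ => r) l).mul (exp_sub_one_isBigO hy0)).congr' ?_
      EventuallyEq.rfl
    filter_upwards [hPeq] with r hr
    rw [hr]
    ring
  -- Bootstrap: `P r - r = O(r y)` is negligible against `y`, so `y - D = o(y)` and `y` inherits the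
  -- order of `D`. This improves `P r - r` to `O(r^(n+1))`.
  have hPlo : (fun r => P r - r) =o[l] y := by
    refine hPO.trans_isLittleO ?_
    have : (fun r : ℝ => r) =o[l] fun _ => (1 : ℝ) := (isLittleO_one_iff ℝ).2 hidt
    simpa using this.mul_isBigO (isBigO_refl y l)
  have hyO : y =O[l] fun r => r ^ n := by
    have h1 : (fun r => y r - D r) =o[l] y := hyDO.trans_isLittleO hPlo
    have h2 : y =O[l] D := by
      have := (h1.neg_left).right_isBigO_add
      refine this.congr_right fun r => ?_
      ring
    exact h2.trans hDn
  have hPn : (fun r => P r - r) =O[l] fun r => r ^ (n + 1) := by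
    refine hPO.trans (((isBigO_refl (fun r : ℝ => r) l).mul hyO).congr_right fun r => ?_)
    ring
  -- The quadratic error is `O(r^(2n))`, and `2n ≥ n + 1` because `n` is positive.
  have hy2 : (fun r => Real.exp (y r) - 1 - y r) =O[l] fun r => r ^ (n + 1) := by
    refine (exp_sub_one_sub_isBigO hy0).trans ((hyO.pow 2).trans ?_)
    have h1 : (fun r : ℝ => r ^ (n + 1) * r ^ (n - 1)) =O[l] fun r => r ^ (n + 1) * 1 := by
      refine (isBigO_refl _ l).mul ?_
      have : Tendsto (fun r : ℝ => r ^ (n - 1)) l (𝓝 (0 ^ (n - 1))) :=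
        ((continuous_pow (n - 1)).tendsto 0).mono_left nhdsWithin_le_nhds
      exact this.isBigO_one ℝ
    refine h1.congr (fun r => ?_) fun r => by rw [mul_one]
    rw [← pow_add, ← pow_mul]
    congr 1
    omega
  have hfin := (isBigO_refl (fun r : ℝ => r) l).mul ((hy2.add (hyDO.trans hPn)).add hDO)
  refine hfin.congr' ?_ (Eventually.of_forall fun r => by ring)
  filter_upwards [hPeq] with r hr
  rw [show gm (gp r) = r * Real.exp (y r) from hr]
  ring

end CircleHolo

end

/-! ### Weak foci, degrees and coefficients -/

noncomputable section

namespace CircleHolo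

theorem eval_one_polyField (α : ℝ) (d : ℂ) : (polyField α 0 d).eval 1 = 0 := by
  simp [polyField]
  ring

theorem eval_one_derivative_polyField (α : ℝ) (d : ℂ) :
    (polyField α 0 d).derivative.eval 1 = α + Complex.I := by
  simp [polyField, fieldFactor]
  linear_combination (-(α : ℂ) - Complex.I) * Complex.I_sq

/-- Two fields with a common zero at `1` and opposite expansion rates form a weak focus, whose order
is that of the first nonzero coefficient of the difference of the first integrals. -/
theorem isWeakFocus_polyField {α : ℝ} {c d : ℂ} {n : ℕ} (hn : 0 < n) (hα : |α| ≤ 2) (hα0 : α ≠ 0)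
    (hc : ‖c‖ ≤ 2) (hd : ‖d‖ ≤ 2) (hvan : ∀ j, 0 < j → j < n → diffCoeff α (-α) c d j = 0)
    (hX : diffCoeff α (-α) c d n ≠ 0) :
    IsWeakFocus (polyField α 0 c) (polyField (-α) 0 d) 1 (n + 1) := by
  obtain ⟨gp, hgp⟩ := exists_halfReturn α 0 c hα hc
  obtain ⟨gm, hgm⟩ := exists_halfReturn (-α) 0 (-d) (by rwa [abs_neg]) (by rwa [norm_neg])
  have hsmall : ∀ᶠ r in 𝓝[>] (0 : ℝ), 0 < r ∧ r ≤ 1 / 100000000000 ∧ |(0 : ℝ)| ≤ r / 1000000 := by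
    filter_upwards [Ioc_mem_nhdsGT (show (0 : ℝ) < 1 / 100000000000 by norm_num)] with r hr
    refine ⟨hr.1, hr.2, ?_⟩
    rw [abs_zero]
    exact div_nonneg hr.1.le (by norm_num)
  have hp : ∀ᶠ r in 𝓝[>] (0 : ℝ), Admissible α 0 c r (gp r) ∧
      firstIntegral α 0 c (-gp r) = firstIntegral α 0 c r + α * Real.pi ∧ gp r ≤ 100000 * r := by
    filter_upwards [hsmall] with r hr
    obtain ⟨h1, h2, h3, -⟩ := hgp r hr.1 hr.2.1 hr.2.2
    exact ⟨h1, h2, h3⟩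
  have hm : ∀ᶠ s in 𝓝[>] (0 : ℝ), Admissible (-α) 0 d (gm s) s ∧
      firstIntegral (-α) 0 d (gm s) = firstIntegral (-α) 0 d (-s) + (-α) * Real.pi ∧
      gm s ≤ 100000 * s := by
    filter_upwards [hsmall] with r hr
    obtain ⟨h1, h2, h3, -⟩ := hgm r hr.1 hr.2.1 hr.2.2
    have h1' := h1.symm
    have e1 := firstIntegral_neg (-α) 0 d (-gm r)
    have e2 := firstIntegral_neg (-α) 0 d r
    rw [neg_zero] at e1 e2 h1'
    rw [neg_neg] at h1' e1
    refine ⟨h1', ?_, h3⟩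
    rw [← e1, h2, e2]
  have hdisp := displacement_isBigO hn hα hc hd hvan hp hm
  refine ⟨norm_one, eval_one_polyField α c, eval_one_polyField (-α) d, ?_, ?_, by omega, gp, gm, _,
    ⟨tendsto_nhdsGT_of_le (hp.mono fun r hr => ⟨hr.1.hs, hr.2.2⟩), ?_⟩,
    ⟨tendsto_nhdsGT_of_le (hm.mono fun r hr => ⟨hr.1.hr, hr.2.2⟩), ?_⟩, ?_, hdisp⟩
  · rw [eval_one_derivative_polyField]; simp
  · rw [eval_one_derivative_polyField]; simp
  · filter_upwards [hp] with r hr using (hr.1.isArc_outerArc hr.2.1).connects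
  · filter_upwards [hm] with r hr using (hr.1.isArc_innerArc hr.2.1).connects
  -- If `(-q)^n = 1`, then `q^n = 1` and so `n α π = 0`. The condition `α ≠ 0` is needed for even
  -- `n`.
  · refine mul_ne_zero (mul_ne_zero (div_ne_zero (pow_ne_zero _ (by norm_num))
      (Nat.cast_ne_zero.2 hn.ne')) hX) (sub_ne_zero.2 fun h => ?_)
    have h1 := congrArg abs h
    rw [abs_pow, abs_neg, abs_one, abs_of_pos (Real.exp_pos _), ← Real.exp_nat_mul,
      Real.exp_eq_one_iff] at h1
    rcases mul_eq_zero.1 h1 with h2 | h2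
    · exact hn.ne' (Nat.cast_eq_zero.1 h2)
    · rcases mul_eq_zero.1 h2 with h3 | h3
      · exact hα0 h3
      · exact Real.pi_ne_zero h3

theorem fieldFactor_ne_zero (α : ℝ) {δ : ℝ} {d : ℂ} (h : 1 + d * δ ≠ 0) :
    fieldFactor α δ d ≠ 0 := by
  refine div_ne_zero (mul_ne_zero (neg_ne_zero.2 Complex.I_ne_zero) fun h1 => ?_)
    (mul_ne_zero two_ne_zero h)
  have := congrArg Complex.im h1
  simp at this

theorem I_sub_ofReal_ne_zero (δ : ℝ) : Complex.I - δ ≠ 0 := fun h => by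
  have := congrArg Complex.im h
  simp at this

theorem natDegree_polyField_of_ne (α : ℝ) {δ : ℝ} {d : ℂ} (h : 1 + d * δ ≠ 0)
    (hd : d ≠ Complex.I) : (polyField α δ d).natDegree = 2 := by
  refine natDegree_quadratic (mul_ne_zero (fieldFactor_ne_zero α h)
    (mul_ne_zero (I_sub_ofReal_ne_zero δ) fun h1 => hd ?_))
  linear_combination (-Complex.I) * h1 + d * Complex.I_sq

/-- For `d = i` the second zero `-1/d = i` of the chart field is the point that `cayley` sends to
infinity: the leading coefficient contains `1 + i d = 0`. Linear systems enter the same family this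
way. -/
theorem natDegree_polyField_I (α : ℝ) {δ : ℝ} (h : 1 + Complex.I * δ ≠ 0) :
    (polyField α δ Complex.I).natDegree = 1 := by
  have e : polyField α δ Complex.I =
      C (fieldFactor α δ Complex.I * ((Complex.I - δ) * 2)) * X +
        C (fieldFactor α δ Complex.I * (-(Complex.I + δ) * 2)) := by
    have h1 : (1 : ℂ) + Complex.I * Complex.I = 0 := by rw [Complex.I_mul_I]; ring
    have h2 : (1 : ℂ) - Complex.I * Complex.I = 2 := by rw [Complex.I_mul_I]; ring
    rw [polyField, h1, h2]
    simp
  rw [e]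
  exact natDegree_linear (mul_ne_zero (fieldFactor_ne_zero α h)
    (mul_ne_zero (I_sub_ofReal_ne_zero δ) two_ne_zero))

theorem coeff_quadratic (a b c : ℂ) : (C a * X ^ 2 + C b * X + C c).coeff 0 = c ∧
    (C a * X ^ 2 + C b * X + C c).coeff 1 = b ∧ (C a * X ^ 2 + C b * X + C c).coeff 2 = a ∧
    ∀ j, (C a * X ^ 2 + C b * X + C c).coeff (j + 3) = 0 := by
  refine ⟨?_, ?_, ?_, fun j => ?_⟩ <;>
  simp [coeff_X, coeff_C, coeff_X_pow]

theorem eventually_norm_coeff_polyField_sub_lt {ι : Type*} {l : Filter ι} {α δ : ι → ℝ} {d : ι → ℂ}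
    {α₀ : ℝ} {d₀ : ℂ} (hα : Tendsto α l (𝓝 α₀)) (hδ : Tendsto δ l (𝓝 0)) (hd : Tendsto d l (𝓝 d₀))
    {ε : ℝ} (hε : 0 < ε) : ∀ᶠ i in l, ∀ j,
      ‖(polyField (α i) (δ i) (d i)).coeff j - (polyField α₀ 0 d₀).coeff j‖ < ε := by
  have hαc : Tendsto (fun i => (α i : ℂ)) l (𝓝 (α₀ : ℂ)) :=
    (Complex.continuous_ofReal.tendsto α₀).comp hα
  have hδc : Tendsto (fun i => (δ i : ℂ)) l (𝓝 ((0 : ℝ) : ℂ)) :=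
    (Complex.continuous_ofReal.tendsto 0).comp hδ
  have hI : Tendsto (fun _ : ι => Complex.I) l (𝓝 Complex.I) := tendsto_const_nhds
  have h1 : Tendsto (fun _ : ι => (1 : ℂ)) l (𝓝 1) := tendsto_const_nhds
  have hf : Tendsto (fun i => fieldFactor (α i) (δ i) (d i)) l (𝓝 (fieldFactor α₀ 0 d₀)) :=
    (hI.neg.mul (hαc.add hI)).div ((h1.add (hd.mul hδc)).const_mul 2) (by simp)
  have h2 := hf.mul ((hI.sub hδc).mul (h1.add (hI.mul hd)))
  have h3 := hf.mul (((hI.sub hδc).mul (h1.sub (hI.mul hd))).sub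
    ((hI.add hδc).mul (h1.add (hI.mul hd))))
  have h4 := hf.mul ((hI.add hδc).neg.mul (h1.sub (hI.mul hd)))
  have hnear : ∀ {f : ι → ℂ} {a : ℂ}, Tendsto f l (𝓝 a) → ∀ᶠ i in l, ‖f i - a‖ < ε :=
    fun hf => by
      have := (Metric.tendsto_nhds.1 hf) ε hε
      simpa only [dist_eq_norm] using this
  filter_upwards [hnear h2, hnear h3, hnear h4] with i i2 i3 i4 j
  rw [polyField, polyField]
  rcases j with _ | _ | _ | j
  · rw [(coeff_quadratic _ _ _).1, (coeff_quadratic _ _ _).1]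
    exact i4
  · rw [(coeff_quadratic _ _ _).2.1, (coeff_quadratic _ _ _).2.1]
    exact i3
  · rw [(coeff_quadratic _ _ _).2.2.1, (coeff_quadratic _ _ _).2.2.1]
    exact i2
  · rw [(coeff_quadratic _ _ _).2.2.2, (coeff_quadratic _ _ _).2.2.2, sub_zero, norm_zero]
    exact hε

end CircleHolo

end

/-! ### Unfoldings and their rescaled limits -/

noncomputable section

namespace CircleHolo

/-- On a fixed interval about `ρ` the derivatives eventually exceed `m/2`, while the value at `ρ`
tends to zero; the mean value inequality forces a sign change. Continuity of the derivatives is not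
needed. -/
theorem exists_root_of_tendsto_deriv_pos {f f' : ℝ → ℝ → ℝ} {ρ m : ℝ}
    (hder : ∀ᶠ p : ℝ × ℝ in 𝓝[>] 0 ×ˢ 𝓝 ρ, HasDerivAt (f p.1) (f' p.1 p.2) p.2)
    (hf' : Tendsto (fun p : ℝ × ℝ => f' p.1 p.2) (𝓝[>] 0 ×ˢ 𝓝 ρ) (𝓝 m)) (hm : 0 < m)
    (hf : Tendsto (fun e => f e ρ) (𝓝[>] 0) (𝓝 0)) {η : ℝ} (hη : 0 < η) :
    ∀ᶠ e in 𝓝[>] (0 : ℝ), ∃ x, |x - ρ| < η ∧ f e x = 0 ∧ f' e x ≠ 0 := by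
  obtain ⟨pa, hpa, pb, hpb, hab⟩ := eventually_prod_iff.1
    (hder.and (hf'.eventually (lt_mem_nhds (show m / 2 < m by linarith))))
  obtain ⟨η₁, hη₁, hpb⟩ := Metric.eventually_nhds_iff.1 hpb
  set h := min η η₁ / 2 with hh
  have h0 : 0 < h := by positivity
  have hhη : h < η := by linarith [min_le_left η η₁]
  have hhη₁ : h < η₁ := by linarith [min_le_right η η₁]
  have hsmall : ∀ᶠ e in 𝓝[>] (0 : ℝ), |f e ρ| < m / 2 * h := by
    have := hf.abs
    rw [abs_zero] at this
    exact this.eventually (gt_mem_nhds (by positivity))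
  filter_upwards [hpa, hsmall] with e he hs
  have hs' := abs_lt.1 hs
  have hD : ∀ x ∈ Icc (ρ - h) (ρ + h), HasDerivAt (f e) (f' e x) x ∧ m / 2 < f' e x := by
    intro x hx
    refine hab he (hpb ?_)
    rw [Real.dist_eq, abs_lt]
    constructor <;> linarith [hx.1, hx.2]
  have hcont : ContinuousOn (f e) (Icc (ρ - h) (ρ + h)) := fun x hx =>
    (hD x hx).1.continuousAt.continuousWithinAt
  have hmvt := (convex_Icc (ρ - h) (ρ + h)).mul_sub_le_image_sub_of_le_deriv (C := m / 2) hcont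
    (fun x hx => (hD x (interior_subset hx)).1.differentiableAt.differentiableWithinAt)
    (fun x hx => by
      rw [(hD x (interior_subset hx)).1.deriv]
      exact (hD x (interior_subset hx)).2.le)
  have hρ : ρ ∈ Icc (ρ - h) (ρ + h) := ⟨by linarith, by linarith⟩
  have h1 := hmvt (ρ - h) ⟨le_rfl, by linarith⟩ ρ hρ (by linarith)
  have h2 := hmvt ρ hρ (ρ + h) ⟨by linarith, le_rfl⟩ (by linarith)
  rw [sub_sub_cancel] at h1
  rw [add_sub_cancel_left] at h2
  obtain ⟨x, hx, hx0⟩ := intermediate_value_Icc (show ρ - h ≤ ρ + h by linarith) hcont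
    (show (0 : ℝ) ∈ Icc _ _ from ⟨by linarith, by linarith⟩)
  refine ⟨x, abs_lt.2 ⟨by linarith [hx.1], by linarith [hx.2]⟩, hx0, ?_⟩
  linarith [(hD x hx).2]

/-- A simple zero of the limit of a family of functions continues to a simple zero. -/
theorem exists_root_of_tendsto_deriv {f f' : ℝ → ℝ → ℝ} {ρ m : ℝ}
    (hder : ∀ᶠ p : ℝ × ℝ in 𝓝[>] 0 ×ˢ 𝓝 ρ, HasDerivAt (f p.1) (f' p.1 p.2) p.2)
    (hf' : Tendsto (fun p : ℝ × ℝ => f' p.1 p.2) (𝓝[>] 0 ×ˢ 𝓝 ρ) (𝓝 m)) (hm : m ≠ 0)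
    (hf : Tendsto (fun e => f e ρ) (𝓝[>] 0) (𝓝 0)) {η : ℝ} (hη : 0 < η) :
    ∀ᶠ e in 𝓝[>] (0 : ℝ), ∃ x, |x - ρ| < η ∧ f e x = 0 ∧ f' e x ≠ 0 := by
  rcases hm.lt_or_gt with h | h
  · have := exists_root_of_tendsto_deriv_pos (f := fun e x => -f e x) (f' := fun e x => -f' e x)
      (hder.mono fun p hp => hp.neg) hf'.neg (neg_pos.2 h) (by simpa using hf.neg) hη
    simpa only [neg_eq_zero, ne_eq] using this
  · exact exists_root_of_tendsto_deriv_pos hder hf' h hf hη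

/-- A one-parameter family of piecewise fields that unfolds a weak focus at parameter `0`,
for which the rescaled coefficients of the displacement function converge. -/
structure IsUnfolding (n : ℕ) (α b δ₀ : ℝ) (c d : ℝ → ℂ) (c₀ d₀ : ℂ) (X : ℕ → ℝ) : Prop where
  n_pos : 0 < n
  hα : |α| < 2
  hc : Tendsto c (𝓝[>] 0) (𝓝 c₀)
  hd : Tendsto d (𝓝[>] 0) (𝓝 d₀)
  hc₀ : ‖c₀‖ < 2
  hd₀ : ‖d₀‖ < 2
  hX : ∀ j, 0 < j → j ≤ n → Tendsto
    (fun e : ℝ => diffCoeff α (-α + b * e ^ n) (c e) (d e) j / e ^ (n - j)) (𝓝[>] 0) (𝓝 (X j))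

/-- The limit of the rescaled difference of the first integrals. -/
def limitDiff (n : ℕ) (δ₀ : ℝ) (X : ℕ → ℝ) (y : ℝ) : ℝ :=
  -δ₀ / y + ∑ j ∈ Finset.range (n + 1), (-1) ^ (j + 1) / (j : ℝ) * X j * y ^ j

/-- The derivative of `limitDiff`. -/
def limitDiffDeriv (n : ℕ) (δ₀ : ℝ) (X : ℕ → ℝ) (y : ℝ) : ℝ :=
  δ₀ / y ^ 2 + ∑ j ∈ Finset.range n, (-y) ^ j * X (j + 1)

variable {n : ℕ} {α b δ₀ : ℝ} {c d : ℝ → ℂ} {c₀ d₀ : ℂ} {X : ℕ → ℝ}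

theorem IsUnfolding.tendsto_beta (h : IsUnfolding n α b δ₀ c d c₀ d₀ X) :
    Tendsto (fun e : ℝ => -α + b * e ^ n) (𝓝[>] 0) (𝓝 (-α)) := by
  have h1 : Tendsto (fun e : ℝ => -α + b * e ^ n) (𝓝 0) (𝓝 (-α + b * 0 ^ n)) :=
    (show Continuous fun e : ℝ => -α + b * e ^ n by fun_prop).tendsto 0
  rw [zero_pow h.n_pos.ne', mul_zero, add_zero] at h1
  exact h1.mono_left nhdsWithin_le_nhds

theorem IsUnfolding.eventually_bounds (h : IsUnfolding n α b δ₀ c d c₀ d₀ X) :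
    ∀ᶠ e in 𝓝[>] (0 : ℝ), |-α + b * e ^ n| ≤ 2 ∧ ‖c e‖ ≤ 2 ∧ ‖d e‖ ≤ 2 := by
  have h1 := h.tendsto_beta.abs
  rw [abs_neg] at h1
  filter_upwards [h1.eventually (gt_mem_nhds h.hα), h.hc.norm.eventually (gt_mem_nhds h.hc₀),
    h.hd.norm.eventually (gt_mem_nhds h.hd₀)] with e h2 h3 h4
  exact ⟨h2.le, h3.le, h4.le⟩

theorem tendsto_pow_nhdsGT {k : ℕ} (hk : k ≠ 0) :
    Tendsto (fun e : ℝ => e ^ k) (𝓝[>] 0) (𝓝 0) := by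
  have h1 : Tendsto (fun e : ℝ => e ^ k) (𝓝 0) (𝓝 (0 ^ k)) := (continuous_pow k).tendsto 0
  rw [zero_pow hk] at h1
  exact h1.mono_left nhdsWithin_le_nhds

/-- The difference is `log(1 - δ₀ e^n / y)`, linearised at `1` through `dslope`. Negative `y` is
covered because the real logarithm depends only on `|x|`. -/
theorem tendsto_log_sub_log_div {ι : Type*} {l : Filter ι} {e y : ι → ℝ} {y₀ : ℝ} {n : ℕ}
    (hn : 0 < n) (he : Tendsto e l (𝓝[>] 0)) (hy : Tendsto y l (𝓝 y₀)) (hy₀ : y₀ ≠ 0) (δ₀ : ℝ) :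
    Tendsto (fun i => (Real.log (e i * y i - δ₀ * e i ^ (n + 1)) - Real.log (e i * y i)) / e i ^ n)
      l (𝓝 (-δ₀ / y₀)) := by
  have hen := (tendsto_pow_nhdsGT hn.ne').comp he
  have ht : Tendsto (fun i => 1 + -δ₀ * e i ^ n / y i) l (𝓝 1) := by
    have := ((hen.const_mul (-δ₀)).div hy hy₀).const_add 1
    simpa using this
  have hds : Tendsto (fun i => dslope Real.log 1 (1 + -δ₀ * e i ^ n / y i)) l (𝓝 1) := by
    have h1 : ContinuousAt (dslope Real.log 1) 1 :=
      continuousAt_dslope_same.2 (Real.differentiableAt_log one_ne_zero)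
    have h2 := h1.tendsto.comp ht
    rwa [dslope_same, Real.deriv_log, inv_one] at h2
  have hlim := hds.mul ((tendsto_const_nhds (x := -δ₀)).div hy hy₀)
  rw [one_mul] at hlim
  refine hlim.congr' ?_
  filter_upwards [he.eventually self_mem_nhdsWithin, hy.eventually_ne hy₀,
    ht.eventually_ne one_ne_zero] with i hi hyi hti
  have hi0 : e i ≠ 0 := ne_of_gt hi
  have e1 : e i * y i - δ₀ * e i ^ (n + 1) = (1 + -δ₀ * e i ^ n / y i) * (e i * y i) := by
    field_simp
    ring
  have h3 := sub_smul_dslope Real.log 1 (1 + -δ₀ * e i ^ n / y i)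
  rw [Real.log_one, sub_zero, add_sub_cancel_left, smul_eq_mul] at h3
  rw [e1, Real.log_mul hti (mul_ne_zero hi0 hyi), add_sub_cancel_right, ← h3, Pi.div_apply]
  field_simp

/-- At `x = e y` the weight `e^(n-j)` of the `j`-th coefficient combines with `x^j` into the common
factor `e^n`. The Taylor remainder is of order `e^(n+1)`, so it disappears after division. -/
theorem IsUnfolding.tendsto_firstIntegral_sub (h : IsUnfolding n α b δ₀ c d c₀ d₀ X) {ι : Type*}
    {l : Filter ι} {e y : ι → ℝ} {y₀ : ℝ} (he : Tendsto e l (𝓝[>] 0)) (hy : Tendsto y l (𝓝 y₀))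
    (hy₀ : y₀ ≠ 0) : Tendsto (fun i =>
      (firstIntegral (-α + b * e i ^ n) (δ₀ * e i ^ (n + 1)) (d (e i)) (e i * y i) -
        firstIntegral α 0 (c (e i)) (e i * y i)) / e i ^ n) l (𝓝 (limitDiff n δ₀ X y₀)) := by
  have he0 : Tendsto e l (𝓝 0) := he.mono_right nhdsWithin_le_nhds
  have hsum : Tendsto (fun i => ∑ j ∈ Finset.range (n + 1), (-1) ^ (j + 1) / (j : ℝ) *
      (diffCoeff α (-α + b * e i ^ n) (c (e i)) (d (e i)) j / e i ^ (n - j)) * y i ^ j) l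
      (𝓝 (∑ j ∈ Finset.range (n + 1), (-1) ^ (j + 1) / (j : ℝ) * X j * y₀ ^ j)) := by
    refine tendsto_finsetSum _ fun j hj => ?_
    rcases Nat.eq_zero_or_pos j with rfl | hj0
    · simpa using tendsto_const_nhds
    · exact (((h.hX j hj0 (Nat.lt_succ_iff.1 (Finset.mem_range.1 hj))).comp he).const_mul _).mul
        (hy.pow j)
  have hreg : Tendsto (fun i => diffRegular α (-α + b * e i ^ n) (c (e i)) (d (e i)) (e i * y i) /
      e i ^ n - ∑ j ∈ Finset.range (n + 1), (-1) ^ (j + 1) / (j : ℝ) *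
      (diffCoeff α (-α + b * e i ^ n) (c (e i)) (d (e i)) j / e i ^ (n - j)) * y i ^ j) l
      (𝓝 0) := by
    have hb : Tendsto (fun i => 12 * (2 * |y i|) ^ (n + 1) * e i) l (𝓝 0) := by
      have := (((hy.abs.const_mul 2).pow (n + 1)).const_mul 12).mul he0
      simpa using this
    have hsm : ∀ᶠ i in l, |e i * y i| < 1 / 1000000 := by
      have := (he0.mul hy).abs
      rw [zero_mul, abs_zero] at this
      exact this.eventually (gt_mem_nhds (by norm_num))
    refine squeeze_zero_norm' ?_ hb
    filter_upwards [he.eventually h.eventually_bounds, he.eventually self_mem_nhdsWithin, hsm]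
      with i hi hpos hi1
    have hpos : 0 < e i := hpos
    have h1 := abs_diffRegular_sub_le h.hα.le hi.1 hi.2.1 hi.2.2 hi1.le n
    have e1 : ∑ j ∈ Finset.range (n + 1), (-1) ^ (j + 1) / (j : ℝ) *
        (diffCoeff α (-α + b * e i ^ n) (c (e i)) (d (e i)) j / e i ^ (n - j)) * y i ^ j =
        (∑ j ∈ Finset.range (n + 1), (-1) ^ (j + 1) / (j : ℝ) *
          diffCoeff α (-α + b * e i ^ n) (c (e i)) (d (e i)) j * (e i * y i) ^ j) / e i ^ n := by
      rw [Finset.sum_div]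
      refine Finset.sum_congr rfl fun j hj => ?_
      have : e i ^ n = e i ^ (n - j) * e i ^ j := by
        rw [← pow_add, Nat.sub_add_cancel (Nat.lt_succ_iff.1 (Finset.mem_range.1 hj))]
      rw [this, mul_pow]
      have := hpos.ne'
      field_simp
    rw [e1, ← sub_div, norm_div, Real.norm_eq_abs, Real.norm_eq_abs, abs_of_pos (pow_pos hpos n),
      div_le_iff₀ (pow_pos hpos n)]
    refine h1.trans (le_of_eq ?_)
    rw [abs_mul, abs_of_pos hpos]
    ring
  have hlog := tendsto_log_sub_log_div h.n_pos he hy hy₀ δ₀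
  have hfin := hlog.add (hreg.add hsum)
  rw [zero_add] at hfin
  refine hfin.congr fun i => ?_
  rw [firstIntegral_sub_firstIntegral]
  ring

/-- Finite geometric series with exact remainder. It expands the derivative directly, since
convergence of the functions alone says nothing about their derivatives. -/
theorem div_one_add_eq_sum {d : ℂ} {x : ℂ} (h : 1 + d * x ≠ 0) (n : ℕ) :
    d / (1 + d * x) = ∑ j ∈ Finset.range n, (-x) ^ j * d ^ (j + 1) +
      (-x) ^ n * d ^ n * (d / (1 + d * x)) := by
  induction n with
  | zero => simp
  | succ k ih =>
    rw [Finset.sum_range_succ]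
    nth_rewrite 1 [ih]
    have : d / (1 + d * x) = d - d * x * (d / (1 + d * x)) := by
      field_simp
      ring
    nth_rewrite 1 [this]
    ring

theorem re_mul_div_one_add_eq_sum (α : ℝ) {d : ℂ} {x : ℝ} (h : 1 + d * x ≠ 0) (n : ℕ) :
    ((1 + α * Complex.I) * (d / (1 + d * x))).re =
      ∑ j ∈ Finset.range n, (-x) ^ j * ((1 + α * Complex.I) * d ^ (j + 1)).re +
      (-x) ^ n * ((1 + α * Complex.I) * (d ^ n * (d / (1 + d * x)))).re := by
  have h1 : (1 + (α : ℂ) * Complex.I) * (d / (1 + d * x)) =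
      ∑ j ∈ Finset.range n, (((-x) ^ j : ℝ) : ℂ) * ((1 + α * Complex.I) * d ^ (j + 1)) +
      (((-x) ^ n : ℝ) : ℂ) * ((1 + α * Complex.I) * (d ^ n * (d / (1 + d * x)))) := by
    nth_rewrite 1 [div_one_add_eq_sum h n]
    rw [mul_add, Finset.mul_sum]
    push_cast
    congr 1
    · refine Finset.sum_congr rfl fun j _ => ?_
      ring
    · ring
  rw [h1, Complex.add_re, Complex.re_sum, Complex.re_ofReal_mul]
  congr 1
  exact Finset.sum_congr rfl fun j _ => Complex.re_ofReal_mul _ _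

theorem abs_re_mul_pow_mul_div_le {α x : ℝ} {d : ℂ} (hα : |α| ≤ 2) (hd : ‖d‖ ≤ 2)
    (hx : |x| ≤ 1 / 1000000) (n : ℕ) :
    |((1 + α * Complex.I) * (d ^ n * (d / (1 + d * x)))).re| ≤ 12 * 2 ^ n := by
  refine (Complex.abs_re_le_norm _).trans ?_
  have h2 := norm_mul_ofReal_le hd hx
  have h3 : 1 / 2 ≤ ‖1 + d * x‖ := by
    have := norm_sub_norm_le (1 : ℂ) (-(d * x))
    rw [sub_neg_eq_add, norm_neg, norm_one] at this
    linarith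
  have h4 : ‖d / (1 + d * x)‖ ≤ 4 := by
    rw [norm_div, div_le_iff₀ (by linarith)]
    linarith
  rw [norm_mul, norm_mul, norm_pow]
  calc _ ≤ 3 * (2 ^ n * 4) :=
        mul_le_mul (norm_one_add_mul_I_le hα) (mul_le_mul (pow_le_pow_left₀ (norm_nonneg _) hd n)
          h4 (norm_nonneg _) (by positivity)) (by positivity) (by norm_num)
    _ = 12 * 2 ^ n := by ring

/-- The extra factor `e` is the inner derivative of `y ↦ e y`. -/
theorem IsUnfolding.tendsto_firstIntegralDeriv_sub (h : IsUnfolding n α b δ₀ c d c₀ d₀ X)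
    {ι : Type*} {l : Filter ι} {e y : ι → ℝ} {y₀ : ℝ} (he : Tendsto e l (𝓝[>] 0))
    (hy : Tendsto y l (𝓝 y₀)) (hy₀ : y₀ ≠ 0) : Tendsto (fun i =>
      (firstIntegralDeriv (-α + b * e i ^ n) (δ₀ * e i ^ (n + 1)) (d (e i)) (e i * y i) -
        firstIntegralDeriv α 0 (c (e i)) (e i * y i)) * e i / e i ^ n) l
      (𝓝 (limitDiffDeriv n δ₀ X y₀)) := by
  have he0 : Tendsto e l (𝓝 0) := he.mono_right nhdsWithin_le_nhds
  have hen := (tendsto_pow_nhdsGT h.n_pos.ne').comp he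
  have hpole : Tendsto (fun i => δ₀ / (y i * (y i - δ₀ * e i ^ n))) l (𝓝 (δ₀ / y₀ ^ 2)) := by
    have h1 := hy.mul (hy.sub (hen.const_mul δ₀))
    rw [mul_zero, sub_zero, ← sq] at h1
    exact (tendsto_const_nhds (x := δ₀)).div h1 (pow_ne_zero 2 hy₀)
  have hsum : Tendsto (fun i => ∑ j ∈ Finset.range n, (-y i) ^ j *
      (diffCoeff α (-α + b * e i ^ n) (c (e i)) (d (e i)) (j + 1) / e i ^ (n - (j + 1)))) l
      (𝓝 (∑ j ∈ Finset.range n, (-y₀) ^ j * X (j + 1))) := by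
    refine tendsto_finsetSum _ fun j hj => ?_
    exact (hy.neg.pow j).mul ((h.hX (j + 1) j.succ_pos (Finset.mem_range.1 hj)).comp he)
  have hsm : ∀ᶠ i in l, |e i * y i| < 1 / 1000000 := by
    have := (he0.mul hy).abs
    rw [zero_mul, abs_zero] at this
    exact this.eventually (gt_mem_nhds (by norm_num))
  have hrem : Tendsto (fun i => (-y i) ^ n * e i *
      (((1 + α * Complex.I) * (c (e i) ^ n * (c (e i) / (1 + c (e i) * ((e i * y i : ℝ) : ℂ))))).re -
        ((1 + ((-α + b * e i ^ n : ℝ) : ℂ) * Complex.I) *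
          (d (e i) ^ n * (d (e i) / (1 + d (e i) * ((e i * y i : ℝ) : ℂ))))).re)) l (𝓝 0) := by
    have hb : Tendsto (fun i => |(-y i) ^ n * e i| * (24 * 2 ^ n)) l (𝓝 0) := by
      have := (((hy.neg.pow n).mul he0).abs).mul_const (24 * 2 ^ n)
      simpa using this
    refine squeeze_zero_norm' ?_ hb
    filter_upwards [he.eventually h.eventually_bounds, hsm] with i hi hi1
    rw [norm_mul, Real.norm_eq_abs, Real.norm_eq_abs]
    refine mul_le_mul_of_nonneg_left ((abs_sub _ _).trans ?_) (abs_nonneg _)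
    have h1 := abs_re_mul_pow_mul_div_le h.hα.le hi.2.1 hi1.le n
    have h2 := abs_re_mul_pow_mul_div_le hi.1 hi.2.2 hi1.le n
    linarith
  have hfin := hpole.add (hsum.add hrem)
  rw [add_zero] at hfin
  refine hfin.congr' ?_
  filter_upwards [he.eventually h.eventually_bounds, he.eventually self_mem_nhdsWithin, hsm,
    hy.eventually_ne hy₀, (show Tendsto (fun i => y i - δ₀ * e i ^ n) l (𝓝 y₀) by
      simpa using hy.sub (hen.const_mul δ₀)).eventually_ne hy₀] with i hi hpos hi1 hyi hyi'
  have hpos : 0 < e i := hpos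
  have hne := hpos.ne'
  have e1 : (1 / (e i * y i - δ₀ * e i ^ (n + 1)) - 1 / (e i * y i)) * e i / e i ^ n =
      δ₀ / (y i * (y i - δ₀ * e i ^ n)) := by
    have : e i * y i - δ₀ * e i ^ (n + 1) = e i * (y i - δ₀ * e i ^ n) := by ring
    rw [this]
    field_simp
    ring
  have e2 := re_mul_div_one_add_eq_sum α (one_add_mul_ne_zero hi.2.1 hi1.le) n
  have e3 := re_mul_div_one_add_eq_sum (-α + b * e i ^ n) (one_add_mul_ne_zero hi.2.2 hi1.le) n
  have e4 : ∑ j ∈ Finset.range n, (-y i) ^ j *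
      (diffCoeff α (-α + b * e i ^ n) (c (e i)) (d (e i)) (j + 1) / e i ^ (n - (j + 1))) =
      (∑ j ∈ Finset.range n, (-(e i * y i)) ^ j *
        ((1 + α * Complex.I) * c (e i) ^ (j + 1)).re - ∑ j ∈ Finset.range n, (-(e i * y i)) ^ j *
        ((1 + ((-α + b * e i ^ n : ℝ) : ℂ) * Complex.I) * d (e i) ^ (j + 1)).re) *
          e i / e i ^ n := by
    rw [← Finset.sum_sub_distrib, Finset.sum_mul, Finset.sum_div]
    refine Finset.sum_congr rfl fun j hj => ?_
    have : e i ^ n = e i ^ (n - (j + 1)) * e i ^ (j + 1) := by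
      rw [← pow_add, Nat.sub_add_cancel (Finset.mem_range.1 hj)]
    have key : ∀ D : ℝ, (-y i) ^ j * (D / e i ^ (n - (j + 1))) =
        e i ^ j * (-y i) ^ j * D * e i / e i ^ n := by
      intro D
      rw [this, pow_succ]
      field_simp
    rw [diffCoeff, Complex.sub_re, key, neg_mul_eq_mul_neg, mul_pow]
    ring
  have e5 : (-y i) ^ n * e i = (-(e i * y i)) ^ n * e i / e i ^ n := by
    rw [neg_mul_eq_mul_neg, mul_pow]
    field_simp
  rw [firstIntegralDeriv, firstIntegralDeriv, e2, e3, e4, ← e1, e5, sub_zero]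
  ring

end CircleHolo

end

/-! ### Bifurcating limit cycles -/

noncomputable section

namespace CircleHolo

/-- `g e` is the outer half-return map of the field with parameters `α`, `0`, `c e`. -/
def IsHalfReturnFamily (α : ℝ) (c : ℝ → ℂ) (g : ℝ → ℝ → ℝ) : Prop :=
  ∀ e, ‖c e‖ ≤ 2 → ∀ r, 0 < r → r < 1 / 100000000000 →
    Admissible α 0 (c e) r (g e r) ∧
    firstIntegral α 0 (c e) (-g e r) = firstIntegral α 0 (c e) r + α * Real.pi ∧
    g e r ≤ 100000 * r ∧
    HasDerivAt (g e) (-firstIntegralDeriv α 0 (c e) r / firstIntegralDeriv α 0 (c e) (-g e r)) r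

theorem exists_isHalfReturnFamily {α : ℝ} (hα : |α| ≤ 2) (c : ℝ → ℂ) :
    ∃ g, IsHalfReturnFamily α c g := by
  have h : ∀ e, ∃ g : ℝ → ℝ, ‖c e‖ ≤ 2 → ∀ r, 0 < r → r < 1 / 100000000000 →
      Admissible α 0 (c e) r (g r) ∧
      firstIntegral α 0 (c e) (-g r) = firstIntegral α 0 (c e) r + α * Real.pi ∧
      g r ≤ 100000 * r ∧
      HasDerivAt g (-firstIntegralDeriv α 0 (c e) r / firstIntegralDeriv α 0 (c e) (-g r)) r := by
    intro e
    by_cases hc : ‖c e‖ ≤ 2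
    · obtain ⟨g, hg⟩ := exists_halfReturn α 0 (c e) hα hc
      refine ⟨g, fun _ r hr hr1 => ?_⟩
      have h0 : |(0 : ℝ)| < r / 1000000 := by
        rw [abs_zero]
        positivity
      obtain ⟨h1, h2, h3, h4⟩ := hg r hr hr1.le h0.le
      exact ⟨h1, h2, h3, h4 hr1 h0⟩
    · exact ⟨fun _ => 0, fun h => absurd h hc⟩
  choose g hg using h
  exact ⟨g, hg⟩

variable {n : ℕ} {α b δ₀ : ℝ} {c d : ℝ → ℂ} {c₀ d₀ : ℂ} {X : ℕ → ℝ}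

/-- The regular part of the first integral is `O(e)` at scale `e`, so in the limit the half-return
is multiplication by `e^(α π)`. The constant is `900009 = 9 * 100000 + 9`. -/
theorem tendsto_halfReturn_div {ι : Type*} {l : Filter ι} {e y s : ι → ℝ} {c : ι → ℂ} {y₀ : ℝ}
    (hα : |α| ≤ 2) (he : Tendsto e l (𝓝[>] 0)) (hy : Tendsto y l (𝓝 y₀))
    (hc : ∀ᶠ i in l, ‖c i‖ ≤ 2)
    (hs : ∀ᶠ i in l, Admissible α 0 (c i) (e i * y i) (s i) ∧
      firstIntegral α 0 (c i) (-s i) = firstIntegral α 0 (c i) (e i * y i) + α * Real.pi ∧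
      s i ≤ 100000 * (e i * y i)) :
    Tendsto (fun i => s i / e i) l (𝓝 (Real.exp (α * Real.pi) * y₀)) := by
  have he0 : Tendsto e l (𝓝 0) := he.mono_right nhdsWithin_le_nhds
  set w : ι → ℝ := fun i => Real.log (s i) - Real.log (e i * y i) - α * Real.pi with hw
  have hwt : Tendsto w l (𝓝 0) := by
    have hb : Tendsto (fun i => 900009 * (e i * y i)) l (𝓝 0) := by
      simpa using (he0.mul hy).const_mul 900009
    refine squeeze_zero_norm' ?_ hb
    filter_upwards [hs, hc] with i hi hci
    obtain ⟨ha, hI, hle⟩ := hi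
    have b1 := abs_re_mul_log_le (x := e i * y i) hα hci (by rw [abs_of_pos ha.hr]; exact ha.hr1)
    have b2 := abs_re_mul_log_le (x := -s i) hα hci
      (by rw [abs_neg, abs_of_pos ha.hs]; exact ha.hs1)
    rw [abs_of_pos ha.hr] at b1
    rw [abs_neg, abs_of_pos ha.hs] at b2
    rw [firstIntegral, firstIntegral, sub_zero, sub_zero, Real.log_neg_eq_log] at hI
    have b1' := abs_le.1 b1
    have b2' := abs_le.1 b2
    rw [Real.norm_eq_abs, abs_le]
    simp only [hw]
    constructor <;> linarith [b1'.1, b1'.2, b2'.1, b2'.2]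
  have hexp := (Real.continuous_exp.tendsto 0).comp hwt
  rw [Real.exp_zero] at hexp
  have hfin := (hy.const_mul (Real.exp (α * Real.pi))).mul hexp
  rw [mul_one] at hfin
  refine hfin.congr' ?_
  filter_upwards [hs, he.eventually self_mem_nhdsWithin] with i hi hpos
  have hpos : 0 < e i := hpos
  have hne := hpos.ne'
  have hy0 : y i ≠ 0 := fun h => by
    have := hi.1.hr
    rw [h, mul_zero] at this
    exact lt_irrefl _ this
  have hq := (Real.exp_pos (α * Real.pi)).ne'
  simp only [hw, Function.comp_apply]
  rw [Real.exp_sub, Real.exp_sub, Real.exp_log hi.1.hs, Real.exp_log hi.1.hr]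
  field_simp

/-- Only the pole `1/x` survives at scale `e`; the regular part of the derivative is bounded by 12.
-/
theorem tendsto_firstIntegralDeriv_mul {ι : Type*} {l : Filter ι} {e y : ι → ℝ} {c : ι → ℂ}
    {y₀ : ℝ} (hα : |α| ≤ 2) (he : Tendsto e l (𝓝[>] 0)) (hy : Tendsto y l (𝓝 y₀)) (hy₀ : y₀ ≠ 0)
    (hc : ∀ᶠ i in l, ‖c i‖ ≤ 2) :
    Tendsto (fun i => firstIntegralDeriv α 0 (c i) (e i * y i) * e i) l (𝓝 (1 / y₀)) := by
  have he0 : Tendsto e l (𝓝 0) := he.mono_right nhdsWithin_le_nhds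
  have hrem : Tendsto (fun i => ((1 + α * Complex.I) *
      (c i / (1 + c i * ((e i * y i : ℝ) : ℂ)))).re * e i) l (𝓝 0) := by
    have hb : Tendsto (fun i => 12 * |e i|) l (𝓝 0) := by
      simpa using he0.abs.const_mul 12
    refine squeeze_zero_norm' ?_ hb
    have hsm : ∀ᶠ i in l, |e i * y i| < 1 / 1000000 := by
      have := (he0.mul hy).abs
      rw [zero_mul, abs_zero] at this
      exact this.eventually (gt_mem_nhds (by norm_num))
    filter_upwards [hc, hsm] with i hi hi1
    rw [norm_mul, Real.norm_eq_abs, Real.norm_eq_abs]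
    exact mul_le_mul_of_nonneg_right (abs_re_mul_div_le hα hi hi1.le) (abs_nonneg _)
  have hfin := ((tendsto_const_nhds (x := (1 : ℝ))).div hy hy₀).sub hrem
  rw [sub_zero] at hfin
  refine hfin.congr' ?_
  filter_upwards [he.eventually self_mem_nhdsWithin, hy.eventually_ne hy₀] with i hpos hyi
  have hpos : 0 < e i := hpos
  have hne := hpos.ne'
  rw [firstIntegralDeriv, sub_zero, sub_mul, Pi.div_apply]
  congr 1
  field_simp

/-- A positive simple zero `ρ` of the limit of the rescaled displacement function gives rise to a
hyperbolic limit cycle that meets the circle near the parameter `e * ρ`. -/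
theorem IsUnfolding.eventually_exists_cycle (h : IsUnfolding n α b δ₀ c d c₀ d₀ X) {ρ : ℝ}
    (hρ : 0 < ρ)
    (hzero : limitDiff n δ₀ X (-(Real.exp (α * Real.pi) * ρ)) - limitDiff n δ₀ X ρ +
      b * Real.pi = 0)
    (hsimple : limitDiffDeriv n δ₀ X (-(Real.exp (α * Real.pi) * ρ)) * Real.exp (α * Real.pi) +
      limitDiffDeriv n δ₀ X ρ ≠ 0) {η ε : ℝ} (hη : 0 < η) (hε : 0 < ε) :
    ∀ᶠ e in 𝓝[>] (0 : ℝ), ∃ x Γ, |x - ρ| < η ∧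
      IsHyperbolicLimitCycle (polyField α 0 (c e))
        (polyField (-α + b * e ^ n) (δ₀ * e ^ (n + 1)) (d e)) Γ ∧
      Γ ⊆ Metric.ball 1 ε ∧ circlePoint 1 (e * x) ∈ Γ ∧
      ∀ t, 0 < t → circlePoint 1 t ∈ Γ → t = e * x := by
  obtain ⟨g, hg⟩ := exists_isHalfReturnFamily h.hα.le c
  set q := Real.exp (α * Real.pi) with hq
  have hq0 : 0 < q := Real.exp_pos _
  set l : Filter (ℝ × ℝ) := 𝓝[>] 0 ×ˢ 𝓝 ρ with hl
  have he : Tendsto (fun p : ℝ × ℝ => p.1) l (𝓝[>] 0) := tendsto_fst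
  have he0 : Tendsto (fun p : ℝ × ℝ => p.1) l (𝓝 0) := he.mono_right nhdsWithin_le_nhds
  have hy : Tendsto (fun p : ℝ × ℝ => p.2) l (𝓝 ρ) := tendsto_snd
  have hbd := he.eventually h.eventually_bounds
  have hepos : ∀ᶠ p in l, 0 < p.1 := he.eventually self_mem_nhdsWithin
  have hypos : ∀ᶠ p in l, 0 < p.2 := hy.eventually (lt_mem_nhds hρ)
  have her : Tendsto (fun p : ℝ × ℝ => p.1 * p.2) l (𝓝 0) := by simpa using he0.mul hy
  have hsmall : ∀ᶠ p in l, p.1 * p.2 < 1 / 100000000000 :=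
    her.eventually (gt_mem_nhds (by norm_num))
  have hG : ∀ᶠ p in l, Admissible α 0 (c p.1) (p.1 * p.2) (g p.1 (p.1 * p.2)) ∧
      firstIntegral α 0 (c p.1) (-g p.1 (p.1 * p.2)) =
        firstIntegral α 0 (c p.1) (p.1 * p.2) + α * Real.pi ∧
      g p.1 (p.1 * p.2) ≤ 100000 * (p.1 * p.2) ∧
      HasDerivAt (g p.1) (-firstIntegralDeriv α 0 (c p.1) (p.1 * p.2) /
        firstIntegralDeriv α 0 (c p.1) (-g p.1 (p.1 * p.2))) (p.1 * p.2) := by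
    filter_upwards [hbd, hepos, hypos, hsmall] with p h1 h2 h3 h4
    exact hg p.1 h1.2.1 _ (mul_pos h2 h3) h4
  set σ : ℝ × ℝ → ℝ := fun p => g p.1 (p.1 * p.2) / p.1 with hσ
  have hσt : Tendsto σ l (𝓝 (q * ρ)) :=
    tendsto_halfReturn_div h.hα.le he hy (hbd.mono fun p hp => hp.2.1)
      (hG.mono fun p hp => ⟨hp.1, hp.2.1, hp.2.2.1⟩)
  have hσeq : ∀ᶠ p in l, p.1 * -σ p = -g p.1 (p.1 * p.2) := by
    filter_upwards [hepos] with p hp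
    simp only [hσ]
    field_simp
  have hqρ : -(q * ρ) ≠ 0 := neg_ne_zero.2 (mul_pos hq0 hρ).ne'
  set β : ℝ → ℝ := fun e => -α + b * e ^ n with hβ
  set δ : ℝ → ℝ := fun e => δ₀ * e ^ (n + 1) with hδ
  have hδt : Tendsto (fun p : ℝ × ℝ => |δ₀| * p.1 ^ n) l (𝓝 0) := by
    simpa using ((tendsto_pow_nhdsGT h.n_pos.ne').comp he).const_mul |δ₀|
  have hδr : ∀ᶠ p in l, |δ p.1| < p.1 * p.2 / 1000000 := by
    filter_upwards [hepos, hδt.eventually_lt (hy.div_const 1000000) (by positivity)] with p h1 h2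
    have h3 := mul_lt_mul_of_pos_left h2 h1
    simp only [hδ]
    rw [abs_mul, abs_of_pos (pow_pos h1 _), pow_succ]
    linarith
  have hδs : ∀ᶠ p in l, |δ p.1| < g p.1 (p.1 * p.2) / 1000000 := by
    filter_upwards [hepos, hσeq, hδt.eventually_lt (hσt.div_const 1000000) (by positivity)]
      with p h1 h4 h2
    have h3 := mul_lt_mul_of_pos_left h2 h1
    simp only [hδ]
    rw [abs_mul, abs_of_pos (pow_pos h1 _), pow_succ]
    linarith
  have hdp := tendsto_firstIntegralDeriv_mul h.hα.le he hy hρ.ne' (hbd.mono fun p hp => hp.2.1)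
  have hdm := tendsto_firstIntegralDeriv_mul h.hα.le he hσt.neg hqρ (hbd.mono fun p hp => hp.2.1)
  have hdm0 : ∀ᶠ p in l, firstIntegralDeriv α 0 (c p.1) (-g p.1 (p.1 * p.2)) ≠ 0 := by
    filter_upwards [hdm.eventually_ne (one_div_ne_zero hqρ), hσeq] with p h1 h2 h3
    rw [h2, h3, zero_mul] at h1
    exact h1 rfl
  -- The outer equation is solved by `g`, so `f` is the remaining closing condition for the inner
  -- arc, scaled by `e^n`.
  set f : ℝ → ℝ → ℝ := fun e x => (firstIntegral (β e) (δ e) (d e) (-g e (e * x)) -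
    firstIntegral (β e) (δ e) (d e) (e * x) + β e * Real.pi) / e ^ n with hf
  set f' : ℝ → ℝ → ℝ := fun e x => (firstIntegralDeriv (β e) (δ e) (d e) (-g e (e * x)) *
    (firstIntegralDeriv α 0 (c e) (e * x) / firstIntegralDeriv α 0 (c e) (-g e (e * x))) -
    firstIntegralDeriv (β e) (δ e) (d e) (e * x)) * e / e ^ n with hf'
  have hder : ∀ᶠ p in l, HasDerivAt (f p.1) (f' p.1 p.2) p.2 := by
    filter_upwards [hbd, hepos, hypos, hG, hδr, hδs] with p h1 h2 h3 h4 h5 h6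
    obtain ⟨e, x⟩ := p
    dsimp only at *
    have hr := h4.1.hr
    have hs := h4.1.hs
    have hlin : HasDerivAt (fun x : ℝ => e * x) e x := by
      simpa using (hasDerivAt_id x).const_mul e
    have hgd := ((h4.2.2.2).comp x hlin).neg
    have hx1 := hasDerivAt_firstIntegral (β e) (δ := δ e) (x := e * x) h1.2.2
      (by rw [abs_of_pos hr]; exact h4.1.hr1) (by
        have := (abs_lt.1 h5).2
        intro h7
        linarith)
    have hx2 := hasDerivAt_firstIntegral (β e) (δ := δ e) (x := -g e (e * x)) h1.2.2
      (by rw [abs_neg, abs_of_pos hs]; exact h4.1.hs1) (by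
        have := (abs_lt.1 h6).1
        intro h7
        linarith)
    have h8 := (((hx2.comp x hgd).sub (hx1.comp x hlin)).add_const (β e * Real.pi)).div_const
      (e ^ n)
    refine h8.congr_deriv ?_
    simp only [hf']
    ring
  -- Subtracting the outer first integral from the inner one does not change `f'`, because the outer
  -- derivatives cancel against the quotient given by the derivative of `g`. Only the rescaled
  -- differences remain, and the quotient tends to `-q`.
  have hf't : Tendsto (fun p : ℝ × ℝ => f' p.1 p.2) l (𝓝 (limitDiffDeriv n δ₀ X (-(q * ρ)) *
      (1 / ρ / (1 / (-(q * ρ)))) - limitDiffDeriv n δ₀ X ρ)) := by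
    have h1 := h.tendsto_firstIntegralDeriv_sub he hσt.neg hqρ
    have h2 := h.tendsto_firstIntegralDeriv_sub he hy hρ.ne'
    refine ((h1.mul (hdp.div hdm (one_div_ne_zero hqρ))).sub h2).congr' ?_
    filter_upwards [hepos, hσeq, hdm0] with p hp h3 h4
    have hne := hp.ne'
    simp only [hf', Pi.div_apply]
    rw [h3, mul_div_mul_right _ _ hne]
    simp only [hβ, hδ]
    field_simp
    ring
  -- For `f` itself the outer equation contributes `α π`; together with `β π` this is `b e^n π`,
  -- which rescales to `b π`.
  have hft : Tendsto (fun p : ℝ × ℝ => f p.1 p.2) l (𝓝 0) := by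
    have h1 := h.tendsto_firstIntegral_sub he hσt.neg hqρ
    have h2 := h.tendsto_firstIntegral_sub he hy hρ.ne'
    rw [← hzero]
    refine ((h1.sub h2).add_const (b * Real.pi)).congr' ?_
    filter_upwards [hepos, hσeq, hG] with p hp h3 h4
    have hne := hp.ne'
    have h5 := h4.2.1
    simp only [hf]
    rw [h3, h5]
    simp only [hβ, hδ]
    field_simp
    ring
  have hpair : Tendsto (fun e : ℝ => (e, ρ)) (𝓝[>] 0) l := tendsto_id.prodMk tendsto_const_nhds
  have hft' : Tendsto (fun e => f e ρ) (𝓝[>] 0) (𝓝 0) := by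
    have := hft.comp hpair
    rwa [Function.comp_def] at this
  have hm : limitDiffDeriv n δ₀ X (-(q * ρ)) * (1 / ρ / (1 / (-(q * ρ)))) -
      limitDiffDeriv n δ₀ X ρ ≠ 0 := by
    have : 1 / ρ / (1 / (-(q * ρ))) = -q := by
      field_simp
    rw [this]
    intro h0
    exact hsimple (by linarith)
  have hball : ∀ᶠ p in l, 200000 * (100001 * (p.1 * p.2)) < ε := by
    have := (her.const_mul 100001).const_mul 200000
    rw [mul_zero, mul_zero] at this
    exact this.eventually (gt_mem_nhds hε)
  have hsmall' : ∀ᶠ p in l, 100000 * (p.1 * p.2) < 1 / 100000000000 := by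
    have := her.const_mul 100000
    rw [mul_zero] at this
    exact this.eventually (gt_mem_nhds (by norm_num))
  obtain ⟨pa, hpa, pb, hpb, hab⟩ := eventually_prod_iff.1
    (hbd.and (hepos.and (hG.and (hδr.and (hδs.and (hdm0.and (hball.and
      (hsmall.and hsmall'))))))))
  obtain ⟨η₁, hη₁, hpb⟩ := Metric.eventually_nhds_iff.1 hpb
  filter_upwards [hpa, exists_root_of_tendsto_deriv hder hf't hm hft' (lt_min hη hη₁)]
    with e hea ⟨x, hx, hx0, hx'⟩
  obtain ⟨h1, h2, h3, h4, h5, h6, h7, h8, h9⟩ := hab hea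
    (hpb (show dist x ρ < η₁ from (Real.dist_eq x ρ).trans_lt (hx.trans_le (min_le_right _ _))))
  dsimp only at h1 h2 h3 h4 h5 h6 h7 h8 h9
  have hen : e ^ n ≠ 0 := (pow_pos h2 n).ne'
  have hm' : firstIntegral (β e) (δ e) (d e) (e * x) =
      firstIntegral (β e) (δ e) (d e) (-g e (e * x)) + β e * Real.pi := by
    have := (div_eq_zero_iff.1 hx0).resolve_right hen
    linarith
  have hne : firstIntegralDeriv α 0 (c e) (e * x) *
      firstIntegralDeriv (β e) (δ e) (d e) (-g e (e * x)) ≠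
      firstIntegralDeriv α 0 (c e) (-g e (e * x)) *
        firstIntegralDeriv (β e) (δ e) (d e) (e * x) := by
    intro h0
    apply hx'
    simp only [hf']
    rw [mul_div_assoc', mul_comm (firstIntegralDeriv (β e) (δ e) (d e) (-g e (e * x))), h0,
      mul_div_cancel_left₀ _ h6, sub_self, zero_mul, zero_div]
  obtain ⟨Γ, hΓ, hΓb, hΓx, hΓu⟩ := exists_isHyperbolicLimitCycle h.hα.le h1.1 h1.2.1 h1.2.2
    h3.1.hr h3.1.hs h8 (h3.2.2.1.trans_lt h9) h4 h5 h3.2.1 hm' hne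
  refine ⟨x, Γ, hx.trans_le (min_le_left _ _), hΓ, fun z hz => ?_, hΓx, hΓu⟩
  rw [mem_ball_iff_norm]
  have h10 := hΓb z hz
  have h11 := h3.2.2.1
  linarith

/-- If the limit of the rescaled displacement function has the simple zeros `1, …, m`, then `m`
hyperbolic limit cycles bifurcate. -/
theorem IsUnfolding.bifurcate (h : IsUnfolding n α b δ₀ c d c₀ d₀ X) {m : ℕ}
    (hdegp : ∀ᶠ e in 𝓝[>] (0 : ℝ), (polyField α 0 (c e)).natDegree =
      (polyField α 0 c₀).natDegree)
    (hdegm : ∀ᶠ e in 𝓝[>] (0 : ℝ), (polyField (-α + b * e ^ n) (δ₀ * e ^ (n + 1)) (d e)).natDegree =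
      (polyField (-α) 0 d₀).natDegree)
    (hzero : ∀ i : ℕ, i < m → limitDiff n δ₀ X (-(Real.exp (α * Real.pi) * (i + 1))) -
      limitDiff n δ₀ X (i + 1) + b * Real.pi = 0)
    (hsimple : ∀ i : ℕ, i < m → limitDiffDeriv n δ₀ X (-(Real.exp (α * Real.pi) * (i + 1))) *
      Real.exp (α * Real.pi) + limitDiffDeriv n δ₀ X (i + 1) ≠ 0) :
    Bifurcate (polyField α 0 c₀) (polyField (-α) 0 d₀) 1 m := by
  intro ε hε
  -- The tolerance `1/2` about the integers `i + 1` keeps the crossing parameters of different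
  -- cycles apart.
  have hcyc : ∀ᶠ e in 𝓝[>] (0 : ℝ), ∀ i ∈ Finset.range m, ∃ x Γ, |x - ((i : ℝ) + 1)| < 1 / 2 ∧
      IsHyperbolicLimitCycle (polyField α 0 (c e))
        (polyField (-α + b * e ^ n) (δ₀ * e ^ (n + 1)) (d e)) Γ ∧
      Γ ⊆ Metric.ball 1 ε ∧ circlePoint 1 (e * x) ∈ Γ ∧
      ∀ t, 0 < t → circlePoint 1 t ∈ Γ → t = e * x := by
    rw [Filter.eventually_all_finset]
    intro i hi
    exact h.eventually_exists_cycle (by positivity) (hzero i (Finset.mem_range.1 hi))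
      (hsimple i (Finset.mem_range.1 hi)) (by norm_num) hε
  have hδt : Tendsto (fun e : ℝ => δ₀ * e ^ (n + 1)) (𝓝[>] 0) (𝓝 0) := by
    simpa using (tendsto_pow_nhdsGT n.succ_ne_zero).const_mul δ₀
  have hcp := eventually_norm_coeff_polyField_sub_lt (tendsto_const_nhds (x := α))
    (tendsto_const_nhds (x := (0 : ℝ))) h.hc hε
  have hcm := eventually_norm_coeff_polyField_sub_lt h.tendsto_beta hδt h.hd hε
  have hpos : ∀ᶠ e in 𝓝[>] (0 : ℝ), 0 < e := self_mem_nhdsWithin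
  obtain ⟨e, he, hcyc, hcp, hcm, hdp, hdm⟩ :=
    (hpos.and (hcyc.and (hcp.and (hcm.and (hdegp.and hdegm))))).exists
  choose! x Γ hx hΓ hΓb hΓx hΓu using hcyc
  refine ⟨_, _, hdp, hdm, hcp, hcm, (Finset.range m).image Γ, ?_, ?_⟩
  -- A cycle meets the arc of positive parameters only once, so equal cycles have equal crossing
  -- parameters and hence equal indices.
  · rw [Finset.card_image_of_injOn, Finset.card_range]
    intro i hi j hj hij
    have hi' : i ∈ Finset.range m := hi
    have hj' : j ∈ Finset.range m := hj
    have hi1 := abs_lt.1 (hx i hi')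
    have hj1 := abs_lt.1 (hx j hj')
    have hi0 : (0 : ℝ) ≤ i := i.cast_nonneg
    have hxi : 0 < x i := by linarith [hi1.1]
    have h1 := hΓu j hj' (e * x i) (mul_pos he hxi) (hij ▸ hΓx i hi')
    have h2 := mul_left_cancel₀ he.ne' h1
    rw [h2] at hi1
    have h3 : (i : ℝ) < j + 1 := by linarith [hi1.1, hi1.2, hj1.1, hj1.2]
    have h4 : (j : ℝ) < i + 1 := by linarith [hi1.1, hi1.2, hj1.1, hj1.2]
    have h5 : i < j + 1 := by exact_mod_cast h3
    have h6 : j < i + 1 := by exact_mod_cast h4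
    omega
  · intro G hG
    obtain ⟨i, hi, rfl⟩ := Finset.mem_image.1 hG
    exact ⟨hΓ i hi, hΓb i hi⟩

end CircleHolo

end

/-! ### Lower bounds -/

noncomputable section

namespace CircleHolo

/-- Every set of limit cycles that bifurcates is a set of limit cycles of some system. -/
theorem maxBifurcating_le_maxLimitCycles (np nm : ℕ) :
    maxBifurcating np nm ≤ maxLimitCycles np nm := by
  refine iSup₂_le fun m hm => ?_
  obtain ⟨Fp, Fm, p, k, hp, hm, -, hb⟩ := hm
  obtain ⟨Gp, Gm, hGp, hGm, -, -, C, hC, hcyc⟩ := hb 1 one_pos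
  have h1 : (m : ℕ∞) ≤ {Γ : Set ℂ | IsLimitCycle Gp Gm Γ}.encard := by
    rw [← hC, ← Set.encard_coe_eq_coe_finsetCard]
    exact Set.encard_le_encard fun Γ hΓ => (hcyc Γ hΓ).1.1
  refine h1.trans ?_
  unfold maxLimitCycles
  exact le_iSup_of_le Gp (le_iSup_of_le Gm (le_iSup_of_le ⟨hGp.trans hp, hGm.trans hm⟩ le_rfl))

theorem le_maxBifurcating {np nm m k : ℕ} {Fp Fm : ℂ[X]} {p : ℂ} (hp : Fp.natDegree = np)
    (hm : Fm.natDegree = nm) (hw : IsWeakFocus Fp Fm p k) (hb : Bifurcate Fp Fm p m) :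
    (m : ℕ∞) ≤ maxBifurcating np nm :=
  le_iSup₂_of_le m ⟨Fp, Fm, p, k, hp, hm, hw, hb⟩ le_rfl

theorem tendsto_nhdsGT_of_continuous {Y : Type*} [TopologicalSpace Y] {f : ℝ → Y} {y : Y}
    (hf : Continuous f) (h : f 0 = y) : Tendsto f (𝓝[>] 0) (𝓝 y) :=
  h ▸ (hf.tendsto 0).mono_left nhdsWithin_le_nhds

theorem tendsto_div_pow_nhdsGT {f P : ℝ → ℝ} {k : ℕ} {y : ℝ} (hf : ∀ e, f e = e ^ k * P e)
    (hP : Continuous P) (h : P 0 = y) : Tendsto (fun e => f e / e ^ k) (𝓝[>] 0) (𝓝 y) := by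
  refine (tendsto_nhdsGT_of_continuous hP h).congr' ?_
  filter_upwards [self_mem_nhdsWithin] with e he
  have he : 0 < e := he
  rw [hf, mul_div_cancel_left₀ _ (pow_pos he k).ne']

section Degree

variable {n : ℕ} {α b δ₀ : ℝ} {c d : ℝ → ℂ} {c₀ d₀ : ℂ} {X : ℕ → ℝ}

theorem natDegree_polyField_zero_of_ne (α : ℝ) {d : ℂ} (hd : d ≠ Complex.I) :
    (polyField α 0 d).natDegree = 2 :=
  natDegree_polyField_of_ne α (by simp) hd

theorem natDegree_polyField_zero_I (α : ℝ) : (polyField α 0 Complex.I).natDegree = 1 :=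
  natDegree_polyField_I α (by simp)

theorem IsUnfolding.eventually_natDegree_outer (h : IsUnfolding n α b δ₀ c d c₀ d₀ X)
    (hc₀ : c₀ ≠ Complex.I) : ∀ᶠ e in 𝓝[>] (0 : ℝ), (polyField α 0 (c e)).natDegree =
      (polyField α 0 c₀).natDegree := by
  filter_upwards [h.hc.eventually_ne hc₀] with e he
  rw [natDegree_polyField_zero_of_ne α he, natDegree_polyField_zero_of_ne α hc₀]

theorem IsUnfolding.eventually_natDegree_inner (h : IsUnfolding n α b δ₀ c d c₀ d₀ X)
    (hd₀ : d₀ ≠ Complex.I) : ∀ᶠ e in 𝓝[>] (0 : ℝ),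
      (polyField (-α + b * e ^ n) (δ₀ * e ^ (n + 1)) (d e)).natDegree =
      (polyField (-α) 0 d₀).natDegree := by
  have hδ : ∀ᶠ e in 𝓝[>] (0 : ℝ), |δ₀ * e ^ (n + 1)| < 1 / 1000000 := by
    have := ((tendsto_pow_nhdsGT n.succ_ne_zero).const_mul δ₀).abs
    rw [mul_zero, abs_zero] at this
    exact this.eventually (gt_mem_nhds (by norm_num))
  filter_upwards [h.hd.eventually_ne hd₀, h.eventually_bounds, hδ] with e he hb hδe
  rw [natDegree_polyField_of_ne _ (one_add_mul_ne_zero hb.2.2 hδe.le) he,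
    natDegree_polyField_zero_of_ne _ hd₀]

theorem natDegree_polyField_I_eq (α β δ : ℝ) :
    (polyField β δ Complex.I).natDegree = (polyField α 0 Complex.I).natDegree := by
  rw [natDegree_polyField_zero_I, natDegree_polyField_I _ (one_add_I_mul_ne_zero δ)]

end Degree

/-- The expansion factor of the outer half-return map for the expansion rate one. -/
def growth : ℝ := Real.exp (1 * Real.pi)

theorem one_lt_growth : 1 < growth := by
  rw [growth, one_mul, ← Real.exp_zero]
  exact Real.exp_lt_exp.2 Real.pi_pos

theorem norm_lt_two_of_normSq_lt {z : ℂ} (h : Complex.normSq z < 4) : ‖z‖ < 2 := by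
  rw [Complex.normSq_eq_norm_sq] at h
  nlinarith [norm_nonneg z]

/-- Both fields are linear, `c = d = i`, and the first coefficient is already `-2` at `α = 1`. The
shift and the trace are free, and the limit is `2 (q + 1)(ρ - 1)(ρ - 2)/ρ`. -/
theorem two_le_maxBifurcating_one_one : 2 ≤ maxBifurcating 1 1 := by
  have hq := one_lt_growth
  set q := growth with hqd
  have hπ := Real.pi_pos
  have h : IsUnfolding 1 1 (-(6 * (q + 1)) / Real.pi) (4 * q) (fun _ => Complex.I)
      (fun _ => Complex.I) Complex.I Complex.I (fun _ => -2) := by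
    refine ⟨one_pos, by norm_num, tendsto_const_nhds, tendsto_const_nhds, by simp, by simp, ?_⟩
    intro j hj0 hj
    interval_cases j
    refine tendsto_div_pow_nhdsGT (P := fun e => -2 + -(6 * (q + 1)) / Real.pi * e)
      (fun e => ?_) (by fun_prop) (by simp)
    simp [diffCoeff]
    ring
  have hb : Bifurcate (polyField 1 0 Complex.I) (polyField (-1) 0 Complex.I) 1 2 := by
    refine h.bifurcate (Eventually.of_forall fun e => rfl)
      (Eventually.of_forall fun e => natDegree_polyField_I_eq _ _ _) ?_ ?_ <;>
    intro i hi <;> rw [← growth, ← hqd] <;> interval_cases i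
    · simp [limitDiff, Finset.sum_range_succ]; field_simp; ring
    · simp [limitDiff, Finset.sum_range_succ]; field_simp; ring
    · have : 2 * (q + 1) ≠ 0 := by positivity
      convert this using 1
      simp [limitDiffDeriv]; field_simp; ring
    · have : -(q + 1) ≠ 0 := neg_ne_zero.2 (by positivity)
      convert this using 1
      simp [limitDiffDeriv]; field_simp; ring
  refine le_maxBifurcating (m := 2) (natDegree_polyField_zero_I _) (natDegree_polyField_zero_I _)
    (isWeakFocus_polyField (n := 1) one_pos (by norm_num) one_ne_zero (by simp) (by simp) ?_ ?_) hb
  · intro j h0 h1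
    omega
  · simp [diffCoeff]
    norm_num

/-- The coefficients for which the limit of the rescaled displacement function is a multiple of
`(ρ - 1) (ρ - 2) (ρ - 3) / ρ`. -/
def cubicCoeff (κ : ℝ) (j : ℕ) : ℝ := if j = 1 then -(6 * κ * (growth - 1)) else 2 * κ

/-- With `q = growth` the left side is `-κ (q² - 1)(ρ - 1)(ρ - 2)(ρ - 3)/ρ` at `ρ = i + 1`; matching
the powers of `ρ` determines the three groups of constants. -/
theorem cubicCoeff_zero {κ : ℝ} {i : ℕ} (hi : i < 3) :
    limitDiff 2 (6 * κ * (growth - 1) * growth) (cubicCoeff κ)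
      (-(Real.exp (1 * Real.pi) * (i + 1))) -
    limitDiff 2 (6 * κ * (growth - 1) * growth) (cubicCoeff κ) (i + 1) +
      -(11 * κ * (growth ^ 2 - 1)) / Real.pi * Real.pi = 0 := by
  have hq := one_lt_growth
  have hπ := Real.pi_pos
  rw [← growth]
  interval_cases i <;>
  · simp [limitDiff, Finset.sum_range_succ, cubicCoeff]
    field_simp
    ring

theorem cubicCoeff_simple {κ : ℝ} (hκ : κ ≠ 0) {i : ℕ} (hi : i < 3) :
    limitDiffDeriv 2 (6 * κ * (growth - 1) * growth) (cubicCoeff κ)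
      (-(Real.exp (1 * Real.pi) * (i + 1))) * Real.exp (1 * Real.pi) +
    limitDiffDeriv 2 (6 * κ * (growth - 1) * growth) (cubicCoeff κ) (i + 1) ≠ 0 := by
  have hq := one_lt_growth
  have hY : κ * (growth ^ 2 - 1) ≠ 0 := mul_ne_zero hκ (by nlinarith)
  rw [← growth]
  interval_cases i
  · convert mul_ne_zero (two_ne_zero (α := ℝ)) hY using 1
    simp [limitDiffDeriv, Finset.sum_range_succ, cubicCoeff]; field_simp; ring
  · convert mul_ne_zero (show (-1 / 2 : ℝ) ≠ 0 by norm_num) hY using 1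
    simp [limitDiffDeriv, Finset.sum_range_succ, cubicCoeff]; field_simp; ring
  · convert mul_ne_zero (show (2 / 3 : ℝ) ≠ 0 by norm_num) hY using 1
    simp [limitDiffDeriv, Finset.sum_range_succ, cubicCoeff]; field_simp; ring

/-- With `c = i` and real `d` the first coefficient is `-1 - d`, which vanishes at `d = -1`, where
the second equals `-2`; hence `κ = -1`. Moving `d` at rate `x` supplies the first-order coefficient,
and for real `d` the trace does not enter. -/
theorem three_le_maxBifurcating_one_two : 3 ≤ maxBifurcating 1 2 := by
  set x := -(6 * (growth - 1)) with hx
  have hI : (-1 : ℂ) ≠ Complex.I := fun h => by simpa using congrArg Complex.re h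
  have h : IsUnfolding 2 1 (-(11 * (-1) * (growth ^ 2 - 1)) / Real.pi)
      (6 * (-1) * (growth - 1) * growth) (fun _ => Complex.I)
      (fun e => ((-1 + e * x : ℝ) : ℂ)) Complex.I (-1) (cubicCoeff (-1)) := by
    set b := -(11 * (-1) * (growth ^ 2 - 1)) / Real.pi
    refine ⟨two_pos, by norm_num, tendsto_const_nhds,
      tendsto_nhdsGT_of_continuous (by fun_prop) (by simp), by simp, by simp, ?_⟩
    intro j hj0 hj
    interval_cases j
    · refine tendsto_div_pow_nhdsGT (P := fun _ => -x) (fun e => ?_) (by fun_prop)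
        (by simp [cubicCoeff, hx])
      simp [diffCoeff, pow_succ]
    · refine tendsto_div_pow_nhdsGT (P := fun e => -1 - (-1 + e * x) ^ 2) (fun e => ?_)
        (by fun_prop) (by simp [cubicCoeff]; norm_num)
      simp [diffCoeff, pow_two]
  refine le_maxBifurcating (m := 3) (natDegree_polyField_zero_I _)
    (natDegree_polyField_zero_of_ne _ hI)
    (isWeakFocus_polyField (n := 2) two_pos (by norm_num) one_ne_zero (by simp) (by simp) ?_ ?_)
    (h.bifurcate (Eventually.of_forall fun e => rfl) (h.eventually_natDegree_inner hI)
      (fun i hi => cubicCoeff_zero hi) (fun i hi => cubicCoeff_simple (by norm_num) hi))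
  · intro j h0 h1
    interval_cases j
    simp [diffCoeff]
  · simp [diffCoeff, pow_two]
    norm_num

/-- The roles are exchanged: real `c` near `1` and `d = i`. The second coefficient is `2`, so `κ =
1`; the trace `b e²` enters the first coefficient only at higher order. -/
theorem three_le_maxBifurcating_two_one : 3 ≤ maxBifurcating 2 1 := by
  set x := -(6 * (growth - 1)) with hx
  have hI : (1 : ℂ) ≠ Complex.I := fun h => by simpa using congrArg Complex.re h
  have h : IsUnfolding 2 1 (-(11 * 1 * (growth ^ 2 - 1)) / Real.pi)
      (6 * 1 * (growth - 1) * growth) (fun e => ((1 + e * x : ℝ) : ℂ)) (fun _ => Complex.I)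
      1 Complex.I (cubicCoeff 1) := by
    set b := -(11 * 1 * (growth ^ 2 - 1)) / Real.pi
    refine ⟨two_pos, by norm_num, tendsto_nhdsGT_of_continuous (by fun_prop) (by simp),
      tendsto_const_nhds, by simp, by simp, ?_⟩
    intro j hj0 hj
    interval_cases j
    · refine tendsto_div_pow_nhdsGT (P := fun e => x + b * e) (fun e => ?_) (by fun_prop)
        (by simp [cubicCoeff, hx])
      simp [diffCoeff, pow_succ]
      ring
    · refine tendsto_div_pow_nhdsGT (P := fun e => (1 + e * x) ^ 2 + 1) (fun e => ?_)
        (by fun_prop) (by simp [cubicCoeff]; norm_num)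
      simp [diffCoeff, pow_two]
  refine le_maxBifurcating (m := 3) (natDegree_polyField_zero_of_ne _ hI)
    (natDegree_polyField_zero_I _)
    (isWeakFocus_polyField (n := 2) two_pos (by norm_num) one_ne_zero (by simp) (by simp) ?_ ?_)
    (h.bifurcate (h.eventually_natDegree_outer hI)
      (Eventually.of_forall fun e => natDegree_polyField_I_eq _ _ _)
      (fun i hi => cubicCoeff_zero hi) (fun i hi => cubicCoeff_simple one_ne_zero hi))
  · intro j h0 h1
    interval_cases j
    simp [diffCoeff]
  · simp [diffCoeff, pow_two]

/-- The coefficients for which the limit of the rescaled displacement function is a multiple of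
`(ρ - 1) (ρ - 2) (ρ - 3) (ρ - 4) / ρ`. -/
def quarticCoeff (j : ℕ) : ℝ :=
  if j = 1 then -(280 / 3 * (growth ^ 2 - growth + 1))
  else if j = 2 then 160 / 3 * (growth ^ 2 - growth + 1) / (growth - 1) else -8

/-- The third coefficient is fixed at `-8` by the weak focus of `four_le_maxBifurcating_two_two`, so
the limit is `K (ρ - 1)(ρ - 2)(ρ - 3)(ρ - 4)/ρ` with `K = 8/3 (q³ + 1)`. The other constants come
from comparing powers of `ρ`; the second one requires division by `q - 1`. -/
theorem quarticCoeff_zero {i : ℕ} (hi : i < 4) :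
    limitDiff 3 (64 * growth * (growth ^ 2 - growth + 1)) quarticCoeff
      (-(Real.exp (1 * Real.pi) * (i + 1))) -
    limitDiff 3 (64 * growth * (growth ^ 2 - growth + 1)) quarticCoeff (i + 1) +
      -(400 / 3 * (growth ^ 3 + 1)) / Real.pi * Real.pi = 0 := by
  have hq := one_lt_growth
  have hq1 : growth - 1 ≠ 0 := sub_ne_zero.2 hq.ne'
  have hπ := Real.pi_pos
  rw [← growth]
  interval_cases i <;>
  · simp [limitDiff, Finset.sum_range_succ, quarticCoeff]
    field_simp
    ring

theorem quarticCoeff_simple {i : ℕ} (hi : i < 4) :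
    limitDiffDeriv 3 (64 * growth * (growth ^ 2 - growth + 1)) quarticCoeff
      (-(Real.exp (1 * Real.pi) * (i + 1))) * Real.exp (1 * Real.pi) +
    limitDiffDeriv 3 (64 * growth * (growth ^ 2 - growth + 1)) quarticCoeff (i + 1) ≠ 0 := by
  have hq := one_lt_growth
  have hq1 : growth - 1 ≠ 0 := sub_ne_zero.2 hq.ne'
  have hY : 8 / 3 * (growth ^ 3 + 1) ≠ 0 := by positivity
  rw [← growth]
  interval_cases i
  · convert mul_ne_zero (show (6 : ℝ) ≠ 0 by norm_num) hY using 1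
    simp [limitDiffDeriv, Finset.sum_range_succ, quarticCoeff]; field_simp; ring
  · convert mul_ne_zero (show (-1 : ℝ) ≠ 0 by norm_num) hY using 1
    simp [limitDiffDeriv, Finset.sum_range_succ, quarticCoeff]; field_simp; ring
  · convert mul_ne_zero (show (2 / 3 : ℝ) ≠ 0 by norm_num) hY using 1
    simp [limitDiffDeriv, Finset.sum_range_succ, quarticCoeff]; field_simp; ring
  · convert mul_ne_zero (show (-3 / 2 : ℝ) ≠ 0 by norm_num) hY using 1
    simp [limitDiffDeriv, Finset.sum_range_succ, quarticCoeff]; field_simp; ring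

/-- At the base point `d` is minus the conjugate of `c = 1 + i`, so even coefficients cancel and odd
ones double. The first vanishes as `(1 + i)²` is imaginary, and the third is `2 (1 + i)⁴ = -8`. The
first coefficient varies with `Re c - Im c`, which is set to `e² x`; at first order the second
varies with `Im c` at rate `-4`, which explains `t = -X₂/2`. -/
theorem four_le_maxBifurcating_two_two : 4 ≤ maxBifurcating 2 2 := by
  set x := quarticCoeff 1 with hx
  set t := -(quarticCoeff 2 / 2) with ht
  have hIc : (1 + Complex.I : ℂ) ≠ Complex.I := fun h => by simpa using congrArg Complex.re h
  have hId : (-1 + Complex.I : ℂ) ≠ Complex.I := fun h => by simpa using congrArg Complex.re h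
  have hnc : ‖(1 + Complex.I : ℂ)‖ < 2 :=
    norm_lt_two_of_normSq_lt (by simp [Complex.normSq_apply]; norm_num)
  have hnd : ‖(-1 + Complex.I : ℂ)‖ < 2 :=
    norm_lt_two_of_normSq_lt (by simp [Complex.normSq_apply]; norm_num)
  have h : IsUnfolding 3 1 (-(400 / 3 * (growth ^ 3 + 1)) / Real.pi)
      (64 * growth * (growth ^ 2 - growth + 1))
      (fun e => ((1 + (e * t + e ^ 2 * x) / 2 : ℝ) : ℂ) +
        ((1 + (e * t - e ^ 2 * x) / 2 : ℝ) : ℂ) * Complex.I) (fun _ => -1 + Complex.I)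
      (1 + Complex.I) (-1 + Complex.I) quarticCoeff := by
    set b := -(400 / 3 * (growth ^ 3 + 1)) / Real.pi
    refine ⟨by norm_num, by norm_num, tendsto_nhdsGT_of_continuous (by fun_prop) (by simp),
      tendsto_const_nhds, hnc, hnd, ?_⟩
    intro j hj0 hj
    interval_cases j
    · refine tendsto_div_pow_nhdsGT (P := fun e => x + b * e) (fun e => ?_) (by fun_prop)
        (by simp [hx])
      simp [diffCoeff, pow_succ]
      ring
    · refine tendsto_div_pow_nhdsGT (P := fun e => -2 * t + e * (2 * x - t ^ 2 / 2 + e * t * x +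
        e ^ 2 * x ^ 2 / 2 - 2 * b * e)) (fun e => ?_) (by fun_prop) (by simp [ht]; ring)
      simp [diffCoeff, pow_succ]
      ring
    · have hP : Continuous fun e : ℝ => diffCoeff 1 (-1 + b * e ^ 3)
          (((1 + (e * t + e ^ 2 * x) / 2 : ℝ) : ℂ) +
            ((1 + (e * t - e ^ 2 * x) / 2 : ℝ) : ℂ) * Complex.I) (-1 + Complex.I) 3 := by
        unfold diffCoeff
        fun_prop
      refine tendsto_div_pow_nhdsGT (k := 0) (fun e => ?_) hP ?_
      · rw [pow_zero, one_mul]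
      · simp [diffCoeff, quarticCoeff, pow_succ]
        norm_num
  refine le_maxBifurcating (m := 4) (natDegree_polyField_zero_of_ne _ hIc)
    (natDegree_polyField_zero_of_ne _ hId)
    (isWeakFocus_polyField (n := 3) (by norm_num) (by norm_num) one_ne_zero hnc.le hnd.le ?_ ?_)
    (h.bifurcate (h.eventually_natDegree_outer hIc) (h.eventually_natDegree_inner hId)
      (fun i hi => quarticCoeff_zero hi) (fun i hi => quarticCoeff_simple hi))
  · intro j h0 h1
    interval_cases j
    · simp [diffCoeff]
    · simp [diffCoeff, pow_succ]
  · simp [diffCoeff, pow_succ]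
    norm_num

end CircleHolo

end

theorem theoremB :
    (∀ np nm : ℕ, CircleHolo.maxBifurcating np nm ≤ CircleHolo.maxLimitCycles np nm) ∧
    (∀ np nm : ℕ, (np = 1 ∨ np = 2) → (nm = 1 ∨ nm = 2) → np + nm ≤ 4 →
      ((np + nm : ℕ) : ℕ∞) ≤ CircleHolo.maxBifurcating np nm) ∧
    2 ≤ CircleHolo.maxBifurcating 1 1 ∧
    3 ≤ CircleHolo.maxBifurcating 1 2 ∧
    3 ≤ CircleHolo.maxBifurcating 2 1 ∧
    4 ≤ CircleHolo.maxBifurcating 2 2 := by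
  refine ⟨CircleHolo.maxBifurcating_le_maxLimitCycles, ?_,
    CircleHolo.two_le_maxBifurcating_one_one, CircleHolo.three_le_maxBifurcating_one_two,
    CircleHolo.three_le_maxBifurcating_two_one, CircleHolo.four_le_maxBifurcating_two_two⟩
  rintro np nm (rfl | rfl) (rfl | rfl) -
  · exact CircleHolo.two_le_maxBifurcating_one_one
  · exact CircleHolo.three_le_maxBifurcating_one_two
  · exact CircleHolo.three_le_maxBifurcating_two_one
  · exact CircleHolo.four_le_maxBifurcating_two_two
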